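/- Fix $D\ge 1$, weights $\alpha_1,\dots,\alpha_D>0$ with $\sum_c\alpha_c=1$, and a $D\times D$ matrix $g$ with positive real entries. For each $N$ let $J_N=(J_{ij})$ be an $N\times N$ random matrix with i.i.d. complex (in particular, possibly real) entries, all $J_N$ on one probability space, with $\mathbb E J_{ij}=0$, $\mathbb E|J_{ij}|^2=1/N$ and $N^2\,\mathbb E|J_{ij}|^4\le K$, where $K$ does not depend on $N$. (This holds if $J_{ij}=N^{-1/2}\xi_{ij}$ with $\xi_{ij}$ distributed as a fixed centred $\xi$ of unit variance and finite fourth moment; nothing is assumed about the joint law of different $J_N$.) For $1\le i\le N$ let $c_i$ be the unique $c$ with $i/N\in\big(\sum_{d<c}\alpha_d,\sum_{d\le c}\alpha_d\big]$, and let $X_N$ have the entries $X_{ij}=g_{c_ic_j}J_{ij}$. For $z,\eta\in\mathbb C$ put $q=\begin{pmatrix}\eta&z\\ \bar z&\eta\end{pmatrix}$ and $$R_N(q)=\begin{pmatrix}-\eta I_N&X_N-zI_N\\(X_N-zI_N)^*&-\eta I_N\end{pmatrix}^{-1}.$$ Divide both index sets $\{1,\dots,N\}$ of $R_N$ according to the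 value of $c_i$; this divides $R_N$ into $(2D)^2$ blocks $R_N^{cd}$, $1\le c,d\le 2D$. Let $M_N(q)$ be the $2D\times 2D$ matrix with entries $M_N^{cd}(q)=\frac1{\alpha_c}\cdot\frac1N\operatorname{Tr}R_N^{cd}(q)$, where $\alpha_{c+D}=\alpha_c$ and the trace of a rectangular block is the sum of its entries whose row and column numbers within the block are equal. Let $\Sigma$ be the linear map on $2D\times 2D$ matrices for which $\Sigma(A)$ is diagonal with $$\Sigma(A)_{cc}=\sum_{e=1}^D\alpha_e\,g_{ce}^2\,A_{e+D,e+D},\qquad \Sigma(A)_{c+D,c+D}=\sum_{e=1}^D\alpha_e\,g_{ec}^2\,A_{ee}\qquad(1\le c\le D).$$ Then for all $z\in\mathbb C$ and $\eta=\sqrt{-1}\,t$ with real $t\ne0$ the equation $$M=-(q\otimes I_D+\Sigma(M))^{-1}$$ has a unique solution $M=M(q)$ whose imaginary part $\frac1{2\sqrt{-1}}(M-M^*)$ is positive definite if $t>0$, respectively negative definite if $t<0$. Moreover, for every $T>0$ there is a deterministic constant $C$ such that almost surely, for all sufficiently large $N$ and all $z$, $t$ with $|z|<T$ and $0<|t|<T$,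 $$\|M_N(q)-M(q)\|\le C\,|t|^{-5}N^{-1/4},\qquad \eta=\sqrt{-1}\,t,$$ where $\|\cdot\|$ is the operator norm for the Euclidean norm. -/

import Mathlib

open MeasureTheory ProbabilityTheory Filter
open scoped ComplexOrder

noncomputable section

namespace BlockRandomMatrix

variable {D : ℕ}

/-- The partial sum `α_1 + ⋯ + α_m` of the weights. -/
def cumWeight (α : Fin D → ℝ) (m : ℕ) : ℝ :=
  ∑ d : Fin D with d.val < m, α d

/-- The block with label `c`: the indices `i ∈ {1, …, N}` with
`i / N ∈ (α_1 + ⋯ + α_{c-1}, α_1 + ⋯ + α_c]`. Indices and labels are numbered from `0` here. -/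
def block (α : Fin D → ℝ) (N : ℕ) (c : Fin D) : Finset (Fin N) :=
  open Classical in
  Finset.univ.filter fun i =>
    ((i.val + 1 : ℕ) : ℝ) / N ∈ Set.Ioc (cumWeight α c.val) (cumWeight α (c.val + 1))

/-- The number of indices in the block `c`. -/
def blockSize (α : Fin D → ℝ) (N : ℕ) (c : Fin D) : ℕ := (block α N c).card

/-- The `k`-th index of the block `c`, in increasing order. -/
def blockElem (α : Fin D → ℝ) (N : ℕ) (c : Fin D) : Fin (blockSize α N c) ↪o Fin N :=
  (block α N c).orderEmbOfFin rfl

/-- The blocks partition the index set. -/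
theorem existsUnique_mem_block (α : Fin D → ℝ) (hα : ∀ c, 0 < α c) (hsum : ∑ c, α c = 1)
    (N : ℕ) (i : Fin N) : ∃! c, i ∈ block α N c := by
  have hN : (0 : ℝ) < N := by exact_mod_cast i.pos
  set x : ℝ := ((i.val + 1 : ℕ) : ℝ) / N with hx
  have hx0 : 0 < x := by positivity
  have hx1 : x ≤ 1 := by
    rw [hx, div_le_one hN]
    exact_mod_cast i.isLt
  have hmono : Monotone (cumWeight α) := by
    intro a b hab
    refine Finset.sum_le_sum_of_subset_of_nonneg ?_ fun d _ _ => (hα d).le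
    intro d hd
    simp only [Finset.mem_filter, Finset.mem_univ, true_and] at hd ⊢
    omega
  have hex : ∃ m, x ≤ cumWeight α m := by
    refine ⟨D, ?_⟩
    have : cumWeight α D = 1 := by simp [cumWeight, hsum]
    rw [this]; exact hx1
  classical
  have hfind := Nat.find_spec hex
  have hmin := fun k => @Nat.find_min _ _ hex k
  have hle : Nat.find hex ≤ D := Nat.find_min' hex (by simpa [cumWeight, hsum] using hx1)
  have hpos : Nat.find hex ≠ 0 := by
    intro h0
    rw [h0] at hfind
    simp [cumWeight] at hfind
    linarith
  refine ⟨⟨Nat.find hex - 1, by omega⟩, ?_, ?_⟩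
  · simp only [block, Finset.mem_filter, Finset.mem_univ, true_and, Set.mem_Ioc]
    refine ⟨not_le.mp (hmin _ (by omega)), ?_⟩
    rw [Nat.sub_add_cancel (by omega)]
    exact hfind
  · intro d hd
    simp only [block, Finset.mem_filter, Finset.mem_univ, true_and, Set.mem_Ioc] at hd
    have h1 : Nat.find hex ≤ d.val + 1 := Nat.find_min' hex hd.2
    have h2 : d.val < Nat.find hex := by
      by_contra hcon
      exact absurd (hfind.trans (hmono (not_lt.mp hcon))) (not_le.mpr hd.1)
    ext
    simp only
    omega

/-- The matrix with entries `g_{c_i c_j} J_{ij}`, where `c_i` is the label of the block of `i`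
(the sum has exactly one nonzero term, as the blocks partition the index set). -/
def blockMatrix (α : Fin D → ℝ) (g : Fin D → Fin D → ℝ) {N : ℕ} (J : Fin N → Fin N → ℂ) :
    Matrix (Fin N) (Fin N) ℂ :=
  Matrix.of fun i j =>
    ∑ c, ∑ d, if i ∈ block α N c ∧ j ∈ block α N d then (g c d : ℂ) * J i j else 0

theorem blockMatrix_apply (α : Fin D → ℝ) (hα : ∀ c, 0 < α c) (hsum : ∑ c, α c = 1)
    (g : Fin D → Fin D → ℝ) {N : ℕ} (J : Fin N → Fin N → ℂ) {i j : Fin N} {c d : Fin D}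
    (hi : i ∈ block α N c) (hj : j ∈ block α N d) :
    blockMatrix α g J i j = (g c d : ℂ) * J i j := by
  have hc : ∀ c', i ∈ block α N c' ↔ c' = c := fun c' =>
    ⟨fun h => (existsUnique_mem_block α hα hsum N i).unique h hi, fun h => h ▸ hi⟩
  have hd : ∀ d', j ∈ block α N d' ↔ d' = d := fun d' =>
    ⟨fun h => (existsUnique_mem_block α hα hsum N j).unique h hj, fun h => h ▸ hj⟩
  simp [blockMatrix, hc, hd, ite_and]

/-- The resolvent `R_N(q)` of the Hermitization of `X - z`, where `q = (η, z; z̄, η)`. -/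
def resolvent {N : ℕ} (X : Matrix (Fin N) (Fin N) ℂ) (z η : ℂ) :
    Matrix (Fin N ⊕ Fin N) (Fin N ⊕ Fin N) ℂ :=
  (Matrix.fromBlocks
    (-(η • (1 : Matrix (Fin N) (Fin N) ℂ))) (X - z • (1 : Matrix (Fin N) (Fin N) ℂ))
    (X - z • (1 : Matrix (Fin N) (Fin N) ℂ)).conjTranspose
    (-(η • (1 : Matrix (Fin N) (Fin N) ℂ))))⁻¹

/-- The (unnormalized) trace of the possibly rectangular block `A^{cd}`: the sum of its entries
with equal row and column numbers. -/
def blockTrace (α : Fin D → ℝ) {N : ℕ} (A : Matrix (Fin N) (Fin N) ℂ) (c d : Fin D) : ℂ :=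
  ∑ k : Fin (min (blockSize α N c) (blockSize α N d)),
    A (blockElem α N c (k.castLE (min_le_left _ _))) (blockElem α N d (k.castLE (min_le_right _ _)))

/-- The `D × D` matrix with entries `(1 / α_c) tr_N (A^{cd})`, where `tr_N = (1 / N) Tr`. -/
def partialTrace (α : Fin D → ℝ) {N : ℕ} (A : Matrix (Fin N) (Fin N) ℂ) :
    Matrix (Fin D) (Fin D) ℂ :=
  Matrix.of fun c d => (1 / (α c : ℂ)) * ((1 / (N : ℂ)) * blockTrace α A c d)

/-- The `2D × 2D` matrix-valued Stieltjes transform `M_N(q)`. The index set `{1, …, 2D}` is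
`Fin D ⊕ Fin D`. -/
def stieltjes (α : Fin D → ℝ) {N : ℕ} (X : Matrix (Fin N) (Fin N) ℂ) (z η : ℂ) :
    Matrix (Fin D ⊕ Fin D) (Fin D ⊕ Fin D) ℂ :=
  Matrix.fromBlocks
    (partialTrace α (resolvent X z η).toBlocks₁₁) (partialTrace α (resolvent X z η).toBlocks₁₂)
    (partialTrace α (resolvent X z η).toBlocks₂₁) (partialTrace α (resolvent X z η).toBlocks₂₂)

/-- The matrix `q ⊗ I_D` with `q = (η, z; z̄, η)`. -/
def qTensorOne (D : ℕ) (z η : ℂ) : Matrix (Fin D ⊕ Fin D) (Fin D ⊕ Fin D) ℂ :=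
  Matrix.fromBlocks
    (η • (1 : Matrix (Fin D) (Fin D) ℂ)) (z • (1 : Matrix (Fin D) (Fin D) ℂ))
    (star z • (1 : Matrix (Fin D) (Fin D) ℂ)) (η • (1 : Matrix (Fin D) (Fin D) ℂ))

/-- The covariance map `Σ`: a diagonal matrix whose entry at `c` is
`∑_e α_e g_{ce}² A_{e+D,e+D}` in the upper half and `∑_e α_e g_{ec}² A_{e,e}` in the lower half. -/
def covMap (α : Fin D → ℝ) (g : Fin D → Fin D → ℝ)
    (A : Matrix (Fin D ⊕ Fin D) (Fin D ⊕ Fin D) ℂ) :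
    Matrix (Fin D ⊕ Fin D) (Fin D ⊕ Fin D) ℂ :=
  Matrix.diagonal (Sum.elim
    (fun c => ∑ e, ((α e * g c e ^ 2 : ℝ) : ℂ) * A (Sum.inr e) (Sum.inr e))
    (fun c => ∑ e, ((α e * g e c ^ 2 : ℝ) : ℂ) * A (Sum.inl e) (Sum.inl e)))

/-- The imaginary part `(A - A^*) / (2 √-1)` of a matrix. -/
def imPart {n : Type*} (A : Matrix n n ℂ) : Matrix n n ℂ :=
  (1 / (2 * Complex.I)) • (A - A.conjTranspose)

/-- `M` solves `M = -(q ⊗ I_D + Σ(M))⁻¹` at `η = √-1 t`, and its imaginary part is definite with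
the sign of `t`: positive definite for `t > 0` and negative definite for `t < 0`. -/
def IsLimitSolution (α : Fin D → ℝ) (g : Fin D → Fin D → ℝ) (z : ℂ) (t : ℝ)
    (M : Matrix (Fin D ⊕ Fin D) (Fin D ⊕ Fin D) ℂ) : Prop :=
  M = -(qTensorOne D z (Complex.I * t) + covMap α g M)⁻¹ ∧
    (t • imPart M).PosDef

/-- The operator norm of a square matrix with respect to the Euclidean norm. -/
def opNorm {n : Type*} [Fintype n] [DecidableEq n] (A : Matrix n n ℂ) : ℝ :=
  ‖Matrix.toEuclideanCLM (n := n) (𝕜 := ℂ) A‖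

end BlockRandomMatrix

end

noncomputable section

set_option linter.unusedSectionVars false

namespace BlockRandomMatrix

/-! ### The scalar fixed point equation -/

section FixedPoint

variable {ι : Type*} [Fintype ι]

/-! At `η = √-1 t` with `t > 0` the solution has diagonal `√-1 x` with `x > 0`. The limit equation
splits into `2 × 2` problems for each label, and reduces to the scalar system `x i = 1 / (S i + |z|²
/ S (σ i))`, where `S = t + Γ x` and `σ` exchanges the two halves. The right hand side contracts
ratios. If `x` and `y` agree up to a factor `1 + θ`, then `S` at `x` and at `y` agree up to `1 + (1
- δ) θ`, because the summand `t` does not scale and makes up at least the fraction `δ` of `S`;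
passing from `S` to the right hand side preserves this factor. Iteration gives a fixed point
(`exists_dysonMap_fixedPoint`), and the same contraction shows that an approximate fixed point is
near the true one, with a loss polynomial in `1 / t` (`dysonMap_stability`).

Uniqueness has to be shown among all definite `M`, whose diagonal is not known to be imaginary. With
`Q` the matrix inverted in the equation, `M - M' = M (Q - Q') M'`, and `M (Q - Q*) M* = M - M*` is
the equation for the imaginary parts. Comparing `|M i i - M' i i|` with the geometric mean of the
two imaginary parts at a maximal index, Cauchy–Schwarz gives a strict contradiction unless the
diagonals agree (`isLimitSolution_unique`).

On the random side, the Schur complement at an index `k` of the Hermitization is a `2 × 2` linear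
system. Its self-energies are quadratic forms in row and column `k` of `X`, with coefficients taken
from the resolvent with index `k` removed. These are independent of row and column `k`, so second
moment estimates show that the forms are close in mean to their traces
(`norm_green_sub_le_cavityError`, `IsNoise.integral_cavityError_le`). Changing one row of `X` is a
perturbation of bounded rank, so partial traces change by `O(1 / (N t))`, and McDiarmid's inequality
gives concentration. Together these make the expected diagonal an approximate fixed point with error
`O(t⁻³ N^(-1/2))`, and stability gives an error `O(t⁻⁹ N^(-1/2))` for the expectation as long as
`t⁸` exceeds a multiple of `N^(-1/2)`.

In that range `N^(-1/4) ≤ t⁴`, which turns the bound into `t⁻⁵ N^(-1/4)`; for smaller `t` the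
trivial bound `O(t⁻¹)` is already of this size. Uniformity in `z` and `t` comes from a grid of
spacing `1 / N`, Borel–Cantelli and the Lipschitz continuity of the resolvent. Negative `t` reduces
to positive `t` by the chiral symmetry `green_herm_neg`. -/

/-- The affine self-energy `t + ∑ j, Γ i j * x j`. -/
def selfEnergy (Γ : ι → ι → ℝ) (t : ℝ) (x : ι → ℝ) (i : ι) : ℝ := t + ∑ j, Γ i j * x j

/-- The map `x ↦ 1 / (S x i + r / S x (σ i))` whose fixed point is the diagonal of the limit. -/
def dysonMap (Γ : ι → ι → ℝ) (σ : ι → ι) (r t : ℝ) (x : ι → ℝ) (i : ι) : ℝ :=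
  (selfEnergy Γ t x i + r / selfEnergy Γ t x (σ i))⁻¹

variable {Γ : ι → ι → ℝ} {σ : ι → ι} {r t κ : ℝ}

lemma le_selfEnergy (hΓ : ∀ i j, 0 ≤ Γ i j) {x : ι → ℝ} (hx : ∀ i, 0 ≤ x i) (i : ι) :
    t ≤ selfEnergy Γ t x i :=
  le_add_of_nonneg_right (Finset.sum_nonneg fun j _ => mul_nonneg (hΓ i j) (hx j))

lemma selfEnergy_le (hΓ : ∀ i j, 0 ≤ Γ i j) (hκ : ∀ i, ∑ j, Γ i j ≤ κ) {L : ℝ} (hL : 0 ≤ L)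
    {x : ι → ℝ} (hx : ∀ i, x i ≤ L) (i : ι) : selfEnergy Γ t x i ≤ t + κ * L := by
  have h1 : ∑ j, Γ i j * x j ≤ (∑ j, Γ i j) * L := by
    rw [Finset.sum_mul]
    exact Finset.sum_le_sum fun j _ => mul_le_mul_of_nonneg_left (hx j) (hΓ i j)
  have h2 := mul_le_mul_of_nonneg_right (hκ i) hL
  unfold selfEnergy
  linarith

lemma dysonMap_pos (hΓ : ∀ i j, 0 ≤ Γ i j) (hr : 0 ≤ r) (ht : 0 < t) {x : ι → ℝ}
    (hx : ∀ i, 0 ≤ x i) (i : ι) : 0 < dysonMap Γ σ r t x i := by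
  have h1 := le_selfEnergy (t := t) hΓ hx i
  have h2 := le_selfEnergy (t := t) hΓ hx (σ i)
  exact inv_pos.2 (add_pos_of_pos_of_nonneg (by linarith) (div_nonneg hr (by linarith)))

lemma dysonMap_le (hΓ : ∀ i j, 0 ≤ Γ i j) (hr : 0 ≤ r) (ht : 0 < t) {x : ι → ℝ}
    (hx : ∀ i, 0 ≤ x i) (i : ι) : dysonMap Γ σ r t x i ≤ t⁻¹ := by
  have h1 := le_selfEnergy (t := t) hΓ hx i
  have h2 := le_selfEnergy (t := t) hΓ hx (σ i)
  have h3 : 0 ≤ r / selfEnergy Γ t x (σ i) := div_nonneg hr (by linarith)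
  exact inv_anti₀ ht (by linarith)

lemma le_dysonMap (hΓ : ∀ i j, 0 ≤ Γ i j) (hκ : ∀ i, ∑ j, Γ i j ≤ κ) (hr : 0 ≤ r) (ht : 0 < t)
    {L : ℝ} (hL : 0 ≤ L) {x : ι → ℝ} (hx : ∀ i, 0 ≤ x i) (hxL : ∀ i, x i ≤ L) (i : ι) :
    (t + κ * L + r / t)⁻¹ ≤ dysonMap Γ σ r t x i := by
  have h1 := le_selfEnergy (t := t) hΓ hx i
  have h2 := le_selfEnergy (t := t) hΓ hx (σ i)
  have h3 : 0 ≤ r / selfEnergy Γ t x (σ i) := div_nonneg hr (by linarith)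
  have h4 : r / selfEnergy Γ t x (σ i) ≤ r / t := div_le_div_of_nonneg_left hr ht h2
  have h5 := selfEnergy_le (t := t) hΓ hκ hL hxL i
  exact inv_anti₀ (by linarith) (by linarith)

/-- Only the linear part of the self-energy scales with `x`. The constant `t` is at least the
fraction `δ` of the total, so at most the fraction `1 - δ` of the excess `θ` survives. -/
lemma selfEnergy_ratio (hΓ : ∀ i j, 0 ≤ Γ i j) {δ θ : ℝ} (hθ : 0 ≤ θ) {x y : ι → ℝ}
    (hxy : ∀ i, x i ≤ (1 + θ) * y i) (hy : ∀ i, δ * selfEnergy Γ t y i ≤ t) (i : ι) :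
    selfEnergy Γ t x i ≤ (1 + (1 - δ) * θ) * selfEnergy Γ t y i := by
  have h1 : ∑ j, Γ i j * x j ≤ (1 + θ) * ∑ j, Γ i j * y j := by
    rw [Finset.mul_sum]
    refine Finset.sum_le_sum fun j _ => ?_
    calc Γ i j * x j ≤ Γ i j * ((1 + θ) * y j) := mul_le_mul_of_nonneg_left (hxy j) (hΓ i j)
      _ = _ := by ring
  have h2 := mul_le_mul_of_nonneg_left (hy i) hθ
  unfold selfEnergy at *
  nlinarith

/-- The map `dysonMap` contracts ratios. -/
lemma dysonMap_ratio (hΓ : ∀ i j, 0 ≤ Γ i j) (hr : 0 ≤ r) (ht : 0 < t) {δ θ : ℝ} (hδ : δ ≤ 1)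
    (hθ : 0 ≤ θ) {x y : ι → ℝ} (hx0 : ∀ i, 0 ≤ x i) (hy0 : ∀ i, 0 ≤ y i)
    (hxy : ∀ i, x i ≤ (1 + θ) * y i) (hyx : ∀ i, y i ≤ (1 + θ) * x i)
    (hx : ∀ i, δ * selfEnergy Γ t x i ≤ t) (hy : ∀ i, δ * selfEnergy Γ t y i ≤ t) (i : ι) :
    dysonMap Γ σ r t y i ≤ (1 + (1 - δ) * θ) * dysonMap Γ σ r t x i := by
  have hl : 0 < 1 + (1 - δ) * θ := by nlinarith
  have h1 := selfEnergy_ratio hΓ hθ hxy hy i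
  have h2 := selfEnergy_ratio hΓ hθ hyx hx (σ i)
  have px := le_selfEnergy (t := t) hΓ hx0
  have py := le_selfEnergy (t := t) hΓ hy0
  have pxs : 0 < selfEnergy Γ t x (σ i) := ht.trans_le (px _)
  have pys : 0 < selfEnergy Γ t y (σ i) := ht.trans_le (py _)
  -- The term `r / S (σ i)` is decreasing in the self-energy, so it uses the comparison in the
  -- opposite direction, with the same factor; this is why both `hxy` and `hyx` are needed.
  have h3 : r / selfEnergy Γ t x (σ i) ≤ (1 + (1 - δ) * θ) * (r / selfEnergy Γ t y (σ i)) := by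
    rw [← mul_div_assoc, div_le_div_iff₀ pxs pys]
    nlinarith
  have p1 : 0 < selfEnergy Γ t x i + r / selfEnergy Γ t x (σ i) :=
    add_pos_of_pos_of_nonneg (ht.trans_le (px _)) (div_nonneg hr pxs.le)
  have p2 : 0 < selfEnergy Γ t y i + r / selfEnergy Γ t y (σ i) :=
    add_pos_of_pos_of_nonneg (ht.trans_le (py _)) (div_nonneg hr pys.le)
  unfold dysonMap
  rw [← div_eq_mul_inv, le_div_iff₀ p1, inv_mul_le_iff₀ p2]
  nlinarith

lemma abs_sub_le_of_ratio {θ L a b : ℝ} (hθ : 0 ≤ θ) (hab : a ≤ (1 + θ) * b)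
    (hba : b ≤ (1 + θ) * a) (haL : a ≤ L) (hbL : b ≤ L) : |a - b| ≤ θ * L := by
  rw [abs_le]
  constructor <;> nlinarith

/-- The iterates starting from the constant `t⁻¹` stay between two positive bounds, and by
`dysonMap_ratio` the ratios of consecutive iterates approach `1` geometrically. So the sequence is
Cauchy, and its limit is fixed by continuity. -/
theorem exists_dysonMap_fixedPoint (hΓ : ∀ i j, 0 ≤ Γ i j) (hr : 0 ≤ r) (ht : 0 < t) :
    ∃ x : ι → ℝ, (∀ i, 0 < x i) ∧ dysonMap Γ σ r t x = x := by
  classical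
  obtain ⟨κ, hκ0, hκ⟩ : ∃ κ : ℝ, 0 ≤ κ ∧ ∀ i, ∑ j, Γ i j ≤ κ := by
    refine ⟨∑ i, ∑ j, Γ i j, ?_, fun i => ?_⟩
    · exact Finset.sum_nonneg fun i _ => Finset.sum_nonneg fun j _ => hΓ i j
    · exact Finset.single_le_sum (f := fun i => ∑ j, Γ i j)
        (fun i _ => Finset.sum_nonneg fun j _ => hΓ i j) (Finset.mem_univ i)
  have hL : 0 < t⁻¹ := inv_pos.2 ht
  set B : ℝ := t + κ * t⁻¹ + r / t with hB
  have hBpos : 0 < B := by positivity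
  set F := dysonMap Γ σ r t with hF
  let x : ℕ → ι → ℝ := fun n => F^[n] (fun _ => t⁻¹)
  have hxs : ∀ n, x (n + 1) = F (x n) := fun n => Function.iterate_succ_apply' F n _
  have hx0 : ∀ n i, 0 ≤ x n i := by
    intro n
    induction n with
    | zero => exact fun i => hL.le
    | succ n ih => intro i; rw [hxs]; exact (dysonMap_pos hΓ hr ht ih i).le
  have hxL : ∀ n i, x n i ≤ t⁻¹ := by
    intro n
    cases n with
    | zero => exact fun i => le_rfl
    | succ n => intro i; rw [hxs]; exact dysonMap_le hΓ hr ht (hx0 n) i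
  have hBx : ∀ n i, B⁻¹ ≤ x (n + 1) i := fun n i => by
    rw [hxs]; exact le_dysonMap hΓ hκ hr ht hL.le (hx0 n) (hxL n) i
  -- All iterates are at most `t⁻¹`, so `t + κ * t⁻¹` bounds their self-energies and `t` is at least
  -- the fraction `δ` of each.
  set δ : ℝ := t / (t + κ * t⁻¹) with hδ
  have hδpos : 0 < δ := by positivity
  have hδ1 : δ ≤ 1 := by
    rw [hδ, div_le_one (by positivity)]
    have : 0 ≤ κ * t⁻¹ := by positivity
    linarith
  have hδS : ∀ n i, δ * selfEnergy Γ t (x n) i ≤ t := fun n i => by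
    have h := selfEnergy_le (t := t) hΓ hκ hL.le (hxL n) i
    calc δ * selfEnergy Γ t (x n) i ≤ δ * (t + κ * t⁻¹) := mul_le_mul_of_nonneg_left h hδpos.le
      _ = t := div_mul_cancel₀ _ (by positivity)
  -- The first two iterates lie between `B⁻¹` and `t⁻¹`, so `B * t⁻¹` bounds their ratio.
  set θ : ℝ := B * t⁻¹ with hθ
  have hθpos : 0 < θ := by positivity
  have key : ∀ n, (∀ i, x (n + 1) i ≤ (1 + (1 - δ) ^ n * θ) * x n i) ∧
      ∀ i, x n i ≤ (1 + (1 - δ) ^ n * θ) * x (n + 1) i := by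
    intro n
    induction n with
    | zero =>
      have h0 : ∀ i, x 0 i = t⁻¹ := fun i => rfl
      refine ⟨fun i => ?_, fun i => ?_⟩
      · have := hxL 1 i
        rw [h0]
        nlinarith
      · have h1 : 1 ≤ B * x 1 i := by
          have := mul_le_mul_of_nonneg_left (hBx 0 i) hBpos.le
          rwa [mul_inv_cancel₀ hBpos.ne'] at this
        rw [h0]
        have h3 := hx0 1 i
        have h2 : t⁻¹ ≤ θ * x 1 i := by rw [hθ]; nlinarith
        simp only [pow_zero, one_mul]
        nlinarith
    | succ n ih =>
      have hθn : 0 ≤ (1 - δ) ^ n * θ := mul_nonneg (pow_nonneg (by linarith) _) hθpos.le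
      refine ⟨fun i => ?_, fun i => ?_⟩
      · have := dysonMap_ratio (σ := σ) hΓ hr ht hδ1 hθn (hx0 n) (hx0 (n + 1)) ih.2 ih.1
          (hδS n) (hδS (n + 1)) i
        rw [hxs (n + 1), pow_succ', mul_assoc]
        conv_rhs => rw [hxs n]
        exact this
      · have := dysonMap_ratio (σ := σ) hΓ hr ht hδ1 hθn (hx0 (n + 1)) (hx0 n) ih.1 ih.2
          (hδS (n + 1)) (hδS n) i
        rw [hxs (n + 1), pow_succ', mul_assoc]
        conv_lhs => rw [hxs n]
        exact this
  have hcauchy : CauchySeq x := by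
    refine cauchySeq_of_le_geometric (1 - δ) (θ * t⁻¹) (by linarith) fun n => ?_
    have hθn : 0 ≤ (1 - δ) ^ n * θ := mul_nonneg (pow_nonneg (by linarith) _) hθpos.le
    refine (dist_pi_le_iff (mul_nonneg (by positivity) (pow_nonneg (by linarith) _))).2 fun i => ?_
    rw [Real.dist_eq]
    refine (abs_sub_le_of_ratio hθn ((key n).2 i) ((key n).1 i) (hxL n i)
      (hxL (n + 1) i)).trans (le_of_eq (by ring))
  obtain ⟨y, hy⟩ := cauchySeq_tendsto_of_complete hcauchy
  have hyi : ∀ i, Tendsto (fun n => x n i) atTop (nhds (y i)) := fun i => tendsto_pi_nhds.1 hy i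
  have hyB : ∀ i, B⁻¹ ≤ y i := fun i =>
    ge_of_tendsto ((tendsto_add_atTop_iff_nat 1).2 (hyi i)) (Eventually.of_forall fun n => hBx n i)
  have hypos : ∀ i, 0 < y i := fun i => (inv_pos.2 hBpos).trans_le (hyB i)
  refine ⟨y, hypos, funext fun i => ?_⟩
  have hS : ∀ i, Tendsto (fun n => selfEnergy Γ t (x n) i) atTop (nhds (selfEnergy Γ t y i)) :=
    fun i => tendsto_const_nhds.add (tendsto_finsetSum _ fun j _ => (hyi j).const_mul _)
  have hSp : ∀ i, 0 < selfEnergy Γ t y i := fun i =>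
    ht.trans_le (le_selfEnergy hΓ (fun i => (hypos i).le) i)
  have hFy : Tendsto (fun n => x (n + 1) i) atTop (nhds (F y i)) := by
    have : (fun n => x (n + 1) i) = fun n => F (x n) i := funext fun n => by rw [hxs]
    rw [this]
    refine ((hS i).add (tendsto_const_nhds.div (hS (σ i)) (hSp _).ne')).inv₀ ?_
    exact (add_pos_of_pos_of_nonneg (hSp i) (div_nonneg hr (hSp _).le)).ne'
  exact tendsto_nhds_unique hFy ((tendsto_add_atTop_iff_nat 1).2 (hyi i))

/-- Stability of the fixed point equation in terms of ratios. -/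
theorem dysonMap_stability (hΓ : ∀ i j, 0 ≤ Γ i j) (hr : 0 ≤ r) (ht : 0 < t) {δ η L : ℝ}
    (hδ0 : 0 < δ) (hδ : δ ≤ 1) {x y : ι → ℝ} (hx0 : ∀ i, 0 ≤ x i) (hy0 : ∀ i, 0 ≤ y i)
    (hxL : ∀ i, x i ≤ L) (hyL : ∀ i, y i ≤ L)
    (hx : ∀ i, δ * selfEnergy Γ t x i ≤ t) (hy : ∀ i, δ * selfEnergy Γ t y i ≤ t)
    (hfix : dysonMap Γ σ r t y = y) (hη : η ≤ δ / 4)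
    (happrox : ∀ i, |x i - dysonMap Γ σ r t x i| ≤ η * dysonMap Γ σ r t x i) (i : ι) :
    |x i - y i| ≤ 4 * η / δ * L := by
  classical
  set F := dysonMap Γ σ r t with hF
  have hFx : ∀ i, 0 < F x i := fun i => dysonMap_pos hΓ hr ht hx0 i
  have hyp : ∀ i, 0 < y i := fun i => by rw [← hfix]; exact dysonMap_pos hΓ hr ht hy0 i
  have hη0 : 0 ≤ η := nonneg_of_mul_nonneg_left ((abs_nonneg _).trans (happrox i)) (hFx i)
  have hxl : ∀ i, (1 - η) * F x i ≤ x i := fun i => by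
    have := (abs_le.1 (happrox i)).1; linarith
  have hxu : ∀ i, x i ≤ (1 + η) * F x i := fun i => by
    have := (abs_le.1 (happrox i)).2; linarith
  have hxp : ∀ i, 0 < x i := fun i =>
    lt_of_lt_of_le (mul_pos (by linarith) (hFx i)) (hxl i)
  -- The largest ratio `ρ` of `x` and `y`, in either direction, is attained at `k`. Contraction
  -- there gives `ρ ≤ (1 + (1 - δ) (ρ - 1)) (1 + 2 η)`; for `η ≤ δ / 4` the term with `η (ρ - 1)`
  -- takes up at most half of the gain `δ (ρ - 1)`, and `ρ - 1 ≤ 4 η / δ` remains.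
  obtain ⟨k, -, hk⟩ := Finset.exists_max_image Finset.univ
    (fun i => max (x i / y i) (y i / x i)) ⟨i, Finset.mem_univ i⟩
  set ρ : ℝ := max (x k / y k) (y k / x k) with hρ
  have hxy : ∀ j, x j ≤ (1 + (ρ - 1)) * y j := fun j => by
    have := (le_max_left _ _).trans (hk j (Finset.mem_univ j))
    rw [div_le_iff₀ (hyp j)] at this
    linarith
  have hyx : ∀ j, y j ≤ (1 + (ρ - 1)) * x j := fun j => by
    have := (le_max_right _ _).trans (hk j (Finset.mem_univ j))
    rw [div_le_iff₀ (hxp j)] at this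
    linarith
  have hρ1 : 0 ≤ ρ - 1 := by
    by_contra hcon
    push Not at hcon
    have h1 := hxy k
    have h2 := hyx k
    nlinarith [hxp k, hyp k]
  have r1 := dysonMap_ratio (σ := σ) hΓ hr ht hδ hρ1 hx0 hy0 hxy hyx hx hy k
  have r2 := dysonMap_ratio (σ := σ) hΓ hr ht hδ hρ1 hy0 hx0 hyx hxy hy hx k
  rw [← hF, hfix] at r1 r2
  have hlam : 1 ≤ 1 + (1 - δ) * (ρ - 1) := by nlinarith
  set lam : ℝ := 1 + (1 - δ) * (ρ - 1) with hlamdef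
  have hρle : ρ ≤ lam * (1 + 2 * η) := by
    refine max_le ?_ ?_
    · rw [div_le_iff₀ (hyp k)]
      have h1 := hxu k
      have h2 : (1 + η) * F x k ≤ (1 + η) * (lam * y k) :=
        mul_le_mul_of_nonneg_left r2 (by linarith)
      have h3 : 0 ≤ η * (lam * y k) := mul_nonneg hη0 (mul_nonneg (by linarith) (hyp k).le)
      nlinarith
    · rw [div_le_iff₀ (hxp k)]
      have h1 := hxl k
      -- This is `1 ≤ (1 + 2 η) (1 - η)`, valid because `η ≤ 1 / 2`.
      have h4 : F x k ≤ (1 + 2 * η) * x k := by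
        have h5 : (1 + 2 * η) * ((1 - η) * F x k) ≤ (1 + 2 * η) * x k :=
          mul_le_mul_of_nonneg_left h1 (by linarith)
        have h6 : 0 ≤ η * (1 - 2 * η) * F x k :=
          mul_nonneg (mul_nonneg hη0 (by linarith)) (hFx k).le
        nlinarith
      calc y k ≤ lam * F x k := r1
        _ ≤ lam * ((1 + 2 * η) * x k) := mul_le_mul_of_nonneg_left h4 (by linarith)
        _ = lam * (1 + 2 * η) * x k := by ring
  have hθ : ρ - 1 ≤ 4 * η / δ := by
    rw [le_div_iff₀ hδ0]
    have h1 : lam * (1 + 2 * η) = 1 + (1 - δ) * (ρ - 1) + 2 * η + 2 * η * (1 - δ) * (ρ - 1) := by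
      rw [hlamdef]; ring
    have h2 : 2 * η * (1 - δ) * (ρ - 1) ≤ δ / 2 * (ρ - 1) := by
      refine mul_le_mul_of_nonneg_right ?_ hρ1
      nlinarith
    nlinarith
  have hL : 0 ≤ L := (hx0 i).trans (hxL i)
  exact (abs_sub_le_of_ratio hρ1 (hxy i) (hyx i) (hxL i) (hyL i)).trans
    (mul_le_mul_of_nonneg_right hθ hL)

/-- The Lipschitz constant does not depend on `r`, hence later not on `z`. With `w = a b + r`, the
difference is exactly a combination of `a' - a` and `b - b'` with coefficients `b b' / (w w')` and
`r / (w w')`. Both are at most `1 / t²`, as `w w'` dominates `a b a' b'` as well as `r a b`. -/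
lemma abs_inv_add_div_sub_le {a b a' b' : ℝ} (hr : 0 ≤ r) (ht : 0 < t) (ha : t ≤ a) (hb : t ≤ b)
    (ha' : t ≤ a') (hb' : t ≤ b') :
    |(a + r / b)⁻¹ - (a' + r / b')⁻¹| ≤ (|a - a'| + |b - b'|) / t ^ 2 := by
  have pa : 0 < a := by linarith
  have pb : 0 < b := by linarith
  have pa' : 0 < a' := by linarith
  have pb' : 0 < b' := by linarith
  have hw : 0 < a * b + r := by positivity
  have hw' : 0 < a' * b' + r := by positivity
  have e : (a + r / b)⁻¹ - (a' + r / b')⁻¹ =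
      (b * b' / ((a * b + r) * (a' * b' + r))) * (a' - a)
        + (r / ((a * b + r) * (a' * b' + r))) * (b - b') := by
    field_simp
    ring
  have h1 : b * b' / ((a * b + r) * (a' * b' + r)) ≤ 1 / t ^ 2 := by
    rw [div_le_div_iff₀ (by positivity) (by positivity), one_mul, sq]
    have : b * b' * (t * t) ≤ b * b' * (a * a') := by gcongr
    have h2 : 0 ≤ a * b * r + r * (a' * b') + r * r := by positivity
    nlinarith
  have h2 : r / ((a * b + r) * (a' * b' + r)) ≤ 1 / t ^ 2 := by
    rw [div_le_div_iff₀ (by positivity) (by positivity), one_mul, sq]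
    have h3 : r * (t * t) ≤ r * (a * b) := by gcongr
    have h2 : 0 ≤ a * b * (a' * b') + r * (a' * b') + r * r := by positivity
    nlinarith
  rw [e]
  refine (abs_add_le _ _).trans ?_
  rw [abs_mul, abs_mul, abs_of_nonneg (by positivity), abs_of_nonneg (a := r / _) (by positivity),
    abs_sub_comm a' a]
  calc _ ≤ 1 / t ^ 2 * |a - a'| + 1 / t ^ 2 * |b - b'| := by gcongr
    _ = _ := by ring

/-- The counterpart for the off-diagonal entries, whose numerator is `z`. The factor `ζ` is absorbed
by one denominator: `a b + ζ² ≥ t² + ζ² ≥ t ζ`. -/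
lemma abs_inv_mul_add_sub_le {a b a' b' ζ : ℝ} (hζ : 0 ≤ ζ) (ht : 0 < t) (ha : t ≤ a) (hb : t ≤ b)
    (ha' : t ≤ a') (hb' : t ≤ b') :
    ζ * |(a * b + ζ ^ 2)⁻¹ - (a' * b' + ζ ^ 2)⁻¹| ≤ (|a - a'| + |b - b'|) / t ^ 2 := by
  have pa : 0 < a := by linarith
  have pb : 0 < b := by linarith
  have pa' : 0 < a' := by linarith
  have pb' : 0 < b' := by linarith
  have hw : 0 < a * b + ζ ^ 2 := by positivity
  have hw' : 0 < a' * b' + ζ ^ 2 := by positivity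
  have e : (a * b + ζ ^ 2)⁻¹ - (a' * b' + ζ ^ 2)⁻¹ =
      (a' / (a' * b' + ζ ^ 2) / (a * b + ζ ^ 2)) * (b' - b)
        + (b / (a * b + ζ ^ 2) / (a' * b' + ζ ^ 2)) * (a' - a) := by
    field_simp
    ring
  have k1 : a' / (a' * b' + ζ ^ 2) ≤ 1 / t := by
    rw [div_le_div_iff₀ hw' ht]; nlinarith [sq_nonneg ζ]
  have k2 : b / (a * b + ζ ^ 2) ≤ 1 / t := by
    rw [div_le_div_iff₀ hw ht]; nlinarith [sq_nonneg ζ]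
  have k3 : ζ / (a * b + ζ ^ 2) ≤ 1 / t := by
    rw [div_le_div_iff₀ hw ht]; nlinarith [sq_nonneg (ζ - t), mul_le_mul ha hb ht.le pa.le]
  have k4 : ζ / (a' * b' + ζ ^ 2) ≤ 1 / t := by
    rw [div_le_div_iff₀ hw' ht]; nlinarith [sq_nonneg (ζ - t), mul_le_mul ha' hb' ht.le pa'.le]
  rw [e]
  calc _ ≤ ζ * ((a' / (a' * b' + ζ ^ 2) / (a * b + ζ ^ 2)) * |b' - b|
        + (b / (a * b + ζ ^ 2) / (a' * b' + ζ ^ 2)) * |a' - a|) := by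
        refine mul_le_mul_of_nonneg_left ((abs_add_le _ _).trans (le_of_eq ?_)) hζ
        rw [abs_mul, abs_mul, abs_of_nonneg (by positivity),
          abs_of_nonneg (a := b / _ / _) (by positivity)]
    _ = a' / (a' * b' + ζ ^ 2) * (ζ / (a * b + ζ ^ 2)) * |b - b'|
        + b / (a * b + ζ ^ 2) * (ζ / (a' * b' + ζ ^ 2)) * |a - a'| := by
        rw [abs_sub_comm b', abs_sub_comm a']; ring
    _ ≤ 1 / t * (1 / t) * |b - b'| + 1 / t * (1 / t) * |a - a'| := by gcongr
    _ = _ := by ring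

end FixedPoint

/-! ### The limit equation -/

section LimitEquation

variable {D : ℕ}

/-- The kernel of the covariance map on the diagonal. -/
def covKernel (α : Fin D → ℝ) (g : Fin D → Fin D → ℝ) : Fin D ⊕ Fin D → Fin D ⊕ Fin D → ℝ
  | Sum.inl c, Sum.inr e => α e * g c e ^ 2
  | Sum.inr c, Sum.inl e => α e * g e c ^ 2
  | _, _ => 0

variable {α : Fin D → ℝ} {g : Fin D → Fin D → ℝ}

lemma covKernel_nonneg (hα : ∀ c, 0 < α c) (i j : Fin D ⊕ Fin D) : 0 ≤ covKernel α g i j := by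
  rcases i with i | i <;> rcases j with j | j <;> simp only [covKernel, le_refl]
  · exact mul_nonneg (hα _).le (sq_nonneg _)
  · exact mul_nonneg (hα _).le (sq_nonneg _)

lemma covMap_eq (A : Matrix (Fin D ⊕ Fin D) (Fin D ⊕ Fin D) ℂ) :
    covMap α g A = Matrix.diagonal fun i => ∑ j, (covKernel α g i j : ℂ) * A j j := by
  unfold covMap
  congr 1
  funext i
  rcases i with i | i <;> simp [covKernel]

/-- For a singular matrix `⁻¹` takes the value `0`, so `M` would vanish, and the imaginary part of
`0` is not definite. The index `i` is there to exclude an empty index set. -/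
lemma isUnit_det_of_isLimitSolution {z : ℂ} {t : ℝ}
    {M : Matrix (Fin D ⊕ Fin D) (Fin D ⊕ Fin D) ℂ} (h : IsLimitSolution α g z t M)
    (i : Fin D ⊕ Fin D) : IsUnit (qTensorOne D z (Complex.I * t) + covMap α g M).det := by
  by_contra hcon
  have h1 := h.1
  rw [Matrix.nonsing_inv_apply_not_isUnit _ hcon, neg_zero] at h1
  have h2 := h.2.diag_pos (i := i)
  rw [h1] at h2
  simp [imPart] at h2

lemma diag_pos_of_isLimitSolution {z : ℂ} {t : ℝ}
    {M : Matrix (Fin D ⊕ Fin D) (Fin D ⊕ Fin D) ℂ} (h : IsLimitSolution α g z t M)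
    (i : Fin D ⊕ Fin D) : 0 < t * (M i i).im := by
  have h2 := h.2.diag_pos (i := i)
  have e : (t • imPart M) i i = ((t * (M i i).im : ℝ) : ℂ) := by
    simp only [imPart, Matrix.smul_apply, Matrix.sub_apply, Matrix.conjTranspose_apply,
      Complex.star_def, Complex.sub_conj, Complex.real_smul, smul_eq_mul]
    push_cast
    field_simp
  rw [e] at h2
  exact_mod_cast h2

/-- The part of `q` with `z` and `z̄` is Hermitian and cancels, and the covariance map has diagonal
values. So the denominator has a diagonal imaginary part, which depends on `M` only through the
imaginary parts of its diagonal. -/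
lemma sub_conjTranspose_eq (z : ℂ) (t : ℝ) (M : Matrix (Fin D ⊕ Fin D) (Fin D ⊕ Fin D) ℂ) :
    (qTensorOne D z (Complex.I * t) + covMap α g M) -
      (qTensorOne D z (Complex.I * t) + covMap α g M).conjTranspose =
    Matrix.diagonal fun i => ((2 * selfEnergy (covKernel α g) t (fun j => (M j j).im) i : ℝ) : ℂ)
      * Complex.I := by
  have h1 : qTensorOne D z (Complex.I * t) - (qTensorOne D z (Complex.I * t)).conjTranspose =
      Matrix.diagonal fun _ => ((2 * t : ℝ) : ℂ) * Complex.I := by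
    ext i j
    rcases i with i | i <;> rcases j with j | j <;> by_cases hij : i = j <;>
      simp [qTensorOne, hij, eq_comm] <;> ring
  have h2 : covMap α g M - (covMap α g M).conjTranspose =
      Matrix.diagonal fun i => ((2 * ∑ j, covKernel α g i j * (M j j).im : ℝ) : ℂ)
        * Complex.I := by
    rw [covMap_eq, Matrix.diagonal_conjTranspose, Matrix.diagonal_sub]
    congr 1
    funext i
    simp only [Pi.star_apply, Complex.star_def, Complex.sub_conj]
    simp [Complex.im_sum]
  rw [Matrix.conjTranspose_add, add_sub_add_comm, h1, h2, Matrix.diagonal_add]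
  congr 1
  funext i
  simp only [selfEnergy]
  push_cast
  ring

/-- Multiplying `Q - Q*` by `M` on one side and `M*` on the other gives `M - M*`, in either order;
these are the diagonal entries. Uniqueness applies the row form to one solution and the column form
to the other. -/
lemma im_diag_eq {z : ℂ} {t : ℝ} {M : Matrix (Fin D ⊕ Fin D) (Fin D ⊕ Fin D) ℂ}
    (h : IsLimitSolution α g z t M) (i : Fin D ⊕ Fin D) :
    (M i i).im = ∑ k, ‖M i k‖ ^ 2 * selfEnergy (covKernel α g) t (fun j => (M j j).im) k ∧
    (M i i).im = ∑ k, ‖M k i‖ ^ 2 * selfEnergy (covKernel α g) t (fun j => (M j j).im) k := by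
  set Q := qTensorOne D z (Complex.I * t) + covMap α g M with hQ
  have hu := isUnit_det_of_isLimitSolution h i
  have hM : M = -Q⁻¹ := h.1
  have hMQ : M * Q = -1 := by rw [hM, neg_mul, Matrix.nonsing_inv_mul _ hu]
  have hQM : Q * M = -1 := by rw [hM, mul_neg, Matrix.mul_nonsing_inv _ hu]
  have hMQ' : Q.conjTranspose * M.conjTranspose = -1 := by
    rw [← Matrix.conjTranspose_mul, hMQ]; simp
  have hQM' : M.conjTranspose * Q.conjTranspose = -1 := by
    rw [← Matrix.conjTranspose_mul, hQM]; simp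
  have e1 : M * (Q - Q.conjTranspose) * M.conjTranspose = M - M.conjTranspose := by
    rw [mul_sub, sub_mul, hMQ, mul_assoc M, hMQ']; simp; abel
  have e2 : M.conjTranspose * (Q - Q.conjTranspose) * M = M - M.conjTranspose := by
    rw [mul_sub, sub_mul, hQM', mul_assoc _ Q, hQM]; simp; abel
  rw [hQ, sub_conjTranspose_eq] at e1 e2
  have d1 := congrFun (congrFun e1 i) i
  have d2 := congrFun (congrFun e2 i) i
  set s := selfEnergy (covKernel α g) t (fun j => (M j j).im) with hs
  rw [Matrix.mul_apply] at d1 d2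
  simp only [Matrix.mul_diagonal, Matrix.sub_apply, Matrix.conjTranspose_apply, Complex.star_def,
    Complex.sub_conj] at d1 d2
  have t1 : ∀ k, M i k * (((2 * s k : ℝ) : ℂ) * Complex.I) * (starRingEnd ℂ) (M i k) =
      ((2 * (‖M i k‖ ^ 2 * s k) : ℝ) : ℂ) * Complex.I := fun k => by
    have := Complex.mul_conj' (M i k)
    push_cast at this ⊢
    linear_combination (2 * (s k : ℂ) * Complex.I) * this
  have t2 : ∀ k, (starRingEnd ℂ) (M k i) * (((2 * s k : ℝ) : ℂ) * Complex.I) * M k i =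
      ((2 * (‖M k i‖ ^ 2 * s k) : ℝ) : ℂ) * Complex.I := fun k => by
    have := Complex.mul_conj' (M k i)
    push_cast at this ⊢
    linear_combination (2 * (s k : ℂ) * Complex.I) * this
  simp only [t1] at d1
  simp only [t2] at d2
  rw [← Finset.sum_mul, ← Complex.ofReal_sum, ← Finset.mul_sum] at d1 d2
  have d1' := mul_right_cancel₀ Complex.I_ne_zero d1
  have d2' := mul_right_cancel₀ Complex.I_ne_zero d2
  have d1'' := Complex.ofReal_injective d1'
  have d2'' := Complex.ofReal_injective d2'
  constructor <;> linarith

/-- A definite solution of the limit equation is unique. -/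
theorem isLimitSolution_unique (hα : ∀ c, 0 < α c) {z : ℂ} {t : ℝ} (ht : t ≠ 0)
    {M M' : Matrix (Fin D ⊕ Fin D) (Fin D ⊕ Fin D) ℂ}
    (h : IsLimitSolution α g z t M) (h' : IsLimitSolution α g z t M') : M = M' := by
  classical
  rcases isEmpty_or_nonempty (Fin D ⊕ Fin D) with he | hne
  · exact Subsingleton.elim _ _
  set Γ := covKernel α g with hΓdef
  have hΓ : ∀ i j, 0 ≤ Γ i j := covKernel_nonneg hα
  set Q := qTensorOne D z (Complex.I * t) + covMap α g M with hQ
  set Q' := qTensorOne D z (Complex.I * t) + covMap α g M' with hQ'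
  have i0 : Fin D ⊕ Fin D := Classical.arbitrary _
  have hMQ : M * Q = -1 := by
    conv_lhs => rw [h.1]
    rw [neg_mul, Matrix.nonsing_inv_mul _ (isUnit_det_of_isLimitSolution h i0)]
  have hQM : Q' * M' = -1 := by
    conv_lhs => rw [h'.1]
    rw [mul_neg, Matrix.mul_nonsing_inv _ (isUnit_det_of_isLimitSolution h' i0)]
  have hdiff : M - M' = M * (Q - Q') * M' := by
    rw [mul_sub, sub_mul, hMQ, mul_assoc M, hQM]; simp; abel
  have hQQ : Q - Q' = Matrix.diagonal fun i => ∑ j, (Γ i j : ℂ) * (M j j - M' j j) := by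
    rw [hQ, hQ', add_sub_add_left_eq_sub, covMap_eq, covMap_eq, Matrix.diagonal_sub]
    congr 1
    funext i
    rw [← Finset.sum_sub_distrib]
    simp only [mul_sub, hΓdef]
  set Δ : Fin D ⊕ Fin D → ℝ := fun i => ‖M i i - M' i i‖ with hΔ
  have hΔle : ∀ i, Δ i ≤ ∑ k, ‖M i k‖ * ‖M' k i‖ * ∑ j, Γ k j * Δ j := by
    intro i
    have e := congrFun (congrFun hdiff i) i
    rw [hQQ, Matrix.mul_apply] at e
    simp only [Matrix.mul_diagonal, Matrix.sub_apply] at e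
    simp only [hΔ]
    rw [e]
    refine (norm_sum_le _ _).trans (Finset.sum_le_sum fun k _ => ?_)
    rw [norm_mul, norm_mul]
    have : ‖∑ j, (Γ k j : ℂ) * (M j j - M' j j)‖ ≤ ∑ j, Γ k j * ‖M j j - M' j j‖ := by
      refine (norm_sum_le _ _).trans (Finset.sum_le_sum fun j _ => ?_)
      rw [norm_mul, Complex.norm_real, Real.norm_of_nonneg (hΓ k j)]
    calc _ ≤ ‖M i k‖ * (∑ j, Γ k j * ‖M j j - M' j j‖) * ‖M' k i‖ := by gcongr
      _ = _ := by ring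
  set p : Fin D ⊕ Fin D → ℝ := fun i => t * (M i i).im with hp
  set p' : Fin D ⊕ Fin D → ℝ := fun i => t * (M' i i).im with hp'
  have pp : ∀ i, 0 < p i := diag_pos_of_isLimitSolution h
  have pp' : ∀ i, 0 < p' i := diag_pos_of_isLimitSolution h'
  have hS : ∀ (A : Matrix (Fin D ⊕ Fin D) (Fin D ⊕ Fin D) ℂ) k,
      t * selfEnergy Γ t (fun j => (A j j).im) k
        = t ^ 2 + ∑ j, Γ k j * (t * (A j j).im) := by
    intro A k
    simp only [selfEnergy, mul_add, Finset.mul_sum]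
    congr 1
    · ring
    · exact Finset.sum_congr rfl fun j _ => by ring
  have hpeq : ∀ i, p i = ∑ k, ‖M i k‖ ^ 2 * (t ^ 2 + ∑ j, Γ k j * p j) := by
    intro i
    simp only [hp]
    rw [(im_diag_eq h i).1, Finset.mul_sum]
    refine Finset.sum_congr rfl fun k _ => ?_
    rw [← hS M k]; ring
  have hpeq' : ∀ i, p' i = ∑ k, ‖M' k i‖ ^ 2 * (t ^ 2 + ∑ j, Γ k j * p' j) := by
    intro i
    simp only [hp']
    rw [(im_diag_eq h' i).2, Finset.mul_sum]
    refine Finset.sum_congr rfl fun k _ => ?_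
    rw [← hS M' k]; ring
  -- `Δ` is measured in units of the geometric mean of `p` and `p'`. At an index with the largest
  -- quotient `θ`, Cauchy–Schwarz for the sum over `j` and then for the sum over `k` reproduces the
  -- equations of `p` and `p'`, without their `t²` terms.
  obtain ⟨m, -, hm⟩ := Finset.exists_max_image Finset.univ
    (fun i => Δ i / (√(p i) * √(p' i))) Finset.univ_nonempty
  set θ := Δ m / (√(p m) * √(p' m)) with hθ
  have hw : ∀ i, 0 < √(p i) * √(p' i) := fun i =>
    mul_pos (Real.sqrt_pos.2 (pp i)) (Real.sqrt_pos.2 (pp' i))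
  have hΔθ : ∀ i, Δ i ≤ θ * (√(p i) * √(p' i)) := fun i =>
    (div_le_iff₀ (hw i)).1 (hm i (Finset.mem_univ i))
  have hθ0 : 0 ≤ θ := div_nonneg (norm_nonneg _) (hw m).le
  have hσ : ∀ k, ∑ j, Γ k j * Δ j ≤ θ * (√(∑ j, Γ k j * p j) * √(∑ j, Γ k j * p' j)) := by
    intro k
    calc ∑ j, Γ k j * Δ j ≤ ∑ j, θ * (√(Γ k j * p j) * √(Γ k j * p' j)) := by
          refine Finset.sum_le_sum fun j _ => ?_
          rw [Real.sqrt_mul (hΓ k j), Real.sqrt_mul (hΓ k j)]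
          have e : √(Γ k j) * √(Γ k j) = Γ k j := Real.mul_self_sqrt (hΓ k j)
          calc Γ k j * Δ j ≤ Γ k j * (θ * (√(p j) * √(p' j))) :=
                mul_le_mul_of_nonneg_left (hΔθ j) (hΓ k j)
            _ = (√(Γ k j) * √(Γ k j)) * (θ * (√(p j) * √(p' j))) := by rw [e]
            _ = _ := by ring
      _ = θ * ∑ j, √(Γ k j * p j) * √(Γ k j * p' j) := by rw [Finset.mul_sum]
      _ ≤ _ := mul_le_mul_of_nonneg_left (Real.sum_sqrt_mul_sqrt_le _
          (fun j => mul_nonneg (hΓ k j) (pp j).le) (fun j => mul_nonneg (hΓ k j) (pp' j).le)) hθ0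
  have hsum_nn : ∀ k, 0 ≤ ∑ j, Γ k j * p j := fun k =>
    Finset.sum_nonneg fun j _ => mul_nonneg (hΓ k j) (pp j).le
  have hsum_nn' : ∀ k, 0 ≤ ∑ j, Γ k j * p' j := fun k =>
    Finset.sum_nonneg fun j _ => mul_nonneg (hΓ k j) (pp' j).le
  have ht2 : 0 < t ^ 2 := by positivity
  -- The omitted term `t²` makes this strict, since `M m m ≠ 0`; the strictness is what forces `θ =
  -- 0`.
  have hrow : ∑ k, ‖M m k‖ ^ 2 * ∑ j, Γ k j * p j < p m := by
    have e := hpeq m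
    simp only [mul_add, Finset.sum_add_distrib] at e
    have : 0 < ∑ k, ‖M m k‖ ^ 2 * t ^ 2 := by
      rw [← Finset.sum_mul]
      refine mul_pos (Finset.sum_pos' (fun k _ => sq_nonneg _) ⟨m, Finset.mem_univ m, ?_⟩) ht2
      have : M m m ≠ 0 := fun h0 => by
        have := pp m
        simp [hp, h0] at this
      positivity
    linarith
  have hcol : ∑ k, ‖M' k m‖ ^ 2 * ∑ j, Γ k j * p' j ≤ p' m := by
    rw [hpeq' m]
    refine Finset.sum_le_sum fun k _ => ?_
    gcongr
    linarith
  have hfin : Δ m ≤ θ * (√(∑ k, ‖M m k‖ ^ 2 * ∑ j, Γ k j * p j)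
      * √(∑ k, ‖M' k m‖ ^ 2 * ∑ j, Γ k j * p' j)) := by
    calc Δ m ≤ ∑ k, ‖M m k‖ * ‖M' k m‖ *
          (θ * (√(∑ j, Γ k j * p j) * √(∑ j, Γ k j * p' j))) :=
          (hΔle m).trans (Finset.sum_le_sum fun k _ =>
            mul_le_mul_of_nonneg_left (hσ k) (by positivity))
      _ = θ * ∑ k, √(‖M m k‖ ^ 2 * ∑ j, Γ k j * p j) * √(‖M' k m‖ ^ 2 * ∑ j, Γ k j * p' j) := by
          rw [Finset.mul_sum]
          refine Finset.sum_congr rfl fun k _ => ?_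
          rw [Real.sqrt_mul (sq_nonneg _), Real.sqrt_mul (sq_nonneg _),
            Real.sqrt_sq (norm_nonneg _), Real.sqrt_sq (norm_nonneg _)]
          ring
      _ ≤ _ := mul_le_mul_of_nonneg_left (Real.sum_sqrt_mul_sqrt_le _
          (fun k => mul_nonneg (sq_nonneg _) (hsum_nn k))
          (fun k => mul_nonneg (sq_nonneg _) (hsum_nn' k))) hθ0
  have hθz : θ = 0 := by
    by_contra hne0
    have hθp : 0 < θ := lt_of_le_of_ne hθ0 (Ne.symm hne0)
    have h1 : Δ m = θ * (√(p m) * √(p' m)) := by rw [hθ, div_mul_cancel₀ _ (hw m).ne']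
    have h2 : √(∑ k, ‖M m k‖ ^ 2 * ∑ j, Γ k j * p j)
        * √(∑ k, ‖M' k m‖ ^ 2 * ∑ j, Γ k j * p' j) < √(p m) * √(p' m) :=
      calc _ ≤ √(∑ k, ‖M m k‖ ^ 2 * ∑ j, Γ k j * p j) * √(p' m) := by
            gcongr
        _ < _ := mul_lt_mul_of_pos_right (Real.sqrt_lt_sqrt
            (Finset.sum_nonneg fun k _ => mul_nonneg (sq_nonneg _) (hsum_nn k)) hrow)
            (Real.sqrt_pos.2 (pp' m))
    have h3 := mul_lt_mul_of_pos_left h2 hθp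
    linarith
  have hdiag : ∀ i, M i i = M' i i := fun i => by
    have h1 := hΔθ i
    rw [hθz, zero_mul] at h1
    exact sub_eq_zero.1 (norm_eq_zero.1 (le_antisymm h1 (norm_nonneg _)))
  have hcov : covMap α g M = covMap α g M' := by
    rw [covMap_eq, covMap_eq]
    simp only [hdiag]
  rw [h.1, h'.1, hcov]

/-- The solution of the limit equation built from a fixed point `x` of `dysonMap`; the sign
`s = ±1` is that of `t`. -/
def limitMatrix (α : Fin D → ℝ) (g : Fin D → Fin D → ℝ) (z : ℂ) (s t : ℝ)
    (x : Fin D ⊕ Fin D → ℝ) : Matrix (Fin D ⊕ Fin D) (Fin D ⊕ Fin D) ℂ :=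
  let S := selfEnergy (covKernel α g) t x
  let w : Fin D → ℂ := fun c => ((S (Sum.inl c) * S (Sum.inr c) + ‖z‖ ^ 2 : ℝ) : ℂ)
  Matrix.fromBlocks
    (Matrix.diagonal fun c => Complex.I * (s * x (Sum.inl c) : ℝ))
    (Matrix.diagonal fun c => -(z * (w c)⁻¹))
    (Matrix.diagonal fun c => -(star z * (w c)⁻¹))
    (Matrix.diagonal fun c => Complex.I * (s * x (Sum.inr c) : ℝ))

lemma dysonMap_swap {Γ : Fin D ⊕ Fin D → Fin D ⊕ Fin D → ℝ} {r t : ℝ}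
    {x : Fin D ⊕ Fin D → ℝ} (h : ∀ i, 0 < selfEnergy Γ t x i) (i : Fin D ⊕ Fin D) :
    dysonMap Γ Sum.swap r t x i = selfEnergy Γ t x i.swap *
      (selfEnergy Γ t x i * selfEnergy Γ t x i.swap + r)⁻¹ := by
  have h2 := h i.swap
  unfold dysonMap
  rw [← div_eq_mul_inv]
  rw [← inv_div]
  field_simp

/-- Every block is diagonal, so for each label `c` the claim is the inversion of the `2 × 2` matrix
with diagonal `√-1 s S`, `√-1 s S'` and off-diagonal entries `z`, `z̄`. As `s² = 1`, its determinant
is `-(S S' + |z|²)` for both signs. -/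
theorem isLimitSolution_limitMatrix (hα : ∀ c, 0 < α c) (z : ℂ) {s t : ℝ} (ht : 0 < t)
    (hs : s = 1 ∨ s = -1) {x : Fin D ⊕ Fin D → ℝ} (hx : ∀ i, 0 < x i)
    (hfix : dysonMap (covKernel α g) Sum.swap (‖z‖ ^ 2) t x = x) :
    IsLimitSolution α g z (s * t) (limitMatrix α g z s t x) := by
  have hs2 : s * s = 1 := by rcases hs with rfl | rfl <;> norm_num
  set S := selfEnergy (covKernel α g) t x with hS
  have hSp : ∀ i, 0 < S i := fun i =>
    ht.trans_le (le_selfEnergy (covKernel_nonneg hα) (fun i => (hx i).le) i)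
  have hw : ∀ c : Fin D, ((S (Sum.inl c) * S (Sum.inr c) + ‖z‖ ^ 2 : ℝ) : ℂ) ≠ 0 := fun c => by
    have h1 := hSp (Sum.inl c)
    have h2 := hSp (Sum.inr c)
    exact_mod_cast (by positivity : S (Sum.inl c) * S (Sum.inr c) + ‖z‖ ^ 2 ≠ 0)
  have hxl : ∀ c : Fin D, (x (Sum.inl c) : ℂ) = S (Sum.inr c) *
      ((S (Sum.inl c) * S (Sum.inr c) + ‖z‖ ^ 2 : ℝ) : ℂ)⁻¹ := fun c => by
    have := dysonMap_swap (r := ‖z‖ ^ 2) hSp (Sum.inl c)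
    rw [hfix] at this
    rw [this]; push_cast; rfl
  have hxr : ∀ c : Fin D, (x (Sum.inr c) : ℂ) = S (Sum.inl c) *
      ((S (Sum.inl c) * S (Sum.inr c) + ‖z‖ ^ 2 : ℝ) : ℂ)⁻¹ := fun c => by
    have := dysonMap_swap (r := ‖z‖ ^ 2) hSp (Sum.inr c)
    rw [hfix] at this
    rw [this, mul_comm (selfEnergy _ _ _ (Sum.inr c))]; push_cast; rfl
  have hdl : ∀ c, limitMatrix α g z s t x (Sum.inl c) (Sum.inl c)
      = Complex.I * (s * x (Sum.inl c) : ℝ) := fun c => by simp [limitMatrix]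
  have hdr : ∀ c, limitMatrix α g z s t x (Sum.inr c) (Sum.inr c)
      = Complex.I * (s * x (Sum.inr c) : ℝ) := fun c => by simp [limitMatrix]
  have hd : ∀ j, limitMatrix α g z s t x j j = Complex.I * (s * x j : ℝ) := by
    rintro (c | c)
    exacts [hdl c, hdr c]
  have hQ : qTensorOne D z (Complex.I * ((s * t : ℝ) : ℂ)) + covMap α g (limitMatrix α g z s t x)
      = Matrix.fromBlocks
        (Matrix.diagonal fun c => Complex.I * s * (S (Sum.inl c) : ℂ)) (Matrix.diagonal fun _ => z)
        (Matrix.diagonal fun _ => star z)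
        (Matrix.diagonal fun c => Complex.I * s * (S (Sum.inr c) : ℂ)) := by
    rw [covMap_eq]
    have hsum : ∀ i, ∑ j, (covKernel α g i j : ℂ) * limitMatrix α g z s t x j j =
        Complex.I * s * ((∑ j, covKernel α g i j * x j : ℝ) : ℂ) := fun i => by
      push_cast
      rw [Finset.mul_sum]
      refine Finset.sum_congr rfl fun j _ => ?_
      rw [hd j]; push_cast; ring
    simp only [hsum]
    ext i j
    rcases i with i | i <;> rcases j with j | j <;> by_cases hij : i = j <;>
      simp [qTensorOne, hij, hS, selfEnergy] <;> ring
  have hzz : z * star z = ((‖z‖ ^ 2 : ℝ) : ℂ) := by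
    rw [Complex.star_def, Complex.mul_conj']; push_cast; rfl
  have hzz' : star z * z = ((‖z‖ ^ 2 : ℝ) : ℂ) := by rw [mul_comm, hzz]
  have hs2' : (s : ℂ) * s = 1 := by exact_mod_cast hs2
  refine ⟨?_, ?_⟩
  · have hinv : (qTensorOne D z (Complex.I * ((s * t : ℝ) : ℂ))
        + covMap α g (limitMatrix α g z s t x)) * (-limitMatrix α g z s t x) = 1 := by
      rw [hQ, limitMatrix, Matrix.fromBlocks_neg, Matrix.fromBlocks_multiply,
        ← Matrix.fromBlocks_one]
      simp only [Matrix.diagonal_mul_diagonal, Matrix.diagonal_add, Matrix.diagonal_neg,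
        ← Matrix.diagonal_one, ← Matrix.diagonal_zero]
      have hv : ∀ c : Fin D, ((S (Sum.inl c) : ℂ) * S (Sum.inr c) + z * star z) *
          ((S (Sum.inl c) * S (Sum.inr c) + ‖z‖ ^ 2 : ℝ) : ℂ)⁻¹ = 1 := fun c => by
        rw [hzz]
        have := mul_inv_cancel₀ (hw c)
        push_cast at this ⊢
        exact this
      congr 2 <;> funext c <;> simp only [Complex.ofReal_mul s, hxl, hxr, ← hS]
      · linear_combination hv c - ((S (Sum.inl c) : ℂ) * S (Sum.inr c) *
          ((S (Sum.inl c) * S (Sum.inr c) + ‖z‖ ^ 2 : ℝ) : ℂ)⁻¹) *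
          (Complex.I ^ 2 * hs2' + Complex.I_sq)
      · ring
      · ring
      · linear_combination hv c - ((S (Sum.inl c) : ℂ) * S (Sum.inr c) *
          ((S (Sum.inl c) * S (Sum.inr c) + ‖z‖ ^ 2 : ℝ) : ℂ)⁻¹) *
          (Complex.I ^ 2 * hs2' + Complex.I_sq)
    rw [Matrix.inv_eq_right_inv hinv, neg_neg]
  · have himp : (s * t) • imPart (limitMatrix α g z s t x)
        = Matrix.diagonal fun i => ((t * x i : ℝ) : ℂ) := by
      have e : ∀ y : ℝ, ((s : ℂ) * t) * (1 / (2 * Complex.I) * (Complex.I * ((s * y : ℝ) : ℂ) -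
          star (Complex.I * ((s * y : ℝ) : ℂ)))) = ((t * y : ℝ) : ℂ) := fun y => by
        simp only [Complex.star_def, map_mul, Complex.conj_I, Complex.conj_ofReal]
        push_cast
        field_simp
        linear_combination ((y : ℂ) * 2) * hs2'
      ext i j
      rcases i with i | i <;> rcases j with j | j <;> by_cases hij : i = j
      · subst hij
        have := e (x (Sum.inl i))
        simpa [imPart, limitMatrix] using this
      · simp [imPart, limitMatrix, hij, Ne.symm hij]
      · simp [imPart, limitMatrix, hij]
      · simp [imPart, limitMatrix, hij, Ne.symm hij]
      · simp [imPart, limitMatrix, hij]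
      · simp [imPart, limitMatrix, hij, Ne.symm hij]
      · subst hij
        have := e (x (Sum.inr i))
        simpa [imPart, limitMatrix] using this
      · simp [imPart, limitMatrix, hij, Ne.symm hij]
    rw [himp]
    refine Matrix.PosDef.diagonal fun i => ?_
    exact_mod_cast mul_pos ht (hx i)

end LimitEquation

/-! ### Resolvents of Hermitian matrices -/

section Green

open scoped Matrix Matrix.Norms.L2Operator

variable {n : Type*} [Fintype n] [DecidableEq n]

/-- The resolvent `(H - √-1 t)⁻¹`. -/
def green (H : Matrix n n ℂ) (t : ℝ) : Matrix n n ℂ :=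
  (H - (Complex.I * t) • (1 : Matrix n n ℂ))⁻¹

variable {H H' : Matrix n n ℂ} {t t' : ℝ}

lemma isUnit_det_sub_smul (hH : H.IsHermitian) (ht : t ≠ 0) :
    IsUnit (H - (Complex.I * t) • (1 : Matrix n n ℂ)).det := by
  rw [← Matrix.isUnit_iff_isUnit_det]
  have hsa : IsSelfAdjoint H := hH
  have h : (Complex.I * t) ∉ spectrum ℂ H := fun hmem => by
    have := hsa.mem_spectrum_eq_re hmem
    have h2 := congrArg Complex.im this
    simp at h2
    exact ht h2
  rw [spectrum.notMem_iff, Algebra.algebraMap_eq_smul_one] at h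
  rw [← neg_sub]
  exact h.neg

lemma green_mul (hH : H.IsHermitian) (ht : t ≠ 0) :
    green H t * (H - (Complex.I * t) • (1 : Matrix n n ℂ)) = 1 :=
  Matrix.nonsing_inv_mul _ (isUnit_det_sub_smul hH ht)

lemma mul_green (hH : H.IsHermitian) (ht : t ≠ 0) :
    (H - (Complex.I * t) • (1 : Matrix n n ℂ)) * green H t = 1 :=
  Matrix.mul_nonsing_inv _ (isUnit_det_sub_smul hH ht)

lemma green_conjTranspose (hH : H.IsHermitian) : (green H t)ᴴ = green H (-t) := by
  unfold green
  rw [Matrix.conjTranspose_nonsing_inv]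
  congr 1
  rw [Matrix.conjTranspose_sub, hH.eq, Matrix.conjTranspose_smul, Matrix.conjTranspose_one]
  simp

lemma green_sub_green (hH : H.IsHermitian) (hH' : H'.IsHermitian) (ht : t ≠ 0) (ht' : t' ≠ 0) :
    green H t - green H' t' =
      green H t * ((H' - H) + (Complex.I * ((t - t' : ℝ) : ℂ)) • 1) * green H' t' := by
  have e : (H' - H) + (Complex.I * ((t - t' : ℝ) : ℂ)) • (1 : Matrix n n ℂ) =
      (H' - (Complex.I * t') • (1 : Matrix n n ℂ)) - (H - (Complex.I * t) • 1) := by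
    push_cast
    rw [mul_sub, sub_smul]
    abel
  rw [e, mul_sub, sub_mul, green_mul hH ht, mul_assoc, mul_green hH' ht', mul_one, one_mul]

/-- The Ward identity: the adjoint is the resolvent at `-t`, so this is the resolvent identity
between `t` and `-t`. -/
lemma green_ward (hH : H.IsHermitian) (ht : t ≠ 0) :
    green H t - (green H t)ᴴ = (2 * Complex.I * t) • (green H t * (green H t)ᴴ) ∧
    green H t - (green H t)ᴴ = (2 * Complex.I * t) • ((green H t)ᴴ * green H t) := by
  rw [green_conjTranspose hH]
  constructor
  · rw [green_sub_green hH hH ht (neg_ne_zero.2 ht)]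
    simp only [sub_self, zero_add, mul_smul_comm, mul_one, smul_mul_assoc]
    congr 1
    push_cast
    ring
  · rw [← neg_sub, green_sub_green hH hH (neg_ne_zero.2 ht) ht]
    simp only [sub_self, zero_add, mul_smul_comm, mul_one, smul_mul_assoc, ← neg_smul]
    congr 1
    push_cast
    ring

/-- By the Ward identity and the C*-identity `2 |t| ‖G‖² = ‖G - G*‖ ≤ 2 ‖G‖`. -/
lemma norm_green_le (hH : H.IsHermitian) (ht : t ≠ 0) : ‖green H t‖ ≤ |t|⁻¹ := by
  rcases (norm_nonneg (green H t)).eq_or_lt with h0 | hpos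
  · rw [← h0]; positivity
  have h1 := congrArg norm (green_ward hH ht).1
  rw [norm_smul, ← Matrix.star_eq_conjTranspose, CStarRing.norm_self_mul_star] at h1
  have h2 : ‖(2 * Complex.I * t : ℂ)‖ = 2 * |t| := by simp
  have h3 : ‖green H t - star (green H t)‖ ≤ 2 * ‖green H t‖ :=
    (norm_sub_le _ _).trans (by rw [norm_star]; linarith)
  rw [h1, h2] at h3
  have ht' : 0 < |t| := abs_pos.2 ht
  rw [← one_div, le_div_iff₀ ht']
  by_contra hcon
  push Not at hcon
  nlinarith

lemma norm_toLp_col_le (A : Matrix n n ℂ) (j : n) : ∑ i, ‖A i j‖ ^ 2 ≤ ‖A‖ ^ 2 := by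
  have h := Matrix.l2_opNorm_mulVec A (EuclideanSpace.single j (1 : ℂ))
  rw [PiLp.norm_single, norm_one, mul_one] at h
  have h2 := pow_le_pow_left₀ (norm_nonneg _) h 2
  rw [EuclideanSpace.norm_sq_eq] at h2
  simpa using h2

lemma norm_entry_le (A : Matrix n n ℂ) (i j : n) : ‖A i j‖ ≤ ‖A‖ := by
  have h := norm_toLp_col_le A j
  have h1 : ‖A i j‖ ^ 2 ≤ ∑ i, ‖A i j‖ ^ 2 :=
    Finset.single_le_sum (f := fun i => ‖A i j‖ ^ 2) (fun i _ => sq_nonneg _) (Finset.mem_univ i)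
  exact le_of_sq_le_sq (h1.trans h) (norm_nonneg _)

lemma norm_le_sum_entries (A : Matrix n n ℂ) : ‖A‖ ≤ ∑ i, ∑ j, ‖A i j‖ := by
  have h : A = ∑ i, ∑ j, Matrix.single i j (A i j) := Matrix.matrix_eq_sum_single A
  conv_lhs => rw [h]
  refine (norm_sum_le _ _).trans (Finset.sum_le_sum fun i _ => ?_)
  refine (norm_sum_le _ _).trans (Finset.sum_le_sum fun j _ => ?_)
  have h1 := Matrix.l2_opNorm_conjTranspose_mul_self (Matrix.single i j (A i j))
  rw [Matrix.conjTranspose_single, Matrix.single_mul_single_same, ← Matrix.diagonal_single,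
    Matrix.l2_opNorm_diagonal, Pi.norm_single, norm_mul, norm_star] at h1
  exact (mul_self_inj_of_nonneg (norm_nonneg _) (norm_nonneg _)).1 h1 |>.ge

lemma matrix_rank_add_le (A B : Matrix n n ℂ) : (A + B).rank ≤ A.rank + B.rank := by
  have h : LinearMap.range (A + B).mulVecLin ≤
      LinearMap.range A.mulVecLin ⊔ LinearMap.range B.mulVecLin := by
    rintro _ ⟨v, rfl⟩
    rw [Matrix.mulVecLin_add]
    exact Submodule.add_mem_sup (LinearMap.mem_range_self _ _) (LinearMap.mem_range_self _ _)
  exact (Submodule.finrank_mono h).trans (Submodule.finrank_add_le_finrank_add_finrank _ _)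

/-- A weighted partial trace of a matrix of small rank is small. -/
lemma norm_sum_entries_le_rank (B : Matrix n n ℂ) {κ : Type*} [Fintype κ] {σ τ : κ → n}
    (hσ : σ.Injective) (hτ : τ.Injective) {w : κ → ℂ} {β : ℝ} (hβ : 0 ≤ β)
    (hw : ∀ k, ‖w k‖ ≤ β) : ‖∑ k, w k * B (σ k) (τ k)‖ ≤ β * (B.rank * ‖B‖) := by
  classical
  set U := LinearMap.range (Matrix.toEuclideanLin B) with hU
  have hrank : Module.finrank ℂ U = B.rank := by
    rw [Matrix.rank_eq_finrank_range_toLin B (EuclideanSpace.basisFun n ℂ).toBasis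
      (EuclideanSpace.basisFun n ℂ).toBasis, hU, Matrix.toEuclideanLin_eq_toLin_orthonormal]
  set b := stdOrthonormalBasis ℂ U with hb
  -- With an orthonormal basis `b` of the range, `B = ∑ i, b i (B* b i)*` has as many terms as the
  -- rank. Since `σ` and `τ` are injective, Cauchy–Schwarz bounds the contribution of each term by
  -- `‖b i‖ ‖B* b i‖ ≤ ‖B‖`.
  have hent : ∀ a c, B a c = ∑ i, (starRingEnd ℂ)
      ((Matrix.toEuclideanLin Bᴴ (b i : EuclideanSpace ℂ n)) c) *
        (b i : EuclideanSpace ℂ n) a := by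
    intro a c
    set v : U := ⟨Matrix.toEuclideanLin B (EuclideanSpace.single c 1), LinearMap.mem_range_self _ _⟩
      with hv
    have h1 := congrArg (fun u : U => (u : EuclideanSpace ℂ n) a) (b.sum_repr' v)
    have h2 : (v : EuclideanSpace ℂ n) a = B a c := by simp [hv]
    simp only [h2] at h1
    rw [← h1]
    simp only [Submodule.coe_sum, Submodule.coe_smul, WithLp.ofLp_sum, Finset.sum_apply,
      PiLp.smul_apply, smul_eq_mul]
    refine Finset.sum_congr rfl fun i _ => ?_
    congr 1
    rw [Submodule.coe_inner, hv]
    simp [PiLp.inner_apply, Matrix.mulVec, dotProduct, Pi.single_apply, mul_comm]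
  have hbn : ∀ i, ‖(b i : EuclideanSpace ℂ n)‖ = 1 := fun i => by
    rw [Submodule.norm_coe]; exact b.orthonormal.1 i
  have hBn : ∀ i, ‖Matrix.toEuclideanLin Bᴴ (b i : EuclideanSpace ℂ n)‖ ≤ ‖B‖ := fun i => by
    have := Matrix.l2_opNorm_mulVec Bᴴ (b i : EuclideanSpace ℂ n)
    rw [hbn, mul_one, Matrix.l2_opNorm_conjTranspose] at this
    exact this
  have hsub : ∀ (v : EuclideanSpace ℂ n) {ρ : κ → n}, ρ.Injective →
      √(∑ k, ‖v (ρ k)‖ ^ 2) ≤ ‖v‖ := fun v ρ hρ => by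
    rw [EuclideanSpace.norm_eq]
    refine Real.sqrt_le_sqrt ?_
    rw [← Finset.sum_image (f := fun a => ‖v a‖ ^ 2) (s := Finset.univ) (g := ρ)
      (fun x _ y _ h => hρ h)]
    exact Finset.sum_le_sum_of_subset_of_nonneg (Finset.subset_univ _) fun _ _ _ => sq_nonneg _
  calc ‖∑ k, w k * B (σ k) (τ k)‖
      ≤ ∑ k, ∑ i, β * (‖(Matrix.toEuclideanLin Bᴴ (b i : EuclideanSpace ℂ n)) (τ k)‖ *
          ‖(b i : EuclideanSpace ℂ n) (σ k)‖) := by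
        refine (norm_sum_le _ _).trans (Finset.sum_le_sum fun k _ => ?_)
        rw [norm_mul, hent, ← Finset.mul_sum]
        refine mul_le_mul (hw k) ((norm_sum_le _ _).trans (Finset.sum_le_sum fun i _ => ?_))
          (norm_nonneg _) hβ
        rw [norm_mul, RCLike.norm_conj]
    _ = β * ∑ i, ∑ k, ‖(Matrix.toEuclideanLin Bᴴ (b i : EuclideanSpace ℂ n)) (τ k)‖ *
          ‖(b i : EuclideanSpace ℂ n) (σ k)‖ := by
        rw [Finset.sum_comm, Finset.mul_sum]
        exact Finset.sum_congr rfl fun i _ => by rw [Finset.mul_sum]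
    _ ≤ β * ∑ _i : Fin (Module.finrank ℂ U), ‖B‖ := by
        refine mul_le_mul_of_nonneg_left (Finset.sum_le_sum fun i _ => ?_) hβ
        refine (Real.sum_mul_le_sqrt_mul_sqrt _ _ _).trans ?_
        have h1 := (hsub (Matrix.toEuclideanLin Bᴴ (b i : EuclideanSpace ℂ n)) hτ).trans (hBn i)
        have h2 := hsub (b i : EuclideanSpace ℂ n) hσ
        rw [hbn] at h2
        calc _ ≤ ‖B‖ * 1 := mul_le_mul h1 h2 (Real.sqrt_nonneg _) (norm_nonneg _)
          _ = _ := mul_one _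
    _ = β * (B.rank * ‖B‖) := by simp [hrank]

/-- The coordinate projection onto `S`. -/
def coordProj (S : Finset n) : Matrix n n ℂ := Matrix.diagonal fun i => if i ∈ S then 1 else 0

lemma rank_coordProj_le (S : Finset n) : (coordProj S).rank ≤ S.card := by
  unfold coordProj
  rw [Matrix.rank_diagonal]
  rw [Fintype.card_subtype]
  refine Finset.card_le_card fun i hi => ?_
  by_contra h
  simp [h] at hi

/-- A matrix supported on the rows and columns with index in `S` has rank at most `2 |S|`. -/
lemma rank_le_of_support {W : Matrix n n ℂ} {S : Finset n}
    (hW : ∀ i j, i ∉ S → j ∉ S → W i j = 0) : W.rank ≤ 2 * S.card := by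
  -- The rows in `S`, plus what is left, which lives on the columns in `S`.
  have e : W = coordProj S * W + (W - coordProj S * W) * coordProj S := by
    ext i j
    simp only [coordProj, Matrix.add_apply, Matrix.diagonal_mul, Matrix.mul_diagonal,
      Matrix.sub_apply]
    by_cases hi : i ∈ S <;> by_cases hj : j ∈ S <;> simp [hi, hj]
    exact hW i j hi hj
  rw [e, two_mul]
  refine (matrix_rank_add_le _ _).trans (add_le_add ?_ ?_)
  · exact (Matrix.rank_mul_le_left _ _).trans (rank_coordProj_le S)
  · exact (Matrix.rank_mul_le_right _ _).trans (rank_coordProj_le S)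

/-- Partial traces of resolvents are stable under perturbations supported on few rows and
columns. -/
lemma norm_sum_green_sub_le (hH : H.IsHermitian) (hH' : H'.IsHermitian) (ht : t ≠ 0)
    {S : Finset n} (hS : ∀ i j, i ∉ S → j ∉ S → H i j = H' i j)
    {κ : Type*} [Fintype κ] {σ τ : κ → n}
    (hσ : σ.Injective) (hτ : τ.Injective) {w : κ → ℂ} {β : ℝ} (hβ : 0 ≤ β)
    (hw : ∀ k, ‖w k‖ ≤ β) :
    ‖∑ k, w k * (green H t - green H' t) (σ k) (τ k)‖ ≤ β * (4 * S.card * |t|⁻¹) := by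
  refine (norm_sum_entries_le_rank _ hσ hτ hβ hw).trans (mul_le_mul_of_nonneg_left ?_ hβ)
  -- By the resolvent identity the difference has `H' - H` as a factor, so its rank is no larger.
  have hr : (green H t - green H' t).rank ≤ 2 * S.card := by
    rw [green_sub_green hH hH' ht ht, sub_self]
    refine (Matrix.rank_mul_le_left _ _).trans ((Matrix.rank_mul_le_right _ _).trans ?_)
    refine rank_le_of_support fun i j hi hj => ?_
    simp [hS i j hi hj]
  have hn : ‖green H t - green H' t‖ ≤ 2 * |t|⁻¹ :=
    (norm_sub_le _ _).trans (by linarith [norm_green_le hH ht, norm_green_le hH' ht])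
  calc ((green H t - green H' t).rank : ℝ) * ‖green H t - green H' t‖
      ≤ ((2 * S.card : ℕ) : ℝ) * (2 * |t|⁻¹) :=
        mul_le_mul (by exact_mod_cast hr) hn (norm_nonneg _) (by positivity)
    _ = _ := by push_cast; ring

end Green

/-! ### Hermitization and cavity identities -/

section Hermitization

open scoped Matrix Matrix.Norms.L2Operator

variable {n : Type*} [Fintype n] [DecidableEq n]

/-- The Hermitization of `X - z`. -/
def herm (X : Matrix n n ℂ) (z : ℂ) : Matrix (n ⊕ n) (n ⊕ n) ℂ :=
  Matrix.fromBlocks 0 (X - z • 1) (X - z • 1)ᴴ 0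

lemma herm_isHermitian (X : Matrix n n ℂ) (z : ℂ) : (herm X z).IsHermitian := by
  unfold herm
  rw [Matrix.IsHermitian, Matrix.fromBlocks_conjTranspose]
  simp

lemma resolvent_eq_green {N : ℕ} (X : Matrix (Fin N) (Fin N) ℂ) (z : ℂ) (t : ℝ) :
    resolvent X z (Complex.I * t) = green (herm X z) t := by
  unfold resolvent green herm
  congr 1
  ext i j
  rcases i with i | i <;> rcases j with j | j <;> simp [Matrix.one_apply]

variable {X X' : Matrix n n ℂ} {z z' : ℂ} {t t' : ℝ}

/-- Chiral symmetry: conjugation by `diag(1, -1)` changes the sign of the Hermitization. It makes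
the diagonal of the resolvent purely imaginary and reduces negative `t` to positive `t`. -/
lemma green_herm_neg (ht : t ≠ 0) :
    green (herm X z) (-t) = -(Matrix.fromBlocks 1 0 0 (-1) * green (herm X z) t *
      Matrix.fromBlocks 1 0 0 (-1)) := by
  set E : Matrix (n ⊕ n) (n ⊕ n) ℂ := Matrix.fromBlocks 1 0 0 (-1) with hE
  have hEE : E * E = 1 := by
    rw [hE, Matrix.fromBlocks_multiply, ← Matrix.fromBlocks_one]; simp
  have hEH : E * herm X z * E = -herm X z := by
    rw [hE, herm, Matrix.fromBlocks_multiply, Matrix.fromBlocks_multiply, Matrix.fromBlocks_neg]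
    simp
  have h1 : herm X z - (Complex.I * ((-t : ℝ) : ℂ)) • (1 : Matrix (n ⊕ n) (n ⊕ n) ℂ)
      = -(E * (herm X z - (Complex.I * t) • 1) * E) := by
    rw [mul_sub, sub_mul, hEH, mul_smul_comm, mul_one, smul_mul_assoc, hEE]
    push_cast
    rw [mul_neg, neg_smul]
    abel
  have h2 := mul_green (herm_isHermitian X z) ht
  refine Matrix.inv_eq_right_inv ?_
  rw [h1, neg_mul_neg]
  calc E * (herm X z - (Complex.I * t) • 1) * E * (E * green (herm X z) t * E)
      = E * (herm X z - (Complex.I * t) • 1) * (E * E) * green (herm X z) t * E := by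
        noncomm_ring
    _ = E * ((herm X z - (Complex.I * t) • 1) * green (herm X z) t) * E := by
        rw [hEE]; noncomm_ring
    _ = 1 := by rw [h2, mul_one, hEE]

/-- The resolvent at `-t` is both the adjoint and, by chiral symmetry, minus a conjugate that fixes
the diagonal entries; so each of these equals minus its complex conjugate. -/
lemma green_herm_diag_re (ht : t ≠ 0) (i : n ⊕ n) : (green (herm X z) t i i).re = 0 := by
  have h1 := congrFun (congrFun (green_herm_neg (X := X) (z := z) ht) i) i
  rw [← green_conjTranspose (herm_isHermitian X z), ← Matrix.fromBlocks_toBlocks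
    (green (herm X z) t), Matrix.fromBlocks_multiply, Matrix.fromBlocks_multiply] at h1
  have h2 : star (green (herm X z) t i i) = -green (herm X z) t i i := by
    rcases i with i | i <;> simpa [Matrix.toBlocks₁₁, Matrix.toBlocks₂₂] using h1
  have h3 := congrArg Complex.re h2
  simp at h3
  linarith

lemma green_diag_im {H : Matrix n n ℂ} (hH : H.IsHermitian) (ht : t ≠ 0) (i : n) :
    (green H t i i).im = t * ∑ j, ‖green H t i j‖ ^ 2 := by
  have h := congrFun (congrFun (green_ward hH ht).1 i) i
  simp only [Matrix.sub_apply, Matrix.conjTranspose_apply, Complex.star_def, Complex.sub_conj,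
    Matrix.smul_apply, Matrix.mul_apply, smul_eq_mul, Complex.mul_conj'] at h
  have h2 : ((2 * (green H t i i).im : ℝ) : ℂ) =
      ((2 * (t * ∑ j, ‖green H t i j‖ ^ 2) : ℝ) : ℂ) := by
    refine mul_right_cancel₀ Complex.I_ne_zero ?_
    rw [h]; push_cast; ring
  have h3 := Complex.ofReal_injective h2
  linarith

lemma green_herm_diag (ht : t ≠ 0) (i : n ⊕ n) :
    green (herm X z) t i i = Complex.I * ((green (herm X z) t i i).im : ℂ) := by
  apply Complex.ext <;> simp [green_herm_diag_re ht]

/-- `X` cancels, and the adjoint of the difference times the difference is the scalar `|z - z'|²`;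
the C*-identity then gives the norm. -/
lemma norm_herm_sub_le : ‖herm X z - herm X z'‖ ≤ ‖z - z'‖ := by
  have e : herm X z - herm X z' = Matrix.fromBlocks 0 ((z' - z) • 1) (star (z' - z) • 1) 0 := by
    unfold herm
    rw [sub_eq_add_neg, Matrix.fromBlocks_neg, Matrix.fromBlocks_add]
    congr 1
    · simp
    · rw [sub_smul]; abel
    · simp only [Matrix.conjTranspose_sub, Matrix.conjTranspose_smul, Matrix.conjTranspose_one,
        star_sub, sub_smul]
      abel
    · simp
  have h1 := Matrix.l2_opNorm_conjTranspose_mul_self (herm X z - herm X z')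
  have e2 : (herm X z - herm X z')ᴴ * (herm X z - herm X z') =
      Matrix.diagonal fun _ => ((‖z - z'‖ ^ 2 : ℝ) : ℂ) := by
    have h3 : (z' - z) * star (z' - z) = ((‖z - z'‖ ^ 2 : ℝ) : ℂ) := by
      rw [Complex.star_def, Complex.mul_conj', norm_sub_rev]; push_cast; rfl
    rw [e, Matrix.fromBlocks_conjTranspose, Matrix.fromBlocks_multiply]
    simp only [Matrix.conjTranspose_zero, zero_mul, Matrix.conjTranspose_smul,
      Matrix.conjTranspose_one, star_star, smul_mul_assoc, one_mul, smul_smul,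
      mul_zero, zero_add, add_zero, mul_comm (star (z' - z)), h3]
    ext i j
    rcases i with i | i <;> rcases j with j | j <;> by_cases hij : i = j <;> simp [hij]
  rw [e2, Matrix.l2_opNorm_diagonal] at h1
  have h4 : ‖(fun _ : n ⊕ n => ((‖z - z'‖ ^ 2 : ℝ) : ℂ))‖ ≤ ‖z - z'‖ ^ 2 := by
    refine (pi_norm_le_iff_of_nonneg (sq_nonneg _)).2 fun _ => ?_
    rw [Complex.norm_real, Real.norm_of_nonneg (sq_nonneg _)]
  rw [h1] at h4
  nlinarith [norm_nonneg (herm X z - herm X z'), norm_nonneg (z - z')]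

lemma norm_green_herm_sub_le (ht : t ≠ 0) (ht' : t' ≠ 0) :
    ‖green (herm X z) t - green (herm X z') t'‖ ≤
      |t|⁻¹ * (‖z - z'‖ + |t - t'|) * |t'|⁻¹ := by
  rw [green_sub_green (herm_isHermitian X z) (herm_isHermitian X z') ht ht']
  have h1 : ‖herm X z' - herm X z + (Complex.I * ((t - t' : ℝ) : ℂ)) •
      (1 : Matrix (n ⊕ n) (n ⊕ n) ℂ)‖ ≤ ‖z - z'‖ + |t - t'| := by
    refine (norm_add_le _ _).trans (add_le_add ?_ ?_)
    · rw [norm_sub_rev]; exact norm_herm_sub_le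
    · rw [norm_smul, norm_mul, Complex.norm_I, one_mul, Complex.norm_real, Real.norm_eq_abs]
      have : ‖(1 : Matrix (n ⊕ n) (n ⊕ n) ℂ)‖ ≤ 1 := by
        rw [← Matrix.diagonal_one, Matrix.l2_opNorm_diagonal]
        exact (pi_norm_le_iff_of_nonneg zero_le_one).2 fun _ => by simp
      exact mul_le_of_le_one_right (abs_nonneg _) this
  refine (norm_mul_le _ _).trans (mul_le_mul ((norm_mul_le _ _).trans
    (mul_le_mul (norm_green_le (herm_isHermitian X z) ht) h1 (norm_nonneg _) (by positivity)))
    (norm_green_le (herm_isHermitian X z') ht') (norm_nonneg _) (by positivity))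

/-- `X` with row and column `k` replaced by zero. -/
def cavity (X : Matrix n n ℂ) (k : n) : Matrix n n ℂ :=
  Matrix.of fun i j => if i = k ∨ j = k then 0 else X i j

/-- The resolvent of `cavity X k`, restricted to the complement of `k`. -/
def cavityGreen (X : Matrix n n ℂ) (z : ℂ) (t : ℝ) (k : n) : Matrix (n ⊕ n) (n ⊕ n) ℂ :=
  (1 - coordProj {Sum.inl k, Sum.inr k}) * green (herm (cavity X k) z) t *
    (1 - coordProj {Sum.inl k, Sum.inr k})

/-- The Schur complement formula in a ring. `B` commutes with the projection `p` and has inverse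
`G`, the coupling `W` has no part inside `1 - p`, and `R` inverts `B + W`. Eliminating `(1 - p) R p`
from the resolvent equation leaves a closed equation for the corner `p R p`, with self-energy `p W
(1 - p) G (1 - p) W p`. -/
lemma schur_block {A : Type*} [Ring A] {p B W G R : A} (hp : p * p = p) (hGB : G * B = 1)
    (hBG : B * G = 1) (hpB : p * B = B * p) (hR : (B + W) * R = 1)
    (hW : (1 - p) * W * (1 - p) = 0) :
    B * (p * R * p) = p - p * W * p * (p * R * p)
      + p * W * ((1 - p) * G * (1 - p)) * W * p * (p * R * p) := by
  have hpG : p * G = G * p := by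
    calc p * G = G * B * p * G := by rw [hGB, one_mul]
      _ = G * (B * p) * G := by noncomm_ring
      _ = G * p * (B * G) := by rw [← hpB]; noncomm_ring
      _ = G * p := by rw [hBG, mul_one]
  have h1 : R = G - G * (W * R) := by
    have : G * ((B + W) * R) = G := by rw [hR, mul_one]
    calc R = G * B * R := by rw [hGB, one_mul]
      _ = G * ((B + W) * R) - G * (W * R) := by noncomm_ring
      _ = _ := by rw [this]
  have hBR : B * R = 1 - W * R := by rw [← hR]; noncomm_ring
  have hpp : (1 - p) * p = 0 := by rw [sub_mul, hp, one_mul, sub_self]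
  have hqG : (1 - p) * G = G * (1 - p) := by rw [sub_mul, mul_sub, hpG, one_mul, mul_one]
  have hq : (1 - p) * (1 - p) = 1 - p := by
    rw [mul_sub, mul_one, hpp, sub_zero]
  have hWq : (1 - p) * W = (1 - p) * W * p := by
    have : (1 - p) * W = (1 - p) * W * p + (1 - p) * W * (1 - p) := by noncomm_ring
    rw [hW, add_zero] at this
    exact this
  have h2 : (1 - p) * R * p = -(G * (1 - p) * W * p * (p * R * p)) := by
    calc (1 - p) * R * p = (1 - p) * (G - G * (W * R)) * p := by rw [← h1]
      _ = (1 - p) * G * p - (1 - p) * G * (W * R) * p := by noncomm_ring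
      _ = G * ((1 - p) * p) - G * ((1 - p) * W) * R * p := by rw [hqG]; noncomm_ring
      _ = -(G * ((1 - p) * W * (p * p)) * R * p) := by
          rw [hpp, hp, ← hWq, mul_zero, zero_sub]
      _ = _ := by noncomm_ring
  calc B * (p * R * p) = B * p * R * p := by noncomm_ring
    _ = p * (B * R) * p := by rw [← hpB]; noncomm_ring
    _ = p * p - p * W * R * p := by rw [hBR]; noncomm_ring
    _ = p - p * W * (p * p) * R * p - p * W * ((1 - p) * (1 - p) * R * p) := by
        rw [hp, hq]; noncomm_ring
    _ = p - p * W * (p * p) * R * p - p * W * ((1 - p) * ((1 - p) * R * p)) := by noncomm_ring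
    _ = p - p * W * (p * p) * R * p
        + p * W * ((1 - p) * G * (1 - p)) * W * p * (p * R * p) := by
        rw [h2]; noncomm_ring
    _ = _ := by noncomm_ring

/-- The companion of `schur_block` for the other entries of the rows of `p`: they are linear in `W`,
with coefficients from the corner `p R p` and from the decoupled inverse. -/
lemma schur_offdiag {A : Type*} [Ring A] {p B W G R : A} (hp : p * p = p) (hGB : G * B = 1)
    (hBG : B * G = 1) (hpB : p * B = B * p) (hR : R * (B + W) = 1)
    (hW : (1 - p) * W * (1 - p) = 0) :
    p * R * (1 - p) = -(p * R * p * W * ((1 - p) * G * (1 - p))) := by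
  have hpG : p * G = G * p := by
    calc p * G = G * B * p * G := by rw [hGB, one_mul]
      _ = G * (B * p) * G := by noncomm_ring
      _ = G * p * (B * G) := by rw [← hpB]; noncomm_ring
      _ = G * p := by rw [hBG, mul_one]
  have h1 : R = G - R * W * G := by
    have : (R * (B + W)) * G = G := by rw [hR, one_mul]
    calc R = R * (B * G) := by rw [hBG, mul_one]
      _ = R * (B + W) * G - R * W * G := by noncomm_ring
      _ = _ := by rw [this]
  have hpp : p * (1 - p) = 0 := by rw [mul_sub, hp, mul_one, sub_self]
  have hqG : (1 - p) * G = G * (1 - p) := by rw [sub_mul, mul_sub, hpG, one_mul, mul_one]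
  have hq : (1 - p) * (1 - p) = 1 - p := by
    rw [sub_mul, one_mul, hpp, sub_zero]
  have hWq : W * (1 - p) = p * W * (1 - p) := by
    have : W * (1 - p) = p * W * (1 - p) + (1 - p) * W * (1 - p) := by noncomm_ring
    rw [hW, add_zero] at this
    exact this
  calc p * R * (1 - p) = p * (G - R * W * G) * (1 - p) := by rw [← h1]
    _ = p * G * (1 - p) - p * R * W * (G * (1 - p)) := by noncomm_ring
    _ = G * (p * (1 - p)) - p * R * (W * (1 - p)) * G := by rw [← hqG, hpG]; noncomm_ring
    _ = -(p * R * p * W * ((1 - p) * G)) := by rw [hpp, hWq]; noncomm_ring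
    _ = -(p * R * p * W * ((1 - p) * (1 - p) * G)) := by rw [hq]
    _ = _ := by rw [mul_assoc (1 - p) (1 - p) G, hqG, ← mul_assoc (1 - p) G, hqG]

lemma coordProj_mul_apply (S : Finset n) (A : Matrix n n ℂ) (i j : n) :
    (coordProj S * A) i j = if i ∈ S then A i j else 0 := by
  simp [coordProj, Matrix.diagonal_mul]

lemma mul_coordProj_apply (S : Finset n) (A : Matrix n n ℂ) (i j : n) :
    (A * coordProj S) i j = if j ∈ S then A i j else 0 := by
  simp [coordProj, Matrix.mul_diagonal]

lemma coordProj_mul_self (S : Finset n) : coordProj S * coordProj S = coordProj S := by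
  ext i j
  rw [coordProj_mul_apply]
  by_cases hi : i ∈ S <;> simp [coordProj, Matrix.diagonal_apply, hi]

lemma one_sub_coordProj_mul_apply (S : Finset n) (A : Matrix n n ℂ) (i j : n) :
    ((1 - coordProj S) * A) i j = if i ∈ S then 0 else A i j := by
  rw [sub_mul, one_mul, Matrix.sub_apply, coordProj_mul_apply]
  split_ifs <;> simp

lemma mul_one_sub_coordProj_apply (S : Finset n) (A : Matrix n n ℂ) (i j : n) :
    (A * (1 - coordProj S)) i j = if j ∈ S then 0 else A i j := by
  rw [mul_sub, mul_one, Matrix.sub_apply, mul_coordProj_apply]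
  split_ifs <;> simp

lemma cavityGreen_apply (X : Matrix n n ℂ) (z : ℂ) (t : ℝ) (k : n) (i j : n ⊕ n) :
    cavityGreen X z t k i j = if i ∈ ({Sum.inl k, Sum.inr k} : Finset (n ⊕ n)) ∨
      j ∈ ({Sum.inl k, Sum.inr k} : Finset (n ⊕ n)) then 0
      else green (herm (cavity X k) z) t i j := by
  rw [cavityGreen, mul_one_sub_coordProj_apply, one_sub_coordProj_mul_apply]
  split_ifs <;> tauto

/-- After row and column `k` of `X` are removed, the two copies of `k` in the Hermitization interact
only with each other, through `z`. -/
lemma herm_cavity_comm (X : Matrix n n ℂ) (z : ℂ) (t : ℝ) (k : n) :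
    coordProj {Sum.inl k, Sum.inr k} * (herm (cavity X k) z - (Complex.I * t) • 1) =
      (herm (cavity X k) z - (Complex.I * t) • 1) * coordProj {Sum.inl k, Sum.inr k} := by
  ext i j
  rw [coordProj_mul_apply, mul_coordProj_apply]
  rcases i with i | i <;> rcases j with j | j <;> by_cases hi : i = k <;> by_cases hj : j = k <;>
    simp [herm, cavity, hi, hj, Matrix.one_apply] <;> intro h <;> simp_all

/-- The coupling of index `k` to the other indices. -/
def coupling (X : Matrix n n ℂ) (k : n) : Matrix (n ⊕ n) (n ⊕ n) ℂ := herm (X - cavity X k) 0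

lemma herm_eq_cavity_add (X : Matrix n n ℂ) (z : ℂ) (t : ℝ) (k : n) :
    (herm (cavity X k) z - (Complex.I * t) • 1) + coupling X k =
      herm X z - (Complex.I * t) • 1 := by
  have : herm X z = herm (cavity X k) z + coupling X k := by
    ext i j
    rcases i with i | i <;> rcases j with j | j <;> simp [herm, coupling]
  rw [this]; abel

lemma coupling_support (X : Matrix n n ℂ) (k : n) :
    (1 - coordProj {Sum.inl k, Sum.inr k}) * coupling X k *
      (1 - coordProj {Sum.inl k, Sum.inr k}) = 0 := by
  ext i j
  rw [mul_one_sub_coordProj_apply, one_sub_coordProj_mul_apply]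
  rcases i with i | i <;> rcases j with j | j <;> by_cases hi : i = k <;> by_cases hj : j = k <;>
    simp [coupling, herm, cavity, hi, hj]

lemma coupling_apply (X : Matrix n n ℂ) (k l : n) :
    coupling X k (Sum.inl k) (Sum.inl l) = 0 ∧ coupling X k (Sum.inr k) (Sum.inr l) = 0 ∧
    coupling X k (Sum.inl l) (Sum.inl k) = 0 ∧ coupling X k (Sum.inr l) (Sum.inr k) = 0 ∧
    coupling X k (Sum.inl k) (Sum.inr l) = X k l ∧
    coupling X k (Sum.inr l) (Sum.inl k) = star (X k l) ∧
    coupling X k (Sum.inl l) (Sum.inr k) = X l k ∧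
    coupling X k (Sum.inr k) (Sum.inl l) = star (X l k) := by
  simp [coupling, herm, cavity]

lemma sum_pair (k : n) (f : n ⊕ n → ℂ) :
    ∑ i, (if i ∈ ({Sum.inl k, Sum.inr k} : Finset (n ⊕ n)) then f i else 0) =
      f (Sum.inl k) + f (Sum.inr k) := by
  simp

/-- `schur_block` for the projection onto the two copies of `k`, read entrywise: each column `j` of
the corner solves a `2 × 2` linear system. -/
lemma green_cavity_eq (ht : t ≠ 0) (k : n) {i j : n ⊕ n}
    (hi : i ∈ ({Sum.inl k, Sum.inr k} : Finset (n ⊕ n)))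
    (hj : j ∈ ({Sum.inl k, Sum.inr k} : Finset (n ⊕ n))) :
    let W := coupling X k
    let V := W * cavityGreen X z t k * W
    let B := herm (cavity X k) z - (Complex.I * t) • (1 : Matrix (n ⊕ n) (n ⊕ n) ℂ)
    let R := green (herm X z) t
    B i (Sum.inl k) * R (Sum.inl k) j + B i (Sum.inr k) * R (Sum.inr k) j =
      (if i = j then 1 else 0)
      - (W i (Sum.inl k) * R (Sum.inl k) j + W i (Sum.inr k) * R (Sum.inr k) j)
      + (V i (Sum.inl k) * R (Sum.inl k) j + V i (Sum.inr k) * R (Sum.inr k) j) := by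
  intro W V B R
  set S : Finset (n ⊕ n) := {Sum.inl k, Sum.inr k} with hS
  have hR : (B + W) * R = 1 := by
    rw [herm_eq_cavity_add]; exact mul_green (herm_isHermitian X z) ht
  have key := schur_block (coordProj_mul_self S) (green_mul (herm_isHermitian (cavity X k) z) ht)
    (mul_green (herm_isHermitian (cavity X k) z) ht) (herm_cavity_comm X z t k) hR
    (coupling_support X k)
  have e := congrFun (congrFun key i) j
  have expand : ∀ A : Matrix (n ⊕ n) (n ⊕ n) ℂ, (A * (coordProj S * R * coordProj S)) i j =
      A i (Sum.inl k) * R (Sum.inl k) j + A i (Sum.inr k) * R (Sum.inr k) j := by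
    intro A
    rw [Matrix.mul_apply, ← sum_pair k fun l => A i l * R l j]
    refine Finset.sum_congr rfl fun l _ => ?_
    rw [mul_coordProj_apply, coordProj_mul_apply, if_pos hj]
    split_ifs <;> simp
  have restrict : ∀ (A : Matrix (n ⊕ n) (n ⊕ n) ℂ) (l : n ⊕ n), l ∈ S →
      (coordProj S * A * coordProj S) i l = A i l := by
    intro A l hl
    rw [mul_coordProj_apply, coordProj_mul_apply, if_pos hl, if_pos hi]
  have hl : Sum.inl k ∈ S := by simp [hS]
  have hr : Sum.inr k ∈ S := by simp [hS]
  have assoc : coordProj S * W * ((1 - coordProj S) * green (herm (cavity X k) z) t *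
      (1 - coordProj S)) * W * coordProj S = coordProj S * V * coordProj S := by
    simp only [V, cavityGreen, hS, mul_assoc]
  rw [assoc, Matrix.add_apply, Matrix.sub_apply, expand, expand, expand, restrict _ _ hl,
    restrict _ _ hr, restrict _ _ hl, restrict _ _ hr] at e
  rw [e]
  congr 2
  simp [coordProj, Matrix.diagonal_apply, hi]

lemma green_offdiag_eq (ht : t ≠ 0) (k : n) {i j : n ⊕ n}
    (hi : i ∈ ({Sum.inl k, Sum.inr k} : Finset (n ⊕ n)))
    (hj : j ∉ ({Sum.inl k, Sum.inr k} : Finset (n ⊕ n))) :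
    let V := coupling X k * cavityGreen X z t k
    let R := green (herm X z) t
    R i j = -(R i (Sum.inl k) * V (Sum.inl k) j + R i (Sum.inr k) * V (Sum.inr k) j) := by
  intro V R
  set S : Finset (n ⊕ n) := {Sum.inl k, Sum.inr k} with hS
  have hR : R * ((herm (cavity X k) z - (Complex.I * t) • (1 : Matrix (n ⊕ n) (n ⊕ n) ℂ))
      + coupling X k) = 1 := by
    rw [herm_eq_cavity_add]; exact green_mul (herm_isHermitian X z) ht
  have key := schur_offdiag (coordProj_mul_self S)
    (green_mul (herm_isHermitian (cavity X k) z) ht)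
    (mul_green (herm_isHermitian (cavity X k) z) ht) (herm_cavity_comm X z t k) hR
    (coupling_support X k)
  have e := congrFun (congrFun key i) j
  have assoc : coordProj S * R * coordProj S * coupling X k *
      ((1 - coordProj S) * green (herm (cavity X k) z) t * (1 - coordProj S)) =
      coordProj S * R * coordProj S * V := by
    simp only [V, cavityGreen, hS, mul_assoc]
  rw [assoc, mul_one_sub_coordProj_apply, coordProj_mul_apply, if_neg hj, if_pos hi,
    Matrix.neg_apply, Matrix.mul_apply] at e
  rw [e, ← sum_pair k fun l => R i l * V l j]
  congr 1
  refine Finset.sum_congr rfl fun l _ => ?_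
  rw [mul_coordProj_apply, coordProj_mul_apply, if_pos hi]
  split_ifs <;> simp

lemma coupling_quadratic (X : Matrix n n ℂ) (k : n) (A : Matrix (n ⊕ n) (n ⊕ n) ℂ) :
    (coupling X k * A * coupling X k) (Sum.inl k) (Sum.inl k) =
      ∑ l', ∑ l, X k l * A (Sum.inr l) (Sum.inr l') * star (X k l') ∧
    (coupling X k * A * coupling X k) (Sum.inr k) (Sum.inr k) =
      ∑ l', ∑ l, star (X l k) * A (Sum.inl l) (Sum.inl l') * X l' k ∧
    (coupling X k * A * coupling X k) (Sum.inl k) (Sum.inr k) =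
      ∑ l', ∑ l, X k l * A (Sum.inr l) (Sum.inl l') * X l' k ∧
    (coupling X k * A * coupling X k) (Sum.inr k) (Sum.inl k) =
      ∑ l', ∑ l, star (X l k) * A (Sum.inl l) (Sum.inr l') * star (X k l') := by
  have h := coupling_apply X k
  simp only [Matrix.mul_apply, Fintype.sum_sum_type, (h _).1, (h _).2.1, (h _).2.2.1,
    (h _).2.2.2.1, (h _).2.2.2.2.1, (h _).2.2.2.2.2.1, (h _).2.2.2.2.2.2.1, (h _).2.2.2.2.2.2.2,
    zero_mul, mul_zero, Finset.sum_const_zero, add_zero, zero_add, Finset.sum_mul, and_self]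

/-- Perturbation of a `2 × 2` linear system with matrix `-(√-1 a, z; z̄, √-1 b)`. -/
lemma norm_sub_solution_le {a b : ℝ} (ht : 0 < t) (ha : t ≤ a) (hb : t ≤ b)
    {r₁ r₂ d₁ d₂ e₁₁ e₁₂ e₂₁ e₂₂ : ℂ} {ε : ℝ} (hr₁ : ‖r₁‖ ≤ t⁻¹) (hr₂ : ‖r₂‖ ≤ t⁻¹)
    (h₁ : -(Complex.I * a) * r₁ - z * r₂ = d₁ - (e₁₁ * r₁ + e₁₂ * r₂))
    (h₂ : -star z * r₁ - (Complex.I * b) * r₂ = d₂ - (e₂₁ * r₁ + e₂₂ * r₂))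
    (hε : ‖e₁₁‖ + ‖e₁₂‖ + ‖e₂₁‖ + ‖e₂₂‖ ≤ ε) :
    ‖r₁ - (Complex.I * b * d₁ - z * d₂) * ((a * b + ‖z‖ ^ 2 : ℝ) : ℂ)⁻¹‖ ≤ ε / t ^ 2 ∧
    ‖r₂ - (-star z * d₁ + Complex.I * a * d₂) * ((a * b + ‖z‖ ^ 2 : ℝ) : ℂ)⁻¹‖ ≤ ε / t ^ 2 := by
  have pa : 0 < a := by linarith
  have pb : 0 < b := by linarith
  have hw : 0 < a * b + ‖z‖ ^ 2 := by positivity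
  have hwc : ((a * b + ‖z‖ ^ 2 : ℝ) : ℂ) ≠ 0 := by exact_mod_cast hw.ne'
  have hzz : z * star z = ((‖z‖ ^ 2 : ℝ) : ℂ) := by
    rw [Complex.star_def, Complex.mul_conj']; push_cast; rfl
  have hI := Complex.I_sq
  have hwinv : ‖((a * b + ‖z‖ ^ 2 : ℝ) : ℂ)⁻¹‖ = (a * b + ‖z‖ ^ 2)⁻¹ := by
    rw [norm_inv, Complex.norm_real, Real.norm_of_nonneg hw.le]
  have k1 : a * (a * b + ‖z‖ ^ 2)⁻¹ ≤ t⁻¹ := by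
    rw [← div_eq_mul_inv, ← one_div, div_le_div_iff₀ hw ht]; nlinarith [sq_nonneg ‖z‖]
  have k2 : b * (a * b + ‖z‖ ^ 2)⁻¹ ≤ t⁻¹ := by
    rw [← div_eq_mul_inv, ← one_div, div_le_div_iff₀ hw ht]; nlinarith [sq_nonneg ‖z‖]
  have k3 : ‖z‖ * (a * b + ‖z‖ ^ 2)⁻¹ ≤ t⁻¹ := by
    rw [← div_eq_mul_inv, ← one_div, div_le_div_iff₀ hw ht]
    nlinarith [sq_nonneg (‖z‖ - t), mul_le_mul ha hb ht.le pa.le]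
  -- Cramer's rule, with the error terms kept on the right hand side; the determinant is `-(a b +
  -- |z|²)`, and `k1`, `k2`, `k3` bound all entries of the inverse by `1 / t`.
  have s1 : r₁ - (Complex.I * b * d₁ - z * d₂) * ((a * b + ‖z‖ ^ 2 : ℝ) : ℂ)⁻¹ =
      -(Complex.I * b * ((a * b + ‖z‖ ^ 2 : ℝ) : ℂ)⁻¹) * (e₁₁ * r₁ + e₁₂ * r₂)
      + z * ((a * b + ‖z‖ ^ 2 : ℝ) : ℂ)⁻¹ * (e₂₁ * r₁ + e₂₂ * r₂) := by
    have : r₁ * ((a * b + ‖z‖ ^ 2 : ℝ) : ℂ) = Complex.I * b * (d₁ - (e₁₁ * r₁ + e₁₂ * r₂))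
        - z * (d₂ - (e₂₁ * r₁ + e₂₂ * r₂)) := by
      rw [← h₁, ← h₂, Complex.ofReal_add, ← hzz]
      push_cast
      linear_combination (a * b * r₁) * hI
    rw [eq_comm, ← sub_eq_zero]
    have h3 := mul_inv_cancel₀ hwc
    linear_combination r₁ * h3 - ((a * b + ‖z‖ ^ 2 : ℝ) : ℂ)⁻¹ * this
  have s2 : r₂ - (-star z * d₁ + Complex.I * a * d₂) * ((a * b + ‖z‖ ^ 2 : ℝ) : ℂ)⁻¹ =
      star z * ((a * b + ‖z‖ ^ 2 : ℝ) : ℂ)⁻¹ * (e₁₁ * r₁ + e₁₂ * r₂)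
      + -(Complex.I * a * ((a * b + ‖z‖ ^ 2 : ℝ) : ℂ)⁻¹) * (e₂₁ * r₁ + e₂₂ * r₂) := by
    have : r₂ * ((a * b + ‖z‖ ^ 2 : ℝ) : ℂ) = -star z * (d₁ - (e₁₁ * r₁ + e₁₂ * r₂))
        + Complex.I * a * (d₂ - (e₂₁ * r₁ + e₂₂ * r₂)) := by
      rw [← h₁, ← h₂, Complex.ofReal_add, ← hzz]
      push_cast
      linear_combination (a * b * r₂) * hI
    rw [eq_comm, ← sub_eq_zero]
    have h3 := mul_inv_cancel₀ hwc
    linear_combination r₂ * h3 - ((a * b + ‖z‖ ^ 2 : ℝ) : ℂ)⁻¹ * this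
  have ht0 : 0 ≤ t⁻¹ := by positivity
  have f1 : ‖e₁₁ * r₁ + e₁₂ * r₂‖ ≤ (‖e₁₁‖ + ‖e₁₂‖) * t⁻¹ := by
    refine (norm_add_le _ _).trans ?_
    rw [norm_mul, norm_mul, add_mul]
    gcongr
  have f2 : ‖e₂₁ * r₁ + e₂₂ * r₂‖ ≤ (‖e₂₁‖ + ‖e₂₂‖) * t⁻¹ := by
    refine (norm_add_le _ _).trans ?_
    rw [norm_mul, norm_mul, add_mul]
    gcongr
  have fin : ∀ u v : ℂ, ‖u‖ ≤ t⁻¹ → ‖v‖ ≤ t⁻¹ →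
      ‖u * (e₁₁ * r₁ + e₁₂ * r₂) + v * (e₂₁ * r₁ + e₂₂ * r₂)‖ ≤ ε / t ^ 2 := by
    intro u v hu hv
    refine (norm_add_le _ _).trans ?_
    rw [norm_mul, norm_mul]
    calc _ ≤ t⁻¹ * ((‖e₁₁‖ + ‖e₁₂‖) * t⁻¹) + t⁻¹ * ((‖e₂₁‖ + ‖e₂₂‖) * t⁻¹) := by gcongr
      _ = (‖e₁₁‖ + ‖e₁₂‖ + ‖e₂₁‖ + ‖e₂₂‖) / t ^ 2 := by field_simp; ring
      _ ≤ _ := by gcongr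
  rw [s1, s2]
  refine ⟨fin _ _ ?_ ?_, fin _ _ ?_ ?_⟩
  · rw [norm_neg, norm_mul, norm_mul, Complex.norm_I, one_mul, hwinv, Complex.norm_real,
      Real.norm_of_nonneg pb.le]
    exact k2
  · rw [norm_mul, hwinv]; exact k3
  · rw [norm_mul, hwinv, norm_star]; exact k3
  · rw [norm_neg, norm_mul, norm_mul, Complex.norm_I, one_mul, hwinv, Complex.norm_real,
      Real.norm_of_nonneg pa.le]
    exact k1

/-- The fluctuation terms in the Schur complement formula at index `k`, for the variance
profile `s`. -/
def cavityError (X : Matrix n n ℂ) (s : n → n → ℝ) (z : ℂ) (t : ℝ) (k : n) : ℝ :=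
  let G := cavityGreen X z t k
  ‖(∑ l', ∑ l, X k l * G (Sum.inr l) (Sum.inr l') * star (X k l')) -
      ∑ l, (s k l : ℂ) * G (Sum.inr l) (Sum.inr l)‖ +
  ‖(∑ l', ∑ l, star (X l k) * G (Sum.inl l) (Sum.inl l') * X l' k) -
      ∑ l, (s l k : ℂ) * G (Sum.inl l) (Sum.inl l)‖ +
  ‖∑ l', ∑ l, X k l * G (Sum.inr l) (Sum.inl l') * X l' k‖ +
  ‖∑ l', ∑ l, star (X l k) * G (Sum.inl l) (Sum.inr l') * star (X k l')‖ + 2 * ‖X k k‖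

/-- Removing row and column `k` changes the Hermitization on two indices only, which costs `8 β / t`
by `norm_sum_green_sub_le`. The summand `l = k`, which `cavityGreen` sets to zero, costs another `β
/ t`. -/
lemma norm_sum_green_sub_cavityGreen_le (ht : 0 < t) (k : n) {w : n → ℝ} {β : ℝ}
    (hw0 : ∀ l, 0 ≤ w l) (hw : ∀ l, w l ≤ β) {ρ : n → n ⊕ n} (hρ : ρ.Injective)
    (hρk : ∀ l, ρ l ∈ ({Sum.inl k, Sum.inr k} : Finset (n ⊕ n)) ↔ l = k) :
    ‖∑ l, (w l : ℂ) * green (herm X z) t (ρ l) (ρ l) -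
      ∑ l, (w l : ℂ) * cavityGreen X z t k (ρ l) (ρ l)‖ ≤ 9 * β / t := by
  set S : Finset (n ⊕ n) := {Sum.inl k, Sum.inr k} with hS
  have hβ : 0 ≤ β := (hw0 k).trans (hw k)
  have hwn : ∀ l, ‖(w l : ℂ)‖ ≤ β := fun l => by
    rw [Complex.norm_real, Real.norm_of_nonneg (hw0 l)]; exact hw l
  have hcard : S.card = 2 := by rw [hS, Finset.card_pair (by simp)]
  have h1 := norm_sum_green_sub_le (H := herm X z) (H' := herm (cavity X k) z) (S := S)
    (herm_isHermitian X z) (herm_isHermitian (cavity X k) z) ht.ne' (fun i j hi hj => by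
      rcases i with i | i <;> rcases j with j | j <;> simp [hS] at hi hj <;>
        simp [herm, cavity, hi, hj]) hρ hρ hβ hwn
  have e : ∑ l, (w l : ℂ) * green (herm X z) t (ρ l) (ρ l) -
      ∑ l, (w l : ℂ) * cavityGreen X z t k (ρ l) (ρ l) =
      (∑ l, (w l : ℂ) * (green (herm X z) t - green (herm (cavity X k) z) t) (ρ l) (ρ l)) +
        (w k : ℂ) * green (herm (cavity X k) z) t (ρ k) (ρ k) := by
    have h2 : ∑ l, (w l : ℂ) * cavityGreen X z t k (ρ l) (ρ l) =
        ∑ l, (w l : ℂ) * green (herm (cavity X k) z) t (ρ l) (ρ l) -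
          (w k : ℂ) * green (herm (cavity X k) z) t (ρ k) (ρ k) := by
      have h3 : ∀ l, (w l : ℂ) * cavityGreen X z t k (ρ l) (ρ l) =
          (w l : ℂ) * green (herm (cavity X k) z) t (ρ l) (ρ l) -
            if l = k then (w l : ℂ) * green (herm (cavity X k) z) t (ρ l) (ρ l) else 0 := by
        intro l
        rw [cavityGreen_apply]
        simp only [← hS, hρk, or_self]
        split_ifs <;> simp
      simp only [h3, Finset.sum_sub_distrib, Finset.sum_ite_eq', Finset.mem_univ, if_true]
    rw [h2]
    simp only [Matrix.sub_apply, mul_sub, Finset.sum_sub_distrib]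
    ring
  rw [e]
  refine (norm_add_le _ _).trans ?_
  have h3 : ‖(w k : ℂ) * green (herm (cavity X k) z) t (ρ k) (ρ k)‖ ≤ β * t⁻¹ := by
    rw [norm_mul]
    refine mul_le_mul (hwn k) ((norm_entry_le _ _ _).trans ?_) (norm_nonneg _) hβ
    simpa [abs_of_pos ht] using norm_green_le (herm_isHermitian (cavity X k) z) ht.ne'
  rw [hcard, abs_of_pos ht] at h1
  calc _ ≤ β * (4 * (2 : ℕ) * t⁻¹) + β * t⁻¹ := add_le_add h1 h3
    _ = _ := by push_cast; ring

/-- A deterministic estimate for an arbitrary bounded profile `s`. In the `2 × 2` system at `k`, the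
quadratic forms are replaced by weighted traces of the cavity resolvent, at the cost of
`cavityError`, and these by traces of the full resolvent, at the cost of `9 β / t` for each of the
two diagonal entries. Since the traces are purely imaginary, the system left over has the real
parameters `a, b ≥ t`, and `norm_sub_solution_le` applies. -/
theorem norm_green_sub_le_cavityError (ht : 0 < t) (k : n) {s : n → n → ℝ} {β : ℝ}
    (hs0 : ∀ i j, 0 ≤ s i j) (hs : ∀ i j, s i j ≤ β) :
    let R := green (herm X z) t
    let a := t + ∑ l, s k l * (R (Sum.inr l) (Sum.inr l)).im
    let b := t + ∑ l, s l k * (R (Sum.inl l) (Sum.inl l)).im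
    let w : ℂ := ((a * b + ‖z‖ ^ 2 : ℝ) : ℂ)
    let ε := (cavityError X s z t k + 18 * β / t) / t ^ 2
    ‖R (Sum.inl k) (Sum.inl k) - Complex.I * b * w⁻¹‖ ≤ ε ∧
    ‖R (Sum.inr k) (Sum.inr k) - Complex.I * a * w⁻¹‖ ≤ ε ∧
    ‖R (Sum.inl k) (Sum.inr k) - -(z * w⁻¹)‖ ≤ ε ∧
    ‖R (Sum.inr k) (Sum.inl k) - -(star z * w⁻¹)‖ ≤ ε := by
  intro R a b w ε
  have hRim : ∀ i, 0 ≤ (R i i).im := fun i => by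
    rw [green_diag_im (herm_isHermitian X z) ht.ne']
    exact mul_nonneg ht.le (Finset.sum_nonneg fun _ _ => sq_nonneg _)
  have ha : t ≤ a := le_add_of_nonneg_right
    (Finset.sum_nonneg fun l _ => mul_nonneg (hs0 _ _) (hRim _))
  have hb : t ≤ b := le_add_of_nonneg_right
    (Finset.sum_nonneg fun l _ => mul_nonneg (hs0 _ _) (hRim _))
  have hRn : ∀ i j, ‖R i j‖ ≤ t⁻¹ := fun i j => (norm_entry_le _ _ _).trans (by
    simpa [abs_of_pos ht] using norm_green_le (herm_isHermitian X z) ht.ne')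
  have hl : Sum.inl k ∈ ({Sum.inl k, Sum.inr k} : Finset (n ⊕ n)) := by simp
  have hr : Sum.inr k ∈ ({Sum.inl k, Sum.inr k} : Finset (n ⊕ n)) := by simp
  set G := cavityGreen X z t k with hG
  obtain ⟨q11, q22, q12, q21⟩ := coupling_quadratic X k G
  have hc := coupling_apply X k k
  have hd1 := norm_sum_green_sub_cavityGreen_le (X := X) (z := z) ht k (w := fun l => s k l)
    (fun l => hs0 k l) (fun l => hs k l) Sum.inr_injective (by simp)
  have hd2 := norm_sum_green_sub_cavityGreen_le (X := X) (z := z) ht k (w := fun l => s l k)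
    (fun l => hs0 l k) (fun l => hs l k) Sum.inl_injective (by simp)
  have ea : Complex.I * a = Complex.I * t + ∑ l, (s k l : ℂ) * R (Sum.inr l) (Sum.inr l) := by
    have : ∀ l, (s k l : ℂ) * R (Sum.inr l) (Sum.inr l) =
        Complex.I * ((s k l * (R (Sum.inr l) (Sum.inr l)).im : ℝ) : ℂ) := fun l => by
      have h := green_herm_diag (X := X) (z := z) ht.ne' (Sum.inr l)
      push_cast
      linear_combination (s k l : ℂ) * h
    simp only [this, ← Finset.mul_sum, a]
    push_cast; ring
  have eb : Complex.I * b = Complex.I * t + ∑ l, (s l k : ℂ) * R (Sum.inl l) (Sum.inl l) := by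
    have : ∀ l, (s l k : ℂ) * R (Sum.inl l) (Sum.inl l) =
        Complex.I * ((s l k * (R (Sum.inl l) (Sum.inl l)).im : ℝ) : ℂ) := fun l => by
      have h := green_herm_diag (X := X) (z := z) ht.ne' (Sum.inl l)
      push_cast
      linear_combination (s l k : ℂ) * h
    simp only [this, ← Finset.mul_sum, b]
    push_cast; ring
  set e11 : ℂ := ∑ l, (s k l : ℂ) * R (Sum.inr l) (Sum.inr l) -
    (coupling X k * G * coupling X k) (Sum.inl k) (Sum.inl k) with he11
  set e12 : ℂ := X k k - (coupling X k * G * coupling X k) (Sum.inl k) (Sum.inr k) with he12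
  set e21 : ℂ := star (X k k) - (coupling X k * G * coupling X k) (Sum.inr k) (Sum.inl k) with he21
  set e22 : ℂ := ∑ l, (s l k : ℂ) * R (Sum.inl l) (Sum.inl l) -
    (coupling X k * G * coupling X k) (Sum.inr k) (Sum.inr k) with he22
  have hε : ‖e11‖ + ‖e12‖ + ‖e21‖ + ‖e22‖ ≤ cavityError X s z t k + 18 * β / t := by
    have n11 : ‖e11‖ ≤ ‖(∑ l', ∑ l, X k l * G (Sum.inr l) (Sum.inr l') * star (X k l')) -
        ∑ l, (s k l : ℂ) * G (Sum.inr l) (Sum.inr l)‖ + 9 * β / t := by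
      have : e11 = (∑ l, (s k l : ℂ) * R (Sum.inr l) (Sum.inr l) -
          ∑ l, (s k l : ℂ) * G (Sum.inr l) (Sum.inr l)) -
          ((∑ l', ∑ l, X k l * G (Sum.inr l) (Sum.inr l') * star (X k l')) -
        ∑ l, (s k l : ℂ) * G (Sum.inr l) (Sum.inr l)) := by rw [he11, q11]; ring
      rw [this]
      exact (norm_sub_le _ _).trans (by linarith)
    have n22 : ‖e22‖ ≤ ‖(∑ l', ∑ l, star (X l k) * G (Sum.inl l) (Sum.inl l') * X l' k) -
        ∑ l, (s l k : ℂ) * G (Sum.inl l) (Sum.inl l)‖ + 9 * β / t := by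
      have : e22 = (∑ l, (s l k : ℂ) * R (Sum.inl l) (Sum.inl l) -
          ∑ l, (s l k : ℂ) * G (Sum.inl l) (Sum.inl l)) -
          ((∑ l', ∑ l, star (X l k) * G (Sum.inl l) (Sum.inl l') * X l' k) -
        ∑ l, (s l k : ℂ) * G (Sum.inl l) (Sum.inl l)) := by rw [he22, q22]; ring
      rw [this]
      exact (norm_sub_le _ _).trans (by linarith)
    have n12 : ‖e12‖ ≤ ‖X k k‖ + ‖∑ l', ∑ l, X k l * G (Sum.inr l) (Sum.inl l') * X l' k‖ := by
      rw [he12, q12]; exact norm_sub_le _ _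
    have n21 : ‖e21‖ ≤ ‖X k k‖ +
        ‖∑ l', ∑ l, star (X l k) * G (Sum.inl l) (Sum.inr l') * star (X k l')‖ := by
      rw [he21, q21]; exact (norm_sub_le _ _).trans (by rw [norm_star])
    simp only [cavityError, ← hG]
    have : 18 * β / t = 9 * β / t + 9 * β / t := by ring
    linarith
  have B11 : (herm (cavity X k) z - (Complex.I * t) • (1 : Matrix (n ⊕ n) (n ⊕ n) ℂ))
      (Sum.inl k) (Sum.inl k) = -(Complex.I * t) := by simp [herm]
  have B22 : (herm (cavity X k) z - (Complex.I * t) • (1 : Matrix (n ⊕ n) (n ⊕ n) ℂ))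
      (Sum.inr k) (Sum.inr k) = -(Complex.I * t) := by simp [herm]
  have B12 : (herm (cavity X k) z - (Complex.I * t) • (1 : Matrix (n ⊕ n) (n ⊕ n) ℂ))
      (Sum.inl k) (Sum.inr k) = -z := by simp [herm, cavity]
  have B21 : (herm (cavity X k) z - (Complex.I * t) • (1 : Matrix (n ⊕ n) (n ⊕ n) ℂ))
      (Sum.inr k) (Sum.inl k) = -star z := by simp [herm, cavity]
  have main : ∀ j ∈ ({Sum.inl k, Sum.inr k} : Finset (n ⊕ n)),
      (-(Complex.I * a) * R (Sum.inl k) j - z * R (Sum.inr k) j =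
        (if Sum.inl k = j then 1 else 0) - (e11 * R (Sum.inl k) j + e12 * R (Sum.inr k) j)) ∧
      (-star z * R (Sum.inl k) j - Complex.I * b * R (Sum.inr k) j =
        (if Sum.inr k = j then 1 else 0) - (e21 * R (Sum.inl k) j + e22 * R (Sum.inr k) j)) := by
    intro j hj
    have m1 := green_cavity_eq (X := X) (z := z) ht.ne' k hl hj
    have m2 := green_cavity_eq (X := X) (z := z) ht.ne' k hr hj
    simp only [B11, B12, B21, B22, hc.1, hc.2.1, hc.2.2.2.2.1, hc.2.2.2.2.2.1, ← hG] at m1 m2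
    constructor
    · rw [ea, he11, he12]
      linear_combination m1
    · rw [eb, he21, he22]
      linear_combination m2
  have r1 := norm_sub_solution_le ht ha hb (hRn _ _) (hRn _ _) (main _ hl).1 (main _ hl).2 hε
  have r2 := norm_sub_solution_le ht ha hb (hRn _ _) (hRn _ _) (main _ hr).1 (main _ hr).2 hε
  simp only [if_true, reduceCtorEq, if_false, mul_one, mul_zero, sub_zero, zero_sub,
    zero_add, add_zero] at r1 r2
  refine ⟨r1.1, r2.2, ?_, ?_⟩
  · rw [← neg_mul]; exact r2.1
  · rw [← neg_mul]; exact r1.2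

end Hermitization

/-! ### Concentration for functions with bounded differences -/

section BoundedDifferences

variable {𝓧 : Type*} [MeasurableSpace 𝓧]

lemma integrable_of_abs_le {Ω : Type*} [MeasurableSpace Ω] {μ : Measure Ω} [IsFiniteMeasure μ]
    {f : Ω → ℝ} (hf : Measurable f) {B : ℝ} (hB : ∀ x, |f x| ≤ B) : Integrable f μ :=
  Integrable.of_bound hf.aestronglyMeasurable B (ae_of_all _ hB)

/-- Hoeffding's lemma on the interval of radius `c` around one value of `f`; its half-length `c`
gives the variance proxy `c²`. -/
lemma integral_exp_sub_integral_le {μ : Measure 𝓧} [IsProbabilityMeasure μ] {f : 𝓧 → ℝ}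
    (hf : Measurable f) {c : ℝ} (hc : ∀ x y, |f x - f y| ≤ c) (r : ℝ) :
    ∫ x, Real.exp (r * (f x - ∫ y, f y ∂μ)) ∂μ ≤ Real.exp (c ^ 2 * r ^ 2 / 2) := by
  obtain ⟨x₀⟩ : Nonempty 𝓧 := by
    by_contra h
    rw [not_nonempty_iff] at h
    have := measure_univ (μ := μ)
    rw [Set.eq_empty_of_isEmpty Set.univ, measure_empty] at this
    exact zero_ne_one this
  have hmem : ∀ᵐ x ∂μ, f x ∈ Set.Icc (f x₀ - c) (f x₀ + c) := ae_of_all _ fun x => by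
    have := abs_le.1 (hc x x₀)
    constructor <;> linarith
  have h := (hasSubgaussianMGF_of_mem_Icc hf.aemeasurable hmem).mgf_le r
  have hc0 : 0 ≤ c := (abs_nonneg _).trans (hc x₀ x₀)
  have e : ((((‖f x₀ + c - (f x₀ - c)‖₊ : NNReal) / 2) ^ 2 : NNReal) : ℝ) = c ^ 2 := by
    push_cast
    rw [Real.norm_of_nonneg (by linarith)]
    ring
  rw [e] at h
  exact h

/-- Induction on the number of coordinates. Integrating out the first one leaves the function `fbar`
of the others, which inherits the bounded differences, and Hoeffding's lemma controls the
fluctuation of `f` around `fbar`. The two exponents add. -/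
theorem integral_exp_pi_le {n : ℕ} (μ : Fin n → Measure 𝓧) [∀ i, IsProbabilityMeasure (μ i)]
    {f : (Fin n → 𝓧) → ℝ} (hf : Measurable f) {B c : ℝ} (hB : ∀ x, |f x| ≤ B)
    (hc : ∀ x i y, |f (Function.update x i y) - f x| ≤ c) (r : ℝ) :
    ∫ x, Real.exp (r * (f x - ∫ y, f y ∂Measure.pi μ)) ∂Measure.pi μ
      ≤ Real.exp (n * c ^ 2 * r ^ 2 / 2) := by
  induction n with
  | zero =>
    have h : ∀ x, f x = f default := fun x => congrArg f (Subsingleton.elim _ _)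
    simp [h]
  | succ n ih =>
    set ν := Measure.pi fun j : Fin n => μ j.succ with hν
    let h : 𝓧 × (Fin n → 𝓧) → ℝ := fun p => f (Fin.cons p.1 p.2)
    have mcons : Measurable fun p : 𝓧 × (Fin n → 𝓧) => (Fin.cons p.1 p.2 : Fin (n + 1) → 𝓧) := by
      refine measurable_pi_lambda _ fun i => ?_
      refine Fin.cases ?_ (fun j => ?_) i
      · simpa using measurable_fst
      · simpa [Function.comp_def] using (measurable_pi_apply j).comp (measurable_snd (α := 𝓧))
    have hh : Measurable h := hf.comp mcons
    have hhB : ∀ p, |h p| ≤ B := fun p => hB _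
    have transfer : ∀ φ : (Fin (n + 1) → 𝓧) → ℝ,
        ∫ x, φ x ∂Measure.pi μ = ∫ p, φ (Fin.cons p.1 p.2) ∂((μ 0).prod ν) := by
      intro φ
      rw [← ((measurePreserving_piFinSuccAbove μ 0).symm).integral_comp']
      simp_rw [MeasurableEquiv.piFinSuccAbove_symm_apply, Fin.insertNthEquiv, Fin.insertNth_zero,
        Equiv.coe_fn_mk, Fin.zero_succAbove]
      rfl
    let fbar : (Fin n → 𝓧) → ℝ := fun x => ∫ a, h (a, x) ∂μ 0
    have hfbar : Measurable fbar :=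
      (hh.stronglyMeasurable.integral_prod_left (μ := μ 0)).measurable
    have hint : ∀ x, Integrable (fun a => h (a, x)) (μ 0) := fun x =>
      integrable_of_abs_le (hh.comp measurable_prodMk_right) fun a => hhB _
    have hfbarB : ∀ x, |fbar x| ≤ B := fun x => by
      have := norm_integral_le_of_norm_le_const (μ := μ 0) (f := fun a => h (a, x)) (C := B)
        (ae_of_all _ fun a => hhB _)
      simpa using this
    have hfbarc : ∀ x i y, |fbar (Function.update x i y) - fbar x| ≤ c := by
      intro x i y
      have e : fbar (Function.update x i y) - fbar x =
          ∫ a, (h (a, Function.update x i y) - h (a, x)) ∂μ 0 :=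
        (integral_sub (hint _) (hint _)).symm
      rw [e]
      have := norm_integral_le_of_norm_le_const (μ := μ 0)
        (f := fun a => h (a, Function.update x i y) - h (a, x)) (C := c)
        (ae_of_all _ fun a => by
          have := hc (Fin.cons a x) i.succ y
          rw [← Fin.cons_update] at this
          exact this)
      simpa using this
    have hmean : ∫ x, f x ∂Measure.pi μ = ∫ x, fbar x ∂ν := by
      rw [transfer, integral_prod_symm _ (integrable_of_abs_le hh hhB)]
    set m := ∫ x, fbar x ∂ν with hm
    have hexpB : ∀ (u v : ℝ), |u| ≤ B → Real.exp (r * (u - v)) ≤ Real.exp (|r| * (B + |v|)) := by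
      intro u v hu
      refine Real.exp_le_exp.2 ((le_abs_self _).trans ?_)
      rw [abs_mul]
      gcongr
      exact (abs_sub _ _).trans (by linarith)
    have hexpint : Integrable (fun p => Real.exp (r * (h p - m))) ((μ 0).prod ν) :=
      integrable_of_abs_le (by fun_prop) fun p => by
        rw [abs_of_pos (Real.exp_pos _)]
        exact hexpB _ _ (hhB p)
    rw [hmean, transfer]
    change ∫ p, Real.exp (r * (h p - m)) ∂((μ 0).prod ν) ≤ _
    rw [integral_prod_symm _ hexpint]
    have hinner : ∀ x, ∫ a, Real.exp (r * (h (a, x) - m)) ∂μ 0 ≤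
        Real.exp (c ^ 2 * r ^ 2 / 2) * Real.exp (r * (fbar x - m)) := by
      intro x
      have e : ∀ a, Real.exp (r * (h (a, x) - m)) =
          Real.exp (r * (h (a, x) - fbar x)) * Real.exp (r * (fbar x - m)) := fun a => by
        rw [← Real.exp_add]; ring_nf
      simp only [e]
      rw [integral_mul_const]
      refine mul_le_mul_of_nonneg_right ?_ (Real.exp_pos _).le
      refine integral_exp_sub_integral_le (hh.comp measurable_prodMk_right) (fun a b => ?_) r
      have := hc (Fin.cons b x) 0 a
      rw [Fin.update_cons_zero] at this
      exact this
    calc ∫ x, ∫ a, Real.exp (r * (h (a, x) - m)) ∂μ 0 ∂ν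
        ≤ ∫ x, Real.exp (c ^ 2 * r ^ 2 / 2) * Real.exp (r * (fbar x - m)) ∂ν := by
          have hi : Integrable (fun x => Real.exp (r * (fbar x - m))) ν := by
            refine integrable_of_abs_le (B := Real.exp (|r| * (B + |m|))) (by fun_prop)
              fun x => ?_
            rw [abs_of_pos (Real.exp_pos _)]
            exact hexpB _ _ (hfbarB x)
          exact integral_mono hexpint.integral_prod_right (hi.const_mul _) hinner
      _ ≤ Real.exp (c ^ 2 * r ^ 2 / 2) * Real.exp (n * c ^ 2 * r ^ 2 / 2) := by
          rw [integral_const_mul]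
          exact mul_le_mul_of_nonneg_left (ih _ hfbar hfbarB hfbarc) (Real.exp_pos _).le
      _ = _ := by rw [← Real.exp_add]; push_cast; ring_nf

/-- McDiarmid's inequality in sub-Gaussian form. -/
theorem hasSubgaussianMGF_pi {n : ℕ} (μ : Fin n → Measure 𝓧) [∀ i, IsProbabilityMeasure (μ i)]
    {f : (Fin n → 𝓧) → ℝ} (hf : Measurable f) {B : ℝ} {c : NNReal} (hB : ∀ x, |f x| ≤ B)
    (hc : ∀ x i y, |f (Function.update x i y) - f x| ≤ c) :
    HasSubgaussianMGF (fun x => f x - ∫ y, f y ∂Measure.pi μ) (n * c ^ 2) (Measure.pi μ) where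
  integrable_exp_mul r := by
    refine integrable_of_abs_le (B := Real.exp (|r| * (B + |∫ y, f y ∂Measure.pi μ|)))
      (by fun_prop) fun x => ?_
    rw [abs_of_pos (Real.exp_pos _)]
    refine Real.exp_le_exp.2 ((le_abs_self _).trans ?_)
    rw [abs_mul]
    gcongr
    exact (abs_sub _ _).trans (by linarith [hB x])
  mgf_le r := by
    have := integral_exp_pi_le μ hf hB hc r
    simpa [mgf] using this

/-- The law of a matrix with independent entries is the product of the laws of its rows. -/
lemma map_eq_pi_pi {Ω : Type*} [MeasurableSpace Ω] {P : Measure Ω} [IsProbabilityMeasure P]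
    {m n : Type*} [Fintype m] [Fintype n] {J : m → n → Ω → 𝓧} (hmeas : ∀ i j, Measurable (J i j))
    (hindep : iIndepFun (fun p : m × n => J p.1 p.2) P) :
    P.map (fun ω i j => J i j ω) =
      Measure.pi fun i => Measure.pi fun j => P.map (J i j) := by
  have : ∀ i j, IsProbabilityMeasure (P.map (J i j)) := fun i j =>
    Measure.isProbabilityMeasure_map (hmeas i j).aemeasurable
  have h1 := hindep.map_fun_eq_pi_map fun p : m × n => (hmeas p.1 p.2).aemeasurable
  have h2 := Measure.infinitePi_map_curry (fun i j => P.map (J i j))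
  simp only [Measure.infinitePi_eq_pi] at h2
  rw [← h1, Measure.map_map (MeasurableEquiv.curry m n 𝓧).measurable
    (measurable_pi_lambda _ fun p : m × n => hmeas p.1 p.2)] at h2
  exact h2

/-- Whole rows serve as the independent coordinates. There are only `n` of them, and a change of one
row still moves a resolvent trace by a bounded rank perturbation. -/
theorem hasSubgaussianMGF_of_rows {Ω : Type*} [MeasurableSpace Ω] {P : Measure Ω}
    [IsProbabilityMeasure P] {n : ℕ} {κ : Type*} [Fintype κ] {J : Fin n → κ → Ω → 𝓧}
    (hmeas : ∀ i j, Measurable (J i j)) (hindep : iIndepFun (fun p : Fin n × κ => J p.1 p.2) P)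
    {f : (Fin n → κ → 𝓧) → ℝ} (hf : Measurable f) {B : ℝ} {c : NNReal} (hB : ∀ x, |f x| ≤ B)
    (hc : ∀ x i y, |f (Function.update x i y) - f x| ≤ c) :
    HasSubgaussianMGF (fun ω => f (fun i j => J i j ω) - ∫ ω, f (fun i j => J i j ω) ∂P)
      (n * c ^ 2) P := by
  have : ∀ i j, IsProbabilityMeasure (P.map (J i j)) := fun i j =>
    Measure.isProbabilityMeasure_map (hmeas i j).aemeasurable
  have hY : Measurable fun ω i j => J i j ω :=
    measurable_pi_lambda _ fun i => measurable_pi_lambda _ fun j => hmeas i j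
  have h := hasSubgaussianMGF_pi (fun i => Measure.pi fun j => P.map (J i j)) hf hB hc
  rw [← map_eq_pi_pi hmeas hindep] at h
  have h2 := HasSubgaussianMGF.of_map hY.aemeasurable h
  rw [integral_map hY.aemeasurable hf.aestronglyMeasurable] at h2
  exact h2

/-- Integrate `|y| ≤ σ (exp (y / σ) + exp (-y / σ))`; at `± 1 / σ` the moment generating function is
at most `exp (1 / 2) ≤ 2`. -/
lemma integral_abs_le_of_hasSubgaussianMGF {Ω : Type*} [MeasurableSpace Ω] {P : Measure Ω}
    [IsProbabilityMeasure P] {Y : Ω → ℝ} {v : NNReal} (h : HasSubgaussianMGF Y v P) {σ : ℝ}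
    (hσ : 0 < σ) (hv : v ≤ σ ^ 2) : ∫ ω, |Y ω| ∂P ≤ 4 * σ := by
  have hpt : ∀ y : ℝ, |y| ≤ σ * (Real.exp (σ⁻¹ * y) + Real.exp (-σ⁻¹ * y)) := fun y => by
    have h1 : |σ⁻¹ * y| ≤ Real.exp (σ⁻¹ * y) + Real.exp (-σ⁻¹ * y) := by
      rw [abs_le]
      have e1 := Real.add_one_le_exp (σ⁻¹ * y)
      have e2 := Real.add_one_le_exp (-σ⁻¹ * y)
      have p1 := Real.exp_pos (σ⁻¹ * y)
      have p2 := Real.exp_pos (-σ⁻¹ * y)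
      constructor <;> linarith
    rw [abs_mul, abs_of_pos (inv_pos.2 hσ), inv_mul_le_iff₀ hσ] at h1
    exact h1
  have i1 := h.integrable_exp_mul σ⁻¹
  have i2 := h.integrable_exp_mul (-σ⁻¹)
  have hb : (v : ℝ) * (σ⁻¹) ^ 2 / 2 ≤ 1 / 2 := by
    have : (v : ℝ) * (σ⁻¹) ^ 2 ≤ 1 := by
      rw [inv_pow, ← div_eq_mul_inv, div_le_one (by positivity)]; exact hv
    linarith
  have e2 : Real.exp (1 / 2) ≤ 2 := by
    rw [← Real.le_log_iff_exp_le (by norm_num)]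
    linarith [Real.log_two_gt_d9]
  have m1 : ∫ ω, Real.exp (σ⁻¹ * Y ω) ∂P ≤ 2 :=
    (h.mgf_le σ⁻¹).trans ((Real.exp_le_exp.2 hb).trans e2)
  have m2 : ∫ ω, Real.exp (-σ⁻¹ * Y ω) ∂P ≤ 2 :=
    (h.mgf_le (-σ⁻¹)).trans ((Real.exp_le_exp.2 (by rw [neg_sq]; exact hb)).trans e2)
  calc ∫ ω, |Y ω| ∂P ≤ ∫ ω, σ * (Real.exp (σ⁻¹ * Y ω) + Real.exp (-σ⁻¹ * Y ω)) ∂P :=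
        integral_mono h.integrable.abs ((i1.add i2).const_mul σ) fun ω => hpt _
    _ = σ * (∫ ω, Real.exp (σ⁻¹ * Y ω) ∂P + ∫ ω, Real.exp (-σ⁻¹ * Y ω) ∂P) := by
        rw [integral_const_mul, integral_add i1 i2]
    _ ≤ σ * (2 + 2) := by gcongr
    _ = _ := by ring

end BoundedDifferences

/-! ### Moments of forms in independent variables -/

section Moments

variable {Ω : Type*} [MeasurableSpace Ω] {P : Measure Ω} [IsProbabilityMeasure P]

lemma measurable_complex_star : Measurable (star : ℂ → ℂ) := continuous_star.measurable

/-- If `E ‖Y‖² ≤ τ²`, then `E ‖Y‖ ≤ τ`. -/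
lemma lintegral_enorm_le_of_integral_sq_le {Y : Ω → ℂ} (hY : MemLp Y 2 P) {τ : ℝ} (hτ : 0 < τ)
    (h : ∫ ω, ‖Y ω‖ ^ 2 ∂P ≤ τ ^ 2) : ∫⁻ ω, ‖Y ω‖ₑ ∂P ≤ ENNReal.ofReal τ := by
  have hi : Integrable Y P := hY.integrable (by norm_num)
  have hi2 : Integrable (fun ω => ‖Y ω‖ ^ 2) P := hY.norm.integrable_sq
  rw [← ofReal_integral_norm_eq_lintegral_enorm hi]
  refine ENNReal.ofReal_le_ofReal ?_
  have hpt : ∀ ω, ‖Y ω‖ ≤ (2 * τ)⁻¹ * ‖Y ω‖ ^ 2 + τ / 2 := fun ω => by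
    have : (2 * τ)⁻¹ * ‖Y ω‖ ^ 2 + τ / 2 - ‖Y ω‖ = (2 * τ)⁻¹ * (‖Y ω‖ - τ) ^ 2 := by
      field_simp; ring
    have h2 : 0 ≤ (2 * τ)⁻¹ * (‖Y ω‖ - τ) ^ 2 := by positivity
    linarith
  calc ∫ ω, ‖Y ω‖ ∂P ≤ ∫ ω, ((2 * τ)⁻¹ * ‖Y ω‖ ^ 2 + τ / 2) ∂P :=
        integral_mono hi.norm ((hi2.const_mul _).add (integrable_const _)) hpt
    _ = (2 * τ)⁻¹ * ∫ ω, ‖Y ω‖ ^ 2 ∂P + τ / 2 := by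
        rw [integral_add (hi2.const_mul _) (integrable_const _), integral_const_mul]; simp
    _ ≤ (2 * τ)⁻¹ * τ ^ 2 + τ / 2 := by gcongr
    _ = τ := by field_simp; norm_num

/-- Linear combinations of uncorrelated variables. -/
lemma lintegral_enorm_sum_le {κ : Type*} {s : Finset κ} {ξ : κ → Ω → ℂ} {c : κ → ℂ} {v τ : ℝ}
    (hτ : 0 < τ) (hL : ∀ p ∈ s, MemLp (ξ p) 2 P)
    (hcorr : ∀ p ∈ s, ∀ q ∈ s, p ≠ q → ∫ ω, ξ p ω * star (ξ q ω) ∂P = 0)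
    (hv : ∀ p ∈ s, ∫ ω, ‖ξ p ω‖ ^ 2 ∂P ≤ v) (hc : v * ∑ p ∈ s, ‖c p‖ ^ 2 ≤ τ ^ 2) :
    ∫⁻ ω, ‖∑ p ∈ s, c p * ξ p ω‖ₑ ∂P ≤ ENNReal.ofReal τ := by
  classical
  have hY : MemLp (fun ω => ∑ p ∈ s, c p * ξ p ω) 2 P :=
    memLp_finsetSum s fun p hp => (hL p hp).const_mul _
  refine lintegral_enorm_le_of_integral_sq_le hY hτ (le_trans ?_ hc)
  have hint : ∀ p ∈ s, ∀ q ∈ s, Integrable (fun ω => ξ p ω * star (ξ q ω)) P := fun p hp q hq =>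
    (hL p hp).integrable_mul (hL q hq).star
  have key : ((∫ ω, ‖∑ p ∈ s, c p * ξ p ω‖ ^ 2 ∂P : ℝ) : ℂ) =
      ((∑ p ∈ s, ‖c p‖ ^ 2 * ∫ ω, ‖ξ p ω‖ ^ 2 ∂P : ℝ) : ℂ) := by
    rw [← integral_complex_ofReal]
    have e : ∀ ω, ((‖∑ p ∈ s, c p * ξ p ω‖ ^ 2 : ℝ) : ℂ) =
        ∑ p ∈ s, ∑ q ∈ s, c p * star (c q) * (ξ p ω * star (ξ q ω)) := fun ω => by
      rw [Complex.ofReal_pow, ← Complex.mul_conj', map_sum, Finset.sum_mul_sum]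
      refine Finset.sum_congr rfl fun p _ => Finset.sum_congr rfl fun q _ => ?_
      simp only [map_mul, Complex.star_def]
      ring
    simp only [e]
    rw [integral_finsetSum _ fun p hp => integrable_finsetSum _ fun q hq =>
      (hint p hp q hq).const_mul _, Complex.ofReal_sum]
    refine Finset.sum_congr rfl fun p hp => ?_
    rw [integral_finsetSum _ fun q hq => (hint p hp q hq).const_mul _, Finset.sum_eq_single p]
    · rw [integral_const_mul, Complex.star_def, Complex.mul_conj', Complex.ofReal_mul,
        ← integral_complex_ofReal]
      push_cast
      congr 1
      refine integral_congr_ae (ae_of_all _ fun ω => ?_)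
      simp only [Complex.mul_conj']
    · intro q hq hqp
      rw [integral_const_mul, hcorr p hp q hq hqp.symm, mul_zero]
    · exact fun h => absurd hp h
  rw [Complex.ofReal_injective key, Finset.mul_sum]
  refine Finset.sum_le_sum fun p hp => ?_
  rw [mul_comm]
  exact mul_le_mul_of_nonneg_right (hv p hp) (sq_nonneg _)

/-- A family of independent centred variables with variance `v` whose fourth moments and squared
variance are at most `w`. -/
structure IsNoise {ι : Type*} (P : Measure Ω) (y : ι → Ω → ℂ) (v w : ℝ) : Prop where
  meas : ∀ i, Measurable (y i)
  indep : iIndepFun y P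
  mean : ∀ i, ∫ ω, y i ω ∂P = 0
  var : ∀ i, ∫ ω, ‖y i ω‖ ^ 2 ∂P = v
  fourth_int : ∀ i, Integrable (fun ω => ‖y i ω‖ ^ 4) P
  fourth : ∀ i, ∫ ω, ‖y i ω‖ ^ 4 ∂P ≤ w
  var_sq : v ^ 2 ≤ w

namespace IsNoise

variable {ι : Type*} {y : ι → Ω → ℂ} {v w : ℝ}

lemma precomp (h : IsNoise P y v w) {κ : Type*} {p : κ → ι} (hp : p.Injective) :
    IsNoise P (fun k => y (p k)) v w :=
  ⟨fun _ => h.meas _, h.indep.precomp hp, fun _ => h.mean _, fun _ => h.var _,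
    fun _ => h.fourth_int _, fun _ => h.fourth _, h.var_sq⟩

lemma star (h : IsNoise P y v w) : IsNoise P (fun i ω => star (y i ω)) v w :=
  ⟨fun i => measurable_complex_star.comp (h.meas i), h.indep.comp (fun _ => Star.star) fun _ => measurable_complex_star,
    fun i => by
      have := integral_conj (μ := P) (f := y i)
      simp only [Complex.star_def]
      rw [this, h.mean i, map_zero],
    fun i => by simpa using h.var i, fun i => by simpa using h.fourth_int i,
    fun i => by simpa using h.fourth i, h.var_sq⟩

lemma memLp_two (h : IsNoise P y v w) (i : ι) : MemLp (y i) 2 P := by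
  refine (memLp_two_iff_integrable_sq_norm (h.meas i).aestronglyMeasurable).2 ?_
  refine ((integrable_const (1 : ℝ)).add (h.fourth_int i)).mono'
    ((h.meas i).norm.pow_const 2).aestronglyMeasurable (ae_of_all _ fun ω => ?_)
  rw [Real.norm_of_nonneg (by positivity)]
  simp only [Pi.add_apply]
  nlinarith [sq_nonneg (‖y i ω‖ ^ 2 - 1)]

/-- The index `a` differs from the three others, so its factor is independent of theirs and its mean
splits off. The indices `b`, `c`, `d` may coincide. -/
lemma integral_four_eq_zero (h : IsNoise P y v w) {a b c d : ι} (hab : a ≠ b) (hac : a ≠ c)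
    (had : a ≠ d) {f₁ f₂ f₃ f₄ : ℂ → ℂ} (h₁ : Measurable f₁) (h₂ : Measurable f₂)
    (h₃ : Measurable f₃) (h₄ : Measurable f₄) (h0 : ∫ ω, f₁ (y a ω) ∂P = 0) :
    ∫ ω, f₁ (y a ω) * (f₂ (y b ω) * f₃ (y c ω) * f₄ (y d ω)) ∂P = 0 := by
  classical
  have hind := h.indep.indepFun_finset {a} {b, c, d} (by simp [hab, hac, had]) h.meas
  have m₁ : Measurable fun u : ({a} : Finset ι) → ℂ => f₁ (u ⟨a, by simp⟩) :=
    h₁.comp (measurable_pi_apply _)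
  have m₂ : Measurable fun u : ({b, c, d} : Finset ι) → ℂ =>
      f₂ (u ⟨b, by simp⟩) * f₃ (u ⟨c, by simp⟩) * f₄ (u ⟨d, by simp⟩) := by
    fun_prop
  have h' := hind.comp m₁ m₂
  have e := h'.integral_fun_mul_eq_mul_integral
    ((h₁.comp (h.meas a)).aestronglyMeasurable)
    (((h₂.comp (h.meas b)).mul (h₃.comp (h.meas c))).mul
      (h₄.comp (h.meas d))).aestronglyMeasurable
  simp only [Function.comp_def] at e
  rw [e, h0, zero_mul]

lemma integral_sq_mul_sq (h : IsNoise P y v w) {a b : ι} (hab : a ≠ b) :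
    ∫ ω, ‖y a ω‖ ^ 2 * ‖y b ω‖ ^ 2 ∂P = v ^ 2 := by
  have h' := (h.indep.indepFun hab).comp (φ := fun u : ℂ => ‖u‖ ^ 2) (ψ := fun u : ℂ => ‖u‖ ^ 2)
    (measurable_norm.pow_const 2) (measurable_norm.pow_const 2)
  have e := h'.integral_fun_mul_eq_mul_integral
    ((h.meas a).norm.pow_const 2).aestronglyMeasurable
    ((h.meas b).norm.pow_const 2).aestronglyMeasurable
  simp only [Function.comp_def, h.var] at e
  rw [e, sq]

lemma memLp_mul (h : IsNoise P y v w) (a b : ι) {f : ℂ → ℂ} (hf : Measurable f)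
    (hfn : ∀ u, ‖f u‖ = ‖u‖) : MemLp (fun ω => y a ω * f (y b ω)) 2 P := by
  refine (memLp_two_iff_integrable_sq_norm
    ((h.meas a).mul (hf.comp (h.meas b))).aestronglyMeasurable).2 ?_
  refine ((h.fourth_int a).add (h.fourth_int b)).mono'
    (((h.meas a).mul (hf.comp (h.meas b))).norm.pow_const 2).aestronglyMeasurable
    (ae_of_all _ fun ω => ?_)
  simp only [Pi.add_apply, Pi.mul_apply, Function.comp_apply]
  rw [Real.norm_of_nonneg (by positivity), norm_mul, hfn]
  nlinarith [sq_nonneg (‖y a ω‖ ^ 2 - ‖y b ω‖ ^ 2), sq_nonneg (‖y a ω‖ ^ 2),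
    sq_nonneg (‖y b ω‖ ^ 2)]

lemma lintegral_linear_le (h : IsNoise P y v w) [Fintype ι] {c : ι → ℂ} {τ : ℝ} (hτ : 0 < τ)
    (hc : v * ∑ i, ‖c i‖ ^ 2 ≤ τ ^ 2) :
    ∫⁻ ω, ‖∑ i, c i * y i ω‖ₑ ∂P ≤ ENNReal.ofReal τ := by
  refine lintegral_enorm_sum_le hτ (fun i _ => h.memLp_two i) (fun i _ j _ hij => ?_)
    (fun i _ => (h.var i).le) hc
  have := h.integral_four_eq_zero hij hij hij (f₁ := id) (f₂ := Star.star) (f₃ := fun _ => 1)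
    (f₄ := fun _ => 1) measurable_id measurable_complex_star measurable_const measurable_const (h.mean i)
  simpa using this

/-- Bilinear combinations `∑ c p * y (a p) * f (y (b p))` in which each pair of terms contains an
index occurring only once. -/
lemma lintegral_bilinear_le (h : IsNoise P y v w) {κ : Type*} {s : Finset κ} {a b : κ → ι}
    {f : ℂ → ℂ} (hf : Measurable f) (hfn : ∀ u, ‖f u‖ = ‖u‖)
    (hf0 : ∀ i, ∫ ω, f (y i ω) ∂P = 0) (hab : ∀ p ∈ s, a p ≠ b p)
    (hsep : ∀ p ∈ s, ∀ q ∈ s, p ≠ q →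
      (a p ≠ a q ∧ a p ≠ b q) ∨ (b p ≠ a q ∧ b p ≠ b q))
    {c : κ → ℂ} {τ : ℝ} (hτ : 0 < τ) (hc : w * ∑ p ∈ s, ‖c p‖ ^ 2 ≤ τ ^ 2) :
    ∫⁻ ω, ‖∑ p ∈ s, c p * (y (a p) ω * f (y (b p) ω))‖ₑ ∂P ≤ ENNReal.ofReal τ := by
  refine lintegral_enorm_sum_le hτ (fun p _ => h.memLp_mul _ _ hf hfn) (fun p hp q hq hpq => ?_)
    (fun p hp => ?_) hc
  · have hsf : Measurable fun u => Star.star (f u) := measurable_complex_star.comp hf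
    rcases hsep p hp q hq hpq with ⟨h1, h2⟩ | ⟨h1, h2⟩
    · have := h.integral_four_eq_zero (hab p hp) h1 h2 (f₁ := id) (f₂ := f) (f₃ := Star.star)
        (f₄ := fun u => Star.star (f u)) measurable_id hf measurable_complex_star hsf (h.mean _)
      rw [← this]
      refine integral_congr_ae (ae_of_all _ fun ω => ?_)
      simp only [star_mul', id]
      ring
    · have := h.integral_four_eq_zero (hab p hp).symm h1 h2 (f₁ := f) (f₂ := id)
        (f₃ := Star.star) (f₄ := fun u => Star.star (f u)) hf measurable_id measurable_complex_star hsf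
        (hf0 _)
      rw [← this]
      refine integral_congr_ae (ae_of_all _ fun ω => ?_)
      simp only [star_mul', id]
      ring
  · refine le_trans (le_of_eq ?_) h.var_sq
    rw [← h.integral_sq_mul_sq (hab p hp)]
    refine integral_congr_ae (ae_of_all _ fun ω => ?_)
    simp only [norm_mul, hfn, mul_pow]

/-- The variables `|y i|² - v` are independent and centred, with variance `E |y i|⁴ - v² ≤ w`. -/
lemma lintegral_diag_le (h : IsNoise P y v w) [Fintype ι] {c : ι → ℂ} {τ : ℝ} (hτ : 0 < τ)
    (hc : w * ∑ i, ‖c i‖ ^ 2 ≤ τ ^ 2) :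
    ∫⁻ ω, ‖∑ i, c i * ((‖y i ω‖ ^ 2 - v : ℝ) : ℂ)‖ₑ ∂P ≤ ENNReal.ofReal τ := by
  have hi2 : ∀ i, Integrable (fun ω => ‖y i ω‖ ^ 2) P := fun i =>
    (h.memLp_two i).norm.integrable_sq
  have hm : ∀ i, Measurable fun ω => ((‖y i ω‖ ^ 2 - v : ℝ) : ℂ) := fun i =>
    Complex.measurable_ofReal.comp (((h.meas i).norm.pow_const 2).sub_const v)
  have hsq : ∀ i ω, ‖((‖y i ω‖ ^ 2 - v : ℝ) : ℂ)‖ ^ 2 =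
      ‖y i ω‖ ^ 4 - 2 * v * ‖y i ω‖ ^ 2 + v ^ 2 := fun i ω => by
    rw [Complex.norm_real, Real.norm_eq_abs, sq_abs]; ring
  have hsqi : ∀ i, Integrable (fun ω => ‖y i ω‖ ^ 4 - 2 * v * ‖y i ω‖ ^ 2 + v ^ 2) P := fun i =>
    ((h.fourth_int i).sub ((hi2 i).const_mul _)).add (integrable_const _)
  refine lintegral_enorm_sum_le hτ (fun i _ => ?_) (fun i _ j _ hij => ?_) (fun i _ => ?_) hc
  · refine (memLp_two_iff_integrable_sq_norm (hm i).aestronglyMeasurable).2 ?_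
    simp only [hsq]
    exact hsqi i
  · have hf : Measurable fun u : ℂ => ((‖u‖ ^ 2 - v : ℝ) : ℂ) :=
      Complex.measurable_ofReal.comp ((measurable_norm.pow_const 2).sub_const v)
    have h0 : ∫ ω, ((‖y i ω‖ ^ 2 - v : ℝ) : ℂ) ∂P = 0 := by
      rw [integral_complex_ofReal, integral_sub (hi2 i) (integrable_const _), h.var]
      simp
    have := h.integral_four_eq_zero hij hij hij (f₁ := fun u : ℂ => ((‖u‖ ^ 2 - v : ℝ) : ℂ))
      (f₂ := fun u : ℂ => ((‖u‖ ^ 2 - v : ℝ) : ℂ)) (f₃ := fun _ => 1)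
      (f₄ := fun _ => 1) hf hf measurable_const measurable_const h0
    simpa [Complex.conj_ofReal] using this
  · simp only [hsq]
    have i1 : Integrable (fun ω => ‖y i ω‖ ^ 4 - 2 * v * ‖y i ω‖ ^ 2) P :=
      (h.fourth_int i).sub ((hi2 i).const_mul _)
    rw [integral_add i1 (integrable_const _),
      integral_sub (h.fourth_int i) ((hi2 i).const_mul _), integral_const_mul, h.var]
    have := h.fourth i
    simp only [integral_const, probReal_univ, one_smul]
    nlinarith [sq_nonneg v]

/-- Fluctuations of the quadratic form `∑ y l B l l' ȳ l'`. -/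
lemma lintegral_quadratic_le (h : IsNoise P y v w) [Fintype ι] [LinearOrder ι]
    {B : ι → ι → ℂ} {τ : ℝ} (hτ : 0 < τ) (hB : w * ∑ i, ∑ j, ‖B i j‖ ^ 2 ≤ τ ^ 2) :
    ∫⁻ ω, ‖(∑ j, ∑ i, y i ω * B i j * Star.star (y j ω)) - ∑ i, (v : ℂ) * B i i‖ₑ ∂P ≤
      3 * ENNReal.ofReal τ := by
  have hw : 0 ≤ w := (sq_nonneg v).trans h.var_sq
  have hsub : ∀ s : Finset (ι × ι), w * ∑ p ∈ s, ‖B p.1 p.2‖ ^ 2 ≤ τ ^ 2 := fun s => by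
    refine le_trans (mul_le_mul_of_nonneg_left ?_ hw) hB
    rw [← Finset.sum_product']
    exact Finset.sum_le_sum_of_subset_of_nonneg (by simp) fun _ _ _ => sq_nonneg _
  have hdiagB : w * ∑ i, ‖B i i‖ ^ 2 ≤ τ ^ 2 := by
    refine le_trans (mul_le_mul_of_nonneg_left (Finset.sum_le_sum fun i _ => ?_) hw) hB
    exact Finset.single_le_sum (f := fun j => ‖B i j‖ ^ 2) (fun _ _ => sq_nonneg _)
      (Finset.mem_univ i)
  -- The off-diagonal part is cut into two triangles. Within one triangle, two different pairs
  -- always contain an index that occurs only once, so the terms are uncorrelated. Between `(i, j)`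
  -- and `(j, i)` there would be a correlation involving `E y²`, about which nothing is assumed.
  set L : Finset (ι × ι) := Finset.univ.filter fun p => p.1 < p.2 with hL
  set G : Finset (ι × ι) := Finset.univ.filter fun p => p.2 < p.1 with hG
  have b1 := lintegral_diag_le h hτ hdiagB
  have b2 := h.lintegral_bilinear_le (s := L) (a := Prod.fst) (b := Prod.snd) (f := Star.star)
    measurable_complex_star (fun u => norm_star u) (fun i => h.star.mean i)
    (fun p hp => ((Finset.mem_filter.1 hp).2).ne)
    (fun p hp q hq hpq => by
      have h1 := (Finset.mem_filter.1 hp).2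
      have h2 := (Finset.mem_filter.1 hq).2
      by_contra hcon
      push Not at hcon
      obtain ⟨c1, c2⟩ := hcon
      by_cases e : p.1 = q.1
      · have : p.2 ≠ q.2 := fun e2 => hpq (Prod.ext e e2)
        exact this (c2 (fun e3 => by rw [← e] at e3; exact h1.ne' e3))
      · have e1 := c1 e
        have : p.2 = q.2 := c2 (fun e3 => by
          rw [e1, e3] at h1; exact lt_asymm h1 h2)
        rw [e1, this] at h1; exact lt_irrefl _ h1)
    (c := fun p => B p.1 p.2) hτ (hsub L)
  have b3 := h.lintegral_bilinear_le (s := G) (a := Prod.fst) (b := Prod.snd) (f := Star.star)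
    measurable_complex_star (fun u => norm_star u) (fun i => h.star.mean i)
    (fun p hp => ((Finset.mem_filter.1 hp).2).ne')
    (fun p hp q hq hpq => by
      have h1 := (Finset.mem_filter.1 hp).2
      have h2 := (Finset.mem_filter.1 hq).2
      by_contra hcon
      push Not at hcon
      obtain ⟨c1, c2⟩ := hcon
      by_cases e : p.1 = q.1
      · have : p.2 ≠ q.2 := fun e2 => hpq (Prod.ext e e2)
        exact this (c2 (fun e3 => by rw [← e] at e3; exact h1.ne e3))
      · have e1 := c1 e
        have : p.2 = q.2 := c2 (fun e3 => by
          rw [e1, e3] at h1; exact lt_asymm h1 h2)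
        rw [e1, this] at h1; exact lt_irrefl _ h1)
    (c := fun p => B p.1 p.2) hτ (hsub G)
  have split : ∀ ω, (∑ j, ∑ i, y i ω * B i j * Star.star (y j ω)) - ∑ i, (v : ℂ) * B i i =
      (∑ i, B i i * ((‖y i ω‖ ^ 2 - v : ℝ) : ℂ)) +
      (∑ p ∈ L, B p.1 p.2 * (y p.1 ω * Star.star (y p.2 ω))) +
      ∑ p ∈ G, B p.1 p.2 * (y p.1 ω * Star.star (y p.2 ω)) := by
    intro ω
    have e1 : ∑ j, ∑ i, y i ω * B i j * Star.star (y j ω) =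
        ∑ p : ι × ι, B p.1 p.2 * (y p.1 ω * Star.star (y p.2 ω)) := by
      rw [Finset.sum_comm, ← Finset.univ_product_univ, Finset.sum_product]
      exact Finset.sum_congr rfl fun i _ => Finset.sum_congr rfl fun j _ => by ring
    have e2 : ∑ p : ι × ι, B p.1 p.2 * (y p.1 ω * Star.star (y p.2 ω)) =
        (∑ i, B i i * (y i ω * Star.star (y i ω))) +
        (∑ p ∈ L, B p.1 p.2 * (y p.1 ω * Star.star (y p.2 ω))) +
        ∑ p ∈ G, B p.1 p.2 * (y p.1 ω * Star.star (y p.2 ω)) := by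
      rw [hL, hG, Finset.sum_filter, Finset.sum_filter]
      have e3 : ∑ i, B i i * (y i ω * Star.star (y i ω)) = ∑ p : ι × ι,
          if p.1 = p.2 then B p.1 p.2 * (y p.1 ω * Star.star (y p.2 ω)) else 0 := by
        rw [← Finset.univ_product_univ, Finset.sum_product]
        simp
      rw [e3, ← Finset.sum_add_distrib, ← Finset.sum_add_distrib]
      refine Finset.sum_congr rfl fun p _ => ?_
      rcases lt_trichotomy p.1 p.2 with hlt | heq | hgt
      · simp [hlt, hlt.ne, hlt.not_gt]
      · simp [heq]
      · simp [hgt, hgt.ne', hgt.not_gt]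
    have e4 : ∑ i, B i i * ((‖y i ω‖ ^ 2 - v : ℝ) : ℂ) =
        (∑ i, B i i * (y i ω * Star.star (y i ω))) - ∑ i, (v : ℂ) * B i i := by
      rw [← Finset.sum_sub_distrib]
      refine Finset.sum_congr rfl fun i _ => ?_
      rw [Complex.star_def, Complex.mul_conj']
      push_cast
      ring
    rw [e1, e2, e4]; ring
  have hm : ∀ i, Measurable (y i) := h.meas
  calc _ ≤ ∫⁻ ω, (‖∑ i, B i i * ((‖y i ω‖ ^ 2 - v : ℝ) : ℂ)‖ₑ +
        ‖∑ p ∈ L, B p.1 p.2 * (y p.1 ω * Star.star (y p.2 ω))‖ₑ +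
        ‖∑ p ∈ G, B p.1 p.2 * (y p.1 ω * Star.star (y p.2 ω))‖ₑ) ∂P := by
        refine lintegral_mono fun ω => ?_
        rw [split]
        exact (enorm_add_le _ _).trans (by gcongr; exact enorm_add_le _ _)
    _ ≤ ENNReal.ofReal τ + ENNReal.ofReal τ + ENNReal.ofReal τ := by
        rw [lintegral_add_right, lintegral_add_right]
        · gcongr
        · exact (Finset.measurable_sum _ fun p _ =>
            (((hm _).mul (measurable_complex_star.comp (hm _))).const_mul _)).enorm
        · exact (Finset.measurable_sum _ fun p _ =>
            (((hm _).mul (measurable_complex_star.comp (hm _))).const_mul _)).enorm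
    _ = _ := by ring

end IsNoise

/-- Fubini for a function of two independent variables. -/
lemma lintegral_le_of_indepFun {𝓤 𝓥 : Type*} [MeasurableSpace 𝓤] [MeasurableSpace 𝓥] {U : Ω → 𝓤}
    {V : Ω → 𝓥} (hU : Measurable U) (hV : Measurable V) (hUV : IndepFun U V P)
    {F : 𝓤 × 𝓥 → ENNReal} (hF : Measurable F) {C : ENNReal}
    (h : ∀ v, ∫⁻ ω, F (U ω, v) ∂P ≤ C) : ∫⁻ ω, F (U ω, V ω) ∂P ≤ C := by
  have hmap := (indepFun_iff_map_prod_eq_prod_map_map hU.aemeasurable hV.aemeasurable).1 hUV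
  have : IsProbabilityMeasure (P.map V) := Measure.isProbabilityMeasure_map hV.aemeasurable
  have : IsProbabilityMeasure (P.map U) := Measure.isProbabilityMeasure_map hU.aemeasurable
  rw [← lintegral_map hF (hU.prodMk hV), hmap, lintegral_prod_symm _ hF.aemeasurable]
  calc _ ≤ ∫⁻ _, C ∂P.map V := by
        refine lintegral_mono fun v => ?_
        have hFv : Measurable fun u => F (u, v) := hF.comp measurable_prodMk_right
        rw [lintegral_map hFv hU]
        exact h v
    _ = C := by simp

end Moments

/-! ### Expected size of the cavity errors -/

section CavityMoments

open scoped Matrix Matrix.Norms.L2Operator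

variable {n : Type*} [Fintype n] [DecidableEq n]

/-- The matrix with entries `γ i j * A (i, j)`. -/
def profileMatrix (γ : n → n → ℝ) (A : n × n → ℂ) : Matrix n n ℂ :=
  Matrix.of fun i j => (γ i j : ℂ) * A (i, j)

/-- The entries in row or column `k`. -/
def maskOn (k : n) (A : n × n → ℂ) : n × n → ℂ := fun p => if p.1 = k ∨ p.2 = k then A p else 0

/-- The entries outside row and column `k`. -/
def maskOff (k : n) (A : n × n → ℂ) : n × n → ℂ := fun p => if p.1 = k ∨ p.2 = k then 0 else A p

lemma cavity_maskOff (γ : n → n → ℝ) (A : n × n → ℂ) (k : n) :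
    cavity (profileMatrix γ (maskOff k A)) k = cavity (profileMatrix γ A) k := by
  ext i j
  by_cases h : i = k ∨ j = k <;> simp [cavity, profileMatrix, maskOff, h]

lemma cavityGreen_maskOff (γ : n → n → ℝ) (A : n × n → ℂ) (z : ℂ) (t : ℝ) (k : n) :
    cavityGreen (profileMatrix γ (maskOff k A)) z t k = cavityGreen (profileMatrix γ A) z t k := by
  unfold cavityGreen
  rw [cavity_maskOff]

/-- The formula `det⁻¹ * adjugate` holds at singular matrices too, with both sides zero; the
determinant and the adjugate are continuous. -/
lemma measurable_matrix_inv_apply (i j : n) :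
    Measurable fun A : n → n → ℂ => (Matrix.of A)⁻¹ i j := by
  have hd : Continuous fun A : n → n → ℂ => (Matrix.of A).det :=
    Continuous.matrix_det continuous_id
  have ha : Continuous fun A : n → n → ℂ => (Matrix.of A).adjugate i j :=
    (Continuous.matrix_adjugate (A := fun A : n → n → ℂ => Matrix.of A)
      continuous_id).matrix_elem i j
  have e : (fun A : n → n → ℂ => (Matrix.of A)⁻¹ i j) =
      fun A => ((Matrix.of A).det)⁻¹ * (Matrix.of A).adjugate i j := by
    funext A
    rw [Matrix.inv_def, Matrix.smul_apply, Ring.inverse_eq_inv', smul_eq_mul]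
  rw [e]
  exact hd.measurable.inv.mul ha.measurable

lemma measurable_green {𝓥 : Type*} [MeasurableSpace 𝓥] {H : 𝓥 → Matrix n n ℂ}
    (hH : ∀ i j, Measurable fun v => H v i j) (t : ℝ) (i j : n) :
    Measurable fun v => green (H v) t i j := by
  have h1 : Measurable fun v => (fun i j => H v i j -
      ((Complex.I * t) • (1 : Matrix n n ℂ)) i j : n → n → ℂ) :=
    measurable_pi_lambda _ fun i => measurable_pi_lambda _ fun j => (hH i j).sub_const _
  exact (measurable_matrix_inv_apply i j).comp h1

lemma measurable_herm {𝓥 : Type*} [MeasurableSpace 𝓥] {X : 𝓥 → Matrix n n ℂ}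
    (hX : ∀ i j, Measurable fun v => X v i j) (z : ℂ) (i j : n ⊕ n) :
    Measurable fun v => herm (X v) z i j := by
  rcases i with i | i <;> rcases j with j | j
  · simp only [herm, Matrix.fromBlocks_apply₁₁]; exact measurable_const
  · simp only [herm, Matrix.fromBlocks_apply₁₂, Matrix.sub_apply]; exact (hX i j).sub_const _
  · simp only [herm, Matrix.fromBlocks_apply₂₁, Matrix.conjTranspose_apply, Matrix.sub_apply]
    exact measurable_complex_star.comp ((hX j i).sub_const _)
  · simp only [herm, Matrix.fromBlocks_apply₂₂]; exact measurable_const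

lemma measurable_green_herm_profileMatrix (γ : n → n → ℝ) (z : ℂ) (t : ℝ) (i j : n ⊕ n) :
    Measurable fun A : n × n → ℂ => green (herm (profileMatrix γ A) z) t i j :=
  measurable_green (measurable_herm (fun _ _ => (measurable_pi_apply _).const_mul _) z) t i j

lemma measurable_cavityGreen (γ : n → n → ℝ) (z : ℂ) (t : ℝ) (k : n) (i j : n ⊕ n) :
    Measurable fun A : n × n → ℂ => cavityGreen (profileMatrix γ A) z t k i j := by
  simp only [cavityGreen_apply]
  split_ifs
  · exact measurable_const
  · refine measurable_green (measurable_herm (fun a b => ?_) z) t i j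
    simp only [cavity, profileMatrix, Matrix.of_apply]
    split_ifs
    · exact measurable_const
    · exact (measurable_pi_apply _).const_mul _

lemma sum_cavityGreen_sq_le {X : Matrix n n ℂ} {z : ℂ} {t : ℝ} (ht : 0 < t) (k : n)
    {ρ : n → n ⊕ n} (hρ : ρ.Injective) (j : n ⊕ n) :
    ∑ l, ‖cavityGreen X z t k (ρ l) j‖ ^ 2 ≤ (t⁻¹) ^ 2 := by
  calc ∑ l, ‖cavityGreen X z t k (ρ l) j‖ ^ 2
      ≤ ∑ l, ‖green (herm (cavity X k) z) t (ρ l) j‖ ^ 2 := by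
        refine Finset.sum_le_sum fun l _ => ?_
        rw [cavityGreen_apply]
        split_ifs
        · simp
        · exact le_rfl
    _ ≤ ∑ i, ‖green (herm (cavity X k) z) t i j‖ ^ 2 := by
        rw [← Finset.sum_image (f := fun i => ‖green (herm (cavity X k) z) t i j‖ ^ 2)
          (s := Finset.univ) (g := ρ) (fun x _ y _ h => hρ h)]
        exact Finset.sum_le_sum_of_subset_of_nonneg (Finset.subset_univ _) fun _ _ _ => sq_nonneg _
    _ ≤ ‖green (herm (cavity X k) z) t‖ ^ 2 := norm_toLp_col_le _ _
    _ ≤ _ := by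
        gcongr
        simpa [abs_of_pos ht] using norm_green_le (herm_isHermitian (cavity X k) z) ht.ne'

/-- The squared Hilbert–Schmidt norm is at most the number of columns times the squared operator
norm, which is at most `t⁻²`. -/
lemma sum_sum_cavityGreen_sq_le {X : Matrix n n ℂ} {z : ℂ} {t b : ℝ} (ht : 0 < t) (k : n)
    {ρ ρ' : n → n ⊕ n} (hρ : ρ.Injective) {c : n → n → ℂ} (hc : ∀ l l', ‖c l l'‖ ≤ b ^ 2) :
    ∑ l, ∑ l', ‖c l l' * cavityGreen X z t k (ρ l) (ρ' l')‖ ^ 2 ≤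
      Fintype.card n * b ^ 4 * (t⁻¹) ^ 2 := by
  rw [Finset.sum_comm]
  calc _ ≤ ∑ _l' : n, b ^ 4 * (t⁻¹) ^ 2 := by
        refine Finset.sum_le_sum fun l' _ => ?_
        calc _ ≤ ∑ l, b ^ 4 * ‖cavityGreen X z t k (ρ l) (ρ' l')‖ ^ 2 := by
              refine Finset.sum_le_sum fun l _ => ?_
              rw [norm_mul, mul_pow]
              gcongr
              calc ‖c l l'‖ ^ 2 ≤ (b ^ 2) ^ 2 := by gcongr; exact hc l l'
                _ = b ^ 4 := by ring
          _ ≤ _ := by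
              rw [← Finset.mul_sum]
              exact mul_le_mul_of_nonneg_left (sum_cavityGreen_sq_le ht k hρ _) (by positivity)
    _ = _ := by simp; ring

variable {Ω : Type*} [MeasurableSpace Ω] {P : Measure Ω} [IsProbabilityMeasure P]
  {y : n × n → Ω → ℂ} {v w : ℝ}

lemma IsNoise.indepFun_mask (h : IsNoise P y v w) (k : n) :
    IndepFun (fun ω => maskOn k fun p => y p ω) (fun ω => maskOff k fun p => y p ω) P := by
  classical
  set S : Finset (n × n) := Finset.univ.filter fun p => p.1 = k ∨ p.2 = k with hS
  have hind := h.indep.indepFun_finset S Sᶜ disjoint_compl_right h.meas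
  have m₁ : Measurable fun (u : S → ℂ) (p : n × n) => if hp : p ∈ S then u ⟨p, hp⟩ else 0 := by
    refine measurable_pi_lambda _ fun p => ?_
    by_cases hp : p ∈ S
    · simp only [hp, dif_pos]; exact measurable_pi_apply _
    · simp only [hp, dif_neg, not_false_eq_true]; exact measurable_const
  have m₂ : Measurable fun (u : (Sᶜ : Finset (n × n)) → ℂ) (p : n × n) =>
      if hp : p ∈ Sᶜ then u ⟨p, hp⟩ else 0 := by
    refine measurable_pi_lambda _ fun p => ?_
    by_cases hp : p ∈ Sᶜ
    · simp only [hp, dif_pos]; exact measurable_pi_apply _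
    · simp only [hp, dif_neg, not_false_eq_true]; exact measurable_const
  convert! hind.comp m₁ m₂ using 1
  · funext ω p
    simp [maskOn, hS]
  · funext ω p
    have hp : p ∈ Sᶜ ↔ ¬(p.1 = k ∨ p.2 = k) := by simp [hS]
    by_cases hq : p.1 = k ∨ p.2 = k
    · simp only [maskOff, if_pos hq, Function.comp_apply, dif_neg fun hp' => (hp.1 hp') hq]
    · simp only [maskOff, if_neg hq, Function.comp_apply, dif_pos (hp.2 hq)]

lemma measurable_maskOn (h : IsNoise P y v w) (k : n) :
    Measurable fun ω => maskOn k fun p => y p ω := by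
  refine measurable_pi_lambda _ fun p => ?_
  simp only [maskOn]
  split_ifs
  exacts [h.meas p, measurable_const]

lemma measurable_maskOff (h : IsNoise P y v w) (k : n) :
    Measurable fun ω => maskOff k fun p => y p ω := by
  refine measurable_pi_lambda _ fun p => ?_
  simp only [maskOff]
  split_ifs
  exacts [measurable_const, h.meas p]

lemma IsNoise.lintegral_cavity_le (h : IsNoise P y v w) (k : n)
    {F : (n × n → ℂ) × (n × n → ℂ) → ENNReal} (hF : Measurable F) {C : ENNReal}
    (hC : ∀ A, ∫⁻ ω, F (maskOn k (fun p => y p ω), A) ∂P ≤ C) :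
    ∫⁻ ω, F (maskOn k (fun p => y p ω), maskOff k fun p => y p ω) ∂P ≤ C :=
  lintegral_le_of_indepFun (measurable_maskOn h k) (measurable_maskOff h k) (h.indepFun_mask k)
    hF hC

lemma maskOn_row (k l : n) (A : n × n → ℂ) : maskOn k A (k, l) = A (k, l) := by simp [maskOn]

lemma maskOn_col (k l : n) (A : n × n → ℂ) : maskOn k A (l, k) = A (l, k) := by simp [maskOn]

/-- As `C` vanishes when an index is `k`, only products of `y (k, l)` and `y (l', k)` with `l, l' ≠
k` occur. These are different, independent variables, and two different products always contain one
that occurs only once; so the form is small without any assumption on `E y²`. -/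
lemma IsNoise.lintegral_rowcol_le (h : IsNoise P y v w) (k : n) {C : n → n → ℂ}
    (hC₁ : ∀ l, C k l = 0) (hC₂ : ∀ l, C l k = 0) {τ : ℝ} (hτ : 0 < τ)
    (hC : w * ∑ l, ∑ l', ‖C l l'‖ ^ 2 ≤ τ ^ 2) :
    ∫⁻ ω, ‖∑ l', ∑ l, y (k, l) ω * C l l' * y (l', k) ω‖ₑ ∂P ≤ ENNReal.ofReal τ := by
  have hw : 0 ≤ w := (sq_nonneg v).trans h.var_sq
  set s : Finset (n × n) := Finset.univ.filter fun p => p.1 ≠ k ∧ p.2 ≠ k with hs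
  have b := h.lintegral_bilinear_le (s := s) (a := fun p : n × n => (k, p.1))
    (b := fun p => (p.2, k)) (f := id) measurable_id (fun _ => rfl) (fun i => h.mean i)
    (fun p hp e => (Finset.mem_filter.1 hp).2.1 (Prod.ext_iff.1 e).2)
    (fun p hp q hq hpq => by
      have h1 := (Finset.mem_filter.1 hp).2
      have h2 := (Finset.mem_filter.1 hq).2
      by_cases e : p.1 = q.1
      · refine Or.inr ⟨fun e1 => h1.2 (Prod.ext_iff.1 e1).1, fun e1 => ?_⟩
        exact hpq (Prod.ext e (Prod.ext_iff.1 e1).1)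
      · exact Or.inl ⟨fun e1 => e (Prod.ext_iff.1 e1).2, fun e1 => h1.1 (Prod.ext_iff.1 e1).2⟩)
    (c := fun p => C p.1 p.2) hτ (by
      refine le_trans (mul_le_mul_of_nonneg_left ?_ hw) hC
      rw [← Finset.sum_product']
      exact Finset.sum_le_sum_of_subset_of_nonneg (by simp) fun _ _ _ => sq_nonneg _)
  refine le_trans (le_of_eq ?_) b
  refine lintegral_congr fun ω => ?_
  congr 1
  rw [hs, Finset.sum_filter, Finset.sum_comm, ← Finset.univ_product_univ, Finset.sum_product]
  refine Finset.sum_congr rfl fun l _ => Finset.sum_congr rfl fun l' _ => ?_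
  by_cases h1 : l = k
  · simp [h1, hC₁]
  by_cases h2 : l' = k
  · simp [h2, hC₂]
  simp [h1, h2]
  ring

end CavityMoments

/-! ### Mean bounds for the fluctuation terms and the off-diagonal entries -/

section CavityBounds

open scoped Matrix Matrix.Norms.L2Operator

variable {n : Type*} [Fintype n] [DecidableEq n]
  {Ω : Type*} [MeasurableSpace Ω] {P : Measure Ω} [IsProbabilityMeasure P]
  {y : n × n → Ω → ℂ} {v w : ℝ}

/-- Integrating out the entries in row and column `k` first. -/
lemma IsNoise.lintegral_form_le (h : IsNoise P y v w) (k : n) {γ : n → n → ℝ} {z : ℂ} {t : ℝ}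
    {f : (n × n → ℂ) → Matrix (n ⊕ n) (n ⊕ n) ℂ → ℂ}
    (hf : Measurable fun q : (n × n → ℂ) × (n × n → ℂ) =>
      f q.1 (cavityGreen (profileMatrix γ q.2) z t k))
    (hfk : ∀ u G, f (maskOn k u) G = f u G) {C : ENNReal}
    (hC : ∀ A, ∫⁻ ω, ‖f (fun p => y p ω) (cavityGreen (profileMatrix γ A) z t k)‖ₑ ∂P ≤ C) :
    (Measurable fun ω => f (fun p => y p ω) (cavityGreen (profileMatrix γ fun p => y p ω) z t k)) ∧
    ∫⁻ ω, ‖f (fun p => y p ω) (cavityGreen (profileMatrix γ fun p => y p ω) z t k)‖ₑ ∂P ≤ C := by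
  have hy : Measurable fun ω => ((fun p => y p ω, fun p => y p ω) :
      (n × n → ℂ) × (n × n → ℂ)) :=
    (measurable_pi_lambda _ h.meas).prodMk (measurable_pi_lambda _ h.meas)
  refine ⟨hf.comp hy, ?_⟩
  have := h.lintegral_cavity_le k (F := fun q =>
    ‖f q.1 (cavityGreen (profileMatrix γ q.2) z t k)‖ₑ) hf.enorm (C := C)
    (fun A => by simpa only [hfk] using hC A)
  simpa only [hfk, cavityGreen_maskOff] using this

lemma measurable_cavityGreen_snd (γ : n → n → ℝ) (z : ℂ) (t : ℝ) (k : n) (i j : n ⊕ n) :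
    Measurable fun q : (n × n → ℂ) × (n × n → ℂ) =>
      cavityGreen (profileMatrix γ q.2) z t k i j :=
  (measurable_cavityGreen γ z t k i j).comp measurable_snd

lemma measurable_fst_apply (p : n × n) :
    Measurable fun q : (n × n → ℂ) × (n × n → ℂ) => q.1 p :=
  (measurable_pi_apply p).comp measurable_fst

lemma integrable_of_lintegral_ofReal_le {f : Ω → ℝ} (hf : Measurable f) (hf0 : ∀ ω, 0 ≤ f ω)
    {C : ℝ} (hC : 0 ≤ C) (h : ∫⁻ ω, ENNReal.ofReal (f ω) ∂P ≤ ENNReal.ofReal C) :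
    Integrable f P ∧ ∫ ω, f ω ∂P ≤ C := by
  have hi : Integrable f P := by
    rw [← lintegral_ofReal_ne_top_iff_integrable hf.aestronglyMeasurable (ae_of_all _ hf0)]
    exact (h.trans_lt ENNReal.ofReal_lt_top).ne
  refine ⟨hi, ?_⟩
  rwa [← ofReal_integral_eq_lintegral_ofReal hi (ae_of_all _ hf0),
    ENNReal.ofReal_le_ofReal_iff hC] at h

/-- For a frozen cavity resolvent, the four forms have coefficients with squared Hilbert–Schmidt
norm at most `n b⁴ / t²`, so the moment bounds apply with scale `τ`. The two quadratic forms cost `3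
τ` each, the two mixed forms `τ` each, and the diagonal entry, which is counted twice, `2 τ`. -/
theorem IsNoise.integral_cavityError_le [LinearOrder n] (h : IsNoise P y v w) (k : n)
    {γ : n → n → ℝ} {z : ℂ} {t b τ : ℝ} (ht : 0 < t) (hγ : ∀ i j, |γ i j| ≤ b) (hτ : 0 < τ)
    (hw : w * (Fintype.card n * b ^ 4 * (t⁻¹) ^ 2) ≤ τ ^ 2) (hv : v * b ^ 2 ≤ τ ^ 2) :
    Integrable (fun ω => cavityError (profileMatrix γ fun p => y p ω)
      (fun i j => v * γ i j ^ 2) z t k) P ∧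
    ∫ ω, cavityError (profileMatrix γ fun p => y p ω) (fun i j => v * γ i j ^ 2) z t k ∂P ≤
      10 * τ := by
  have hw0 : 0 ≤ w := (sq_nonneg v).trans h.var_sq
  have hb : 0 ≤ b := (abs_nonneg _).trans (hγ k k)
  have hγγ : ∀ i j i' j', ‖(γ i j : ℂ) * γ i' j'‖ ≤ b ^ 2 := fun i j i' j' => by
    rw [norm_mul, Complex.norm_real, Complex.norm_real, sq]
    exact mul_le_mul (hγ _ _) (hγ _ _) (norm_nonneg _) hb
  have hbd : ∀ {A : n × n → ℂ} {ρ ρ' : n → n ⊕ n} (_ : ρ.Injective) {c : n → n → ℂ}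
      (_ : ∀ l l', ‖c l l'‖ ≤ b ^ 2),
      w * ∑ l, ∑ l', ‖c l l' * cavityGreen (profileMatrix γ A) z t k (ρ l) (ρ' l')‖ ^ 2 ≤ τ ^ 2 :=
    fun hρ _ hc => (mul_le_mul_of_nonneg_left (sum_sum_cavityGreen_sq_le ht k hρ hc) hw0).trans hw
  have hG0 : ∀ (A : n × n → ℂ) (i j : n ⊕ n), (i = Sum.inl k ∨ i = Sum.inr k ∨ j = Sum.inl k ∨
      j = Sum.inr k) → cavityGreen (profileMatrix γ A) z t k i j = 0 := fun A i j hij => by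
    rw [cavityGreen_apply, if_pos]
    simp only [Finset.mem_insert, Finset.mem_singleton]
    tauto
  have mG := measurable_cavityGreen_snd γ z t k
  have mu := measurable_fst_apply (n := n)
  set f₁ : (n × n → ℂ) → Matrix (n ⊕ n) (n ⊕ n) ℂ → ℂ := fun u G =>
    (∑ l', ∑ l, ((γ k l : ℂ) * u (k, l)) * G (Sum.inr l) (Sum.inr l') * Star.star ((γ k l' : ℂ) * u (k, l'))) -
      ∑ l, ((v * γ k l ^ 2 : ℝ) : ℂ) * G (Sum.inr l) (Sum.inr l) with hf₁
  set f₂ : (n × n → ℂ) → Matrix (n ⊕ n) (n ⊕ n) ℂ → ℂ := fun u G =>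
    (∑ l', ∑ l, Star.star ((γ l k : ℂ) * u (l, k)) * G (Sum.inl l) (Sum.inl l') * ((γ l' k : ℂ) * u (l', k))) -
      ∑ l, ((v * γ l k ^ 2 : ℝ) : ℂ) * G (Sum.inl l) (Sum.inl l) with hf₂
  set f₃ : (n × n → ℂ) → Matrix (n ⊕ n) (n ⊕ n) ℂ → ℂ := fun u G =>
    ∑ l', ∑ l, ((γ k l : ℂ) * u (k, l)) * G (Sum.inr l) (Sum.inl l') * ((γ l' k : ℂ) * u (l', k)) with hf₃
  set f₄ : (n × n → ℂ) → Matrix (n ⊕ n) (n ⊕ n) ℂ → ℂ := fun u G =>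
    ∑ l', ∑ l, Star.star ((γ l k : ℂ) * u (l, k)) * G (Sum.inl l) (Sum.inr l') * Star.star ((γ k l' : ℂ) * u (k, l'))
    with hf₄
  have m₁ : Measurable fun q : (n × n → ℂ) × (n × n → ℂ) =>
      f₁ q.1 (cavityGreen (profileMatrix γ q.2) z t k) :=
    (Finset.measurable_sum _ fun l' _ => Finset.measurable_sum _ fun l _ =>
      (((mu _).const_mul _).mul (mG _ _)).mul
        (measurable_complex_star.comp ((mu _).const_mul _))).sub
      (Finset.measurable_sum _ fun l _ => (mG _ _).const_mul _)
  have m₂ : Measurable fun q : (n × n → ℂ) × (n × n → ℂ) =>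
      f₂ q.1 (cavityGreen (profileMatrix γ q.2) z t k) :=
    (Finset.measurable_sum _ fun l' _ => Finset.measurable_sum _ fun l _ =>
      ((measurable_complex_star.comp ((mu _).const_mul _)).mul (mG _ _)).mul
        ((mu _).const_mul _)).sub
      (Finset.measurable_sum _ fun l _ => (mG _ _).const_mul _)
  have m₃ : Measurable fun q : (n × n → ℂ) × (n × n → ℂ) =>
      f₃ q.1 (cavityGreen (profileMatrix γ q.2) z t k) :=
    Finset.measurable_sum _ fun l' _ => Finset.measurable_sum _ fun l _ =>
      (((mu _).const_mul _).mul (mG _ _)).mul ((mu _).const_mul _)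
  have m₄ : Measurable fun q : (n × n → ℂ) × (n × n → ℂ) =>
      f₄ q.1 (cavityGreen (profileMatrix γ q.2) z t k) :=
    Finset.measurable_sum _ fun l' _ => Finset.measurable_sum _ fun l _ =>
      ((measurable_complex_star.comp ((mu _).const_mul _)).mul (mG _ _)).mul
        (measurable_complex_star.comp ((mu _).const_mul _))
  obtain ⟨n₁, I₁⟩ := h.lintegral_form_le k m₁ (fun u G => by simp only [hf₁, maskOn_row])
    (C := 3 * ENNReal.ofReal τ) (fun A => by
      have q := (h.precomp (p := fun l => (k, l)) (Prod.mk_right_injective k)).lintegral_quadratic_le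
        (B := fun l l' => ((γ k l : ℂ) * γ k l') *
          cavityGreen (profileMatrix γ A) z t k (Sum.inr l) (Sum.inr l')) hτ
        (hbd Sum.inr_injective fun l l' => hγγ _ _ _ _)
      refine le_trans (le_of_eq (lintegral_congr fun ω => ?_)) q
      congr 1
      simp only [hf₁]
      congr 1
      · refine Finset.sum_congr rfl fun l' _ => Finset.sum_congr rfl fun l _ => ?_
        simp only [Complex.star_def, map_mul, Complex.conj_ofReal]
        ring
      · refine Finset.sum_congr rfl fun l _ => ?_
        push_cast
        ring)
  obtain ⟨n₂, I₂⟩ := h.lintegral_form_le k m₂ (fun u G => by simp only [hf₂, maskOn_col])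
    (C := 3 * ENNReal.ofReal τ) (fun A => by
      have q := (h.precomp (p := fun l => (l, k))
        (Prod.mk_left_injective k)).star.lintegral_quadratic_le
        (B := fun l l' => ((γ l k : ℂ) * γ l' k) *
          cavityGreen (profileMatrix γ A) z t k (Sum.inl l) (Sum.inl l')) hτ
        (hbd Sum.inl_injective fun l l' => hγγ _ _ _ _)
      refine le_trans (le_of_eq (lintegral_congr fun ω => ?_)) q
      congr 1
      simp only [hf₂]
      congr 1
      · refine Finset.sum_congr rfl fun l' _ => Finset.sum_congr rfl fun l _ => ?_
        simp only [Complex.star_def, map_mul, Complex.conj_ofReal, Complex.conj_conj]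
        ring
      · refine Finset.sum_congr rfl fun l _ => ?_
        push_cast
        ring)
  obtain ⟨n₃, I₃⟩ := h.lintegral_form_le k m₃ (fun u G => by simp only [hf₃, maskOn_row, maskOn_col])
    (C := ENNReal.ofReal τ) (fun A => by
      have q := h.lintegral_rowcol_le k (C := fun l l' => ((γ k l : ℂ) * γ l' k) *
          cavityGreen (profileMatrix γ A) z t k (Sum.inr l) (Sum.inl l'))
        (fun l => by simp [hG0]) (fun l => by simp [hG0]) hτ
        (hbd Sum.inr_injective fun l l' => hγγ _ _ _ _)
      refine le_trans (le_of_eq (lintegral_congr fun ω => ?_)) q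
      congr 1
      simp only [hf₃]
      refine Finset.sum_congr rfl fun l' _ => Finset.sum_congr rfl fun l _ => ?_
      ring)
  obtain ⟨n₄, I₄⟩ := h.lintegral_form_le k m₄ (fun u G => by simp only [hf₄, maskOn_row, maskOn_col])
    (C := ENNReal.ofReal τ) (fun A => by
      -- Here the second summation index belongs to row `k` and the first to column `k`, so the
      -- coefficients enter transposed.
      have q := h.star.lintegral_rowcol_le k (C := fun l' l => ((γ l k : ℂ) * γ k l') *
          cavityGreen (profileMatrix γ A) z t k (Sum.inl l) (Sum.inr l'))
        (fun l => by simp [hG0]) (fun l => by simp [hG0]) hτ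
        (by
          rw [Finset.sum_comm]
          exact hbd Sum.inl_injective (c := fun l l' => (γ l k : ℂ) * γ k l')
            fun l l' => hγγ _ _ _ _)
      refine le_trans (le_of_eq (lintegral_congr fun ω => ?_)) q
      congr 1
      simp only [hf₄]
      rw [Finset.sum_comm]
      refine Finset.sum_congr rfl fun l' _ => Finset.sum_congr rfl fun l _ => ?_
      simp only [Complex.star_def, map_mul, Complex.conj_ofReal]
      ring)
  have I₅ : ∫⁻ ω, ‖(γ k k : ℂ) * y (k, k) ω‖ₑ ∂P ≤ ENNReal.ofReal τ := by
    refine lintegral_enorm_le_of_integral_sq_le ((h.memLp_two _).const_mul _) hτ ?_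
    simp only [norm_mul, mul_pow, integral_const_mul, h.var, Complex.norm_real, Real.norm_eq_abs,
      sq_abs]
    refine le_trans ?_ hv
    rw [mul_comm]
    have hv0 : 0 ≤ v := by
      rw [← h.var (k, k)]; exact integral_nonneg fun _ => sq_nonneg _
    refine mul_le_mul_of_nonneg_left ?_ hv0
    exact sq_le_sq' (by linarith [neg_abs_le (γ k k), hγ k k]) ((le_abs_self _).trans (hγ k k))
  obtain ⟨ξ₁, hξ₁⟩ : ∃ ξ : Ω → ℂ, ∀ ω, f₁ (fun p => y p ω)
      (cavityGreen (profileMatrix γ fun p => y p ω) z t k) = ξ ω := ⟨_, fun _ => rfl⟩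
  obtain ⟨ξ₂, hξ₂⟩ : ∃ ξ : Ω → ℂ, ∀ ω, f₂ (fun p => y p ω)
      (cavityGreen (profileMatrix γ fun p => y p ω) z t k) = ξ ω := ⟨_, fun _ => rfl⟩
  obtain ⟨ξ₃, hξ₃⟩ : ∃ ξ : Ω → ℂ, ∀ ω, f₃ (fun p => y p ω)
      (cavityGreen (profileMatrix γ fun p => y p ω) z t k) = ξ ω := ⟨_, fun _ => rfl⟩
  obtain ⟨ξ₄, hξ₄⟩ : ∃ ξ : Ω → ℂ, ∀ ω, f₄ (fun p => y p ω)
      (cavityGreen (profileMatrix γ fun p => y p ω) z t k) = ξ ω := ⟨_, fun _ => rfl⟩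
  simp only [hξ₁, hξ₂, hξ₃, hξ₄] at n₁ n₂ n₃ n₄ I₁ I₂ I₃ I₄
  have e : ∀ ω, cavityError (profileMatrix γ fun p => y p ω) (fun i j => v * γ i j ^ 2) z t k =
      ‖ξ₁ ω‖ + ‖ξ₂ ω‖ + ‖ξ₃ ω‖ + ‖ξ₄ ω‖ + 2 * ‖(γ k k : ℂ) * y (k, k) ω‖ := fun ω => by
    rw [← hξ₁, ← hξ₂, ← hξ₃, ← hξ₄]; rfl
  have n₅ : Measurable fun ω => (γ k k : ℂ) * y (k, k) ω := (h.meas _).const_mul _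
  refine integrable_of_lintegral_ofReal_le ?_ ?_ (by positivity) ?_
  · simp only [e]
    exact ((((n₁.norm.add n₂.norm).add n₃.norm).add n₄.norm).add (n₅.norm.const_mul _))
  · intro ω
    rw [e]
    positivity
  · have e' : ∀ ω, ENNReal.ofReal (cavityError (profileMatrix γ fun p => y p ω)
        (fun i j => v * γ i j ^ 2) z t k) =
        ‖ξ₁ ω‖ₑ + ‖ξ₂ ω‖ₑ + ‖ξ₃ ω‖ₑ + ‖ξ₄ ω‖ₑ + 2 * ‖(γ k k : ℂ) * y (k, k) ω‖ₑ := fun ω => by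
      rw [e, ENNReal.ofReal_add (by positivity) (by positivity),
        ENNReal.ofReal_add (by positivity) (by positivity),
        ENNReal.ofReal_add (by positivity) (by positivity),
        ENNReal.ofReal_add (by positivity) (by positivity), ENNReal.ofReal_mul (by norm_num)]
      simp only [ofReal_norm, ENNReal.ofReal_ofNat]
    simp only [e']
    rw [lintegral_add_right _ (n₅.enorm.const_mul _), lintegral_add_right _ n₄.enorm,
      lintegral_add_right _ n₃.enorm, lintegral_add_right _ n₂.enorm,
      lintegral_const_mul _ n₅.enorm]
    calc _ ≤ 3 * ENNReal.ofReal τ + 3 * ENNReal.ofReal τ + ENNReal.ofReal τ + ENNReal.ofReal τ +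
          2 * ENNReal.ofReal τ := by gcongr
      _ = ENNReal.ofReal (10 * τ) := by
          rw [ENNReal.ofReal_mul (by norm_num), ENNReal.ofReal_ofNat]; ring

/-- By `green_offdiag_eq`, the entry is a combination of two linear forms in row and column `k`,
with factors at most `t⁻¹` from the full resolvent. The coefficients of these forms come from the
cavity resolvent, so each form has mean size at most `τ`. -/
theorem IsNoise.lintegral_offdiag_le (h : IsNoise P y v w) (k : n)
    {γ : n → n → ℝ} {z : ℂ} {t b τ : ℝ} (ht : 0 < t) (hγ : ∀ i j, |γ i j| ≤ b) (hτ : 0 < τ)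
    (hv : v * (b ^ 2 * (t⁻¹) ^ 2) ≤ τ ^ 2) {i j : n ⊕ n}
    (hi : i ∈ ({Sum.inl k, Sum.inr k} : Finset (n ⊕ n)))
    (hj : j ∉ ({Sum.inl k, Sum.inr k} : Finset (n ⊕ n))) :
    ∫⁻ ω, ‖green (herm (profileMatrix γ fun p => y p ω) z) t i j‖ₑ ∂P ≤
      ENNReal.ofReal (2 * τ / t) := by
  have hv0 : 0 ≤ v := by
    rw [← h.var (k, k)]; exact integral_nonneg fun _ => sq_nonneg _
  have hb : 0 ≤ b := (abs_nonneg _).trans (hγ k k)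
  have mG := measurable_cavityGreen_snd γ z t k
  have mu := measurable_fst_apply (n := n)
  set f₁ : (n × n → ℂ) → Matrix (n ⊕ n) (n ⊕ n) ℂ → ℂ := fun u G =>
    ∑ l, ((γ k l : ℂ) * u (k, l)) * G (Sum.inr l) j with hf₁
  set f₂ : (n × n → ℂ) → Matrix (n ⊕ n) (n ⊕ n) ℂ → ℂ := fun u G =>
    ∑ l, Star.star ((γ l k : ℂ) * u (l, k)) * G (Sum.inl l) j with hf₂
  have m₁ : Measurable fun q : (n × n → ℂ) × (n × n → ℂ) =>
      f₁ q.1 (cavityGreen (profileMatrix γ q.2) z t k) :=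
    Finset.measurable_sum _ fun l _ => ((mu _).const_mul _).mul (mG _ _)
  have m₂ : Measurable fun q : (n × n → ℂ) × (n × n → ℂ) =>
      f₂ q.1 (cavityGreen (profileMatrix γ q.2) z t k) :=
    Finset.measurable_sum _ fun l _ =>
      (measurable_complex_star.comp ((mu _).const_mul _)).mul (mG _ _)
  have hbd : ∀ {A : n × n → ℂ} {ρ : n → n ⊕ n} (_ : ρ.Injective) {c : n → ℝ}
      (_ : ∀ l, |c l| ≤ b),
      v * ∑ l, ‖(c l : ℂ) * cavityGreen (profileMatrix γ A) z t k (ρ l) j‖ ^ 2 ≤ τ ^ 2 := by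
    intro A ρ hρ c hc
    refine le_trans (mul_le_mul_of_nonneg_left ?_ hv0) hv
    calc _ ≤ ∑ l, b ^ 2 * ‖cavityGreen (profileMatrix γ A) z t k (ρ l) j‖ ^ 2 := by
          refine Finset.sum_le_sum fun l _ => ?_
          rw [norm_mul, mul_pow, Complex.norm_real, Real.norm_eq_abs]
          gcongr
          exact hc l
      _ ≤ _ := by
          rw [← Finset.mul_sum]
          exact mul_le_mul_of_nonneg_left (sum_cavityGreen_sq_le ht k hρ _) (by positivity)
  obtain ⟨n₁, I₁⟩ := h.lintegral_form_le k m₁ (fun u G => by simp only [hf₁, maskOn_row])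
    (C := ENNReal.ofReal τ) (fun A => by
      have q := (h.precomp (p := fun l => (k, l)) (Prod.mk_right_injective k)).lintegral_linear_le
        (c := fun l => (γ k l : ℂ) * cavityGreen (profileMatrix γ A) z t k (Sum.inr l) j) hτ
        (hbd Sum.inr_injective fun l => hγ _ _)
      refine le_trans (le_of_eq (lintegral_congr fun ω => ?_)) q
      congr 1
      simp only [hf₁]
      refine Finset.sum_congr rfl fun l _ => ?_
      ring)
  obtain ⟨n₂, I₂⟩ := h.lintegral_form_le k m₂ (fun u G => by simp only [hf₂, maskOn_col])
    (C := ENNReal.ofReal τ) (fun A => by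
      have q := (h.precomp (p := fun l => (l, k))
        (Prod.mk_left_injective k)).star.lintegral_linear_le
        (c := fun l => (γ l k : ℂ) * cavityGreen (profileMatrix γ A) z t k (Sum.inl l) j) hτ
        (hbd Sum.inl_injective fun l => hγ _ _)
      refine le_trans (le_of_eq (lintegral_congr fun ω => ?_)) q
      congr 1
      simp only [hf₂]
      refine Finset.sum_congr rfl fun l _ => ?_
      simp only [Complex.star_def, map_mul, Complex.conj_ofReal]
      ring)
  obtain ⟨ξ₁, hξ₁⟩ : ∃ ξ : Ω → ℂ, ∀ ω, f₁ (fun p => y p ω)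
      (cavityGreen (profileMatrix γ fun p => y p ω) z t k) = ξ ω := ⟨_, fun _ => rfl⟩
  obtain ⟨ξ₂, hξ₂⟩ : ∃ ξ : Ω → ℂ, ∀ ω, f₂ (fun p => y p ω)
      (cavityGreen (profileMatrix γ fun p => y p ω) z t k) = ξ ω := ⟨_, fun _ => rfl⟩
  simp only [hξ₁, hξ₂] at n₁ n₂ I₁ I₂
  have hpt : ∀ ω, ‖green (herm (profileMatrix γ fun p => y p ω) z) t i j‖ₑ ≤
      ENNReal.ofReal t⁻¹ * (‖ξ₁ ω‖ₑ + ‖ξ₂ ω‖ₑ) := fun ω => by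
    have e1 := hξ₁ ω
    have e2 := hξ₂ ω
    set X := profileMatrix γ fun p => y p ω with hX
    have hR : ∀ i j, ‖green (herm X z) t i j‖ ≤ t⁻¹ := fun i j =>
      (norm_entry_le _ _ _).trans (by
        simpa [abs_of_pos ht] using norm_green_le (herm_isHermitian X z) ht.ne')
    have hc := coupling_apply X k
    have e := green_offdiag_eq (X := X) (z := z) ht.ne' k hi hj
    have e1' : (coupling X k * cavityGreen X z t k) (Sum.inl k) j = ξ₁ ω := by
      rw [← e1, Matrix.mul_apply, Fintype.sum_sum_type]
      simp only [(hc _).1, (hc _).2.2.2.2.1, zero_mul, Finset.sum_const_zero, zero_add]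
      rfl
    have e2' : (coupling X k * cavityGreen X z t k) (Sum.inr k) j = ξ₂ ω := by
      rw [← e2, Matrix.mul_apply, Fintype.sum_sum_type]
      simp only [(hc _).2.1, (hc _).2.2.2.2.2.2.2, zero_mul, Finset.sum_const_zero, add_zero]
      rfl
    simp only [e1', e2'] at e
    rw [e, ← ofReal_norm, ← ofReal_norm, ← ofReal_norm, ← ENNReal.ofReal_add (norm_nonneg _)
      (norm_nonneg _), ← ENNReal.ofReal_mul (by positivity)]
    refine ENNReal.ofReal_le_ofReal ?_
    rw [norm_neg, mul_add]
    refine (norm_add_le _ _).trans ?_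
    rw [norm_mul, norm_mul]
    gcongr <;> exact hR _ _
  calc _ ≤ ∫⁻ ω, ENNReal.ofReal t⁻¹ * (‖ξ₁ ω‖ₑ + ‖ξ₂ ω‖ₑ) ∂P := lintegral_mono hpt
    _ ≤ ENNReal.ofReal t⁻¹ * (ENNReal.ofReal τ + ENNReal.ofReal τ) := by
        rw [lintegral_const_mul' _ _ ENNReal.ofReal_ne_top, lintegral_add_right _ n₂.enorm]
        gcongr
    _ = _ := by
        rw [← ENNReal.ofReal_add hτ.le hτ.le, ← ENNReal.ofReal_mul (by positivity)]
        congr 1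
        field_simp
        ring

end CavityBounds

/-! ### Blocks -/

section Blocks

open scoped Matrix Matrix.Norms.L2Operator

variable {D : ℕ} {α : Fin D → ℝ} {g : Fin D → Fin D → ℝ} {N : ℕ}

lemma cumWeight_succ (α : Fin D → ℝ) (c : Fin D) :
    cumWeight α (c.val + 1) = cumWeight α c.val + α c := by
  have : (Finset.univ.filter fun d : Fin D => d.val < c.val + 1) =
      insert c (Finset.univ.filter fun d : Fin D => d.val < c.val) := by
    ext d
    simp only [Finset.mem_filter, Finset.mem_univ, true_and, Finset.mem_insert, Fin.ext_iff]
    omega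
  rw [cumWeight, this, Finset.sum_insert (by simp), add_comm]
  rfl

lemma cumWeight_nonneg (hα : ∀ c, 0 < α c) (m : ℕ) : 0 ≤ cumWeight α m :=
  Finset.sum_nonneg fun d _ => (hα d).le

lemma cumWeight_le_one (hα : ∀ c, 0 < α c) (hsum : ∑ c, α c = 1) (m : ℕ) :
    cumWeight α m ≤ 1 := by
  rw [← hsum]
  exact Finset.sum_le_sum_of_subset_of_nonneg (Finset.filter_subset _ _) fun d _ _ => (hα d).le

/-- Shifting indices to start from `1`, the block consists of the integers in an interval `(A, B]`
with `B - A = N α c`. Their number is `⌊B⌋ - ⌊A⌋`. -/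
lemma abs_blockSize_sub_le (hα : ∀ c, 0 < α c) (hsum : ∑ c, α c = 1) (N : ℕ) (c : Fin D) :
    |(blockSize α N c : ℝ) - N * α c| ≤ 1 := by
  rcases Nat.eq_zero_or_pos N with rfl | hN
  · have : blockSize α 0 c = 0 := by
      rw [blockSize, Finset.card_eq_zero]; exact Finset.eq_empty_of_isEmpty _
    simp [this]
  have hN' : (0 : ℝ) < N := by exact_mod_cast hN
  set A : ℝ := N * cumWeight α c.val with hA
  set B : ℝ := N * cumWeight α (c.val + 1) with hB
  have hA0 : 0 ≤ A := mul_nonneg hN'.le (cumWeight_nonneg hα _)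
  have hAB : B = A + N * α c := by rw [hB, cumWeight_succ]; ring
  have hNα : 0 < N * α c := mul_pos hN' (hα c)
  have hBN : B ≤ N := by
    have := mul_le_mul_of_nonneg_left (cumWeight_le_one hα hsum (c.val + 1)) hN'.le
    linarith
  have hcard : blockSize α N c = (Finset.Ioc ⌊A⌋₊ ⌊B⌋₊).card := by
    rw [blockSize]
    refine Finset.card_bij (fun i _ => i.val + 1) ?_ ?_ ?_
    · intro i hi
      simp only [block, Finset.mem_filter, Finset.mem_univ, true_and, Set.mem_Ioc] at hi
      rw [lt_div_iff₀ hN', div_le_iff₀ hN', mul_comm, mul_comm (cumWeight α (c.val + 1))] at hi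
      rw [Finset.mem_Ioc, Nat.floor_lt hA0, Nat.le_floor_iff (by linarith)]
      exact hi
    · intro i _ j _ h
      exact Fin.ext (by simpa using h)
    · intro m hm
      rw [Finset.mem_Ioc, Nat.floor_lt hA0, Nat.le_floor_iff (by linarith)] at hm
      have hm0 : 0 < m := by exact_mod_cast hA0.trans_lt hm.1
      have hmN : m ≤ N := by exact_mod_cast hm.2.trans hBN
      refine ⟨⟨m - 1, by omega⟩, ?_, by simp only; omega⟩
      simp only [block, Finset.mem_filter, Finset.mem_univ, true_and, Set.mem_Ioc]
      rw [Nat.sub_add_cancel hm0, lt_div_iff₀ hN', div_le_iff₀ hN', mul_comm,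
        mul_comm (cumWeight α (c.val + 1))]
      exact hm
  rw [hcard, Nat.card_Ioc, Nat.cast_sub (Nat.floor_mono (by linarith)), abs_le]
  have h1 := Nat.floor_le hA0
  have h2 := Nat.lt_floor_add_one A
  have h3 := Nat.floor_le (show 0 ≤ B by linarith)
  have h4 := Nat.lt_floor_add_one B
  constructor <;> linarith

/-- The length `m` is a separate variable so that it can be the minimum of two equal block sizes. -/
lemma sum_blockElem {M : Type*} [AddCommMonoid M] (f : Fin N → M) (c : Fin D) {m : ℕ}
    (hm : m = blockSize α N c) (hle : m ≤ blockSize α N c) :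
    ∑ k : Fin m, f (blockElem α N c (k.castLE hle)) = ∑ i ∈ block α N c, f i := by
  subst hm
  have h := Finset.map_orderEmbOfFin_univ (block α N c) rfl
  conv_rhs => rw [← h, Finset.sum_map]
  exact Finset.sum_congr rfl fun k _ => rfl

/-- The label of the block which contains `i`. -/
def label (α : Fin D → ℝ) (hα : ∀ c, 0 < α c) (hsum : ∑ c, α c = 1) {N : ℕ} (i : Fin N) : Fin D :=
  (existsUnique_mem_block α hα hsum N i).choose

variable (hα : ∀ c, 0 < α c) (hsum : ∑ c, α c = 1)

lemma mem_block_iff_label_eq {i : Fin N} {c : Fin D} :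
    i ∈ block α N c ↔ label α hα hsum i = c := by
  have h := (existsUnique_mem_block α hα hsum N i).choose_spec
  exact ⟨fun hi => (h.2 c hi).symm, fun hi => hi ▸ h.1⟩

lemma block_eq_filter_label (c : Fin D) :
    block α N c = Finset.univ.filter fun i => label α hα hsum i = c := by
  ext i
  simp [mem_block_iff_label_eq hα hsum]

/-- The standard deviation profile of the block matrix. -/
def profile (α : Fin D → ℝ) (g : Fin D → Fin D → ℝ) (hα : ∀ c, 0 < α c) (hsum : ∑ c, α c = 1)
    (N : ℕ) (i j : Fin N) : ℝ := g (label α hα hsum i) (label α hα hsum j)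

lemma blockMatrix_eq_profileMatrix (J : Fin N → Fin N → ℂ) :
    blockMatrix α g J = profileMatrix (profile α g hα hsum N) fun p => J p.1 p.2 := by
  ext i j
  rw [blockMatrix_apply α hα hsum g J ((mem_block_iff_label_eq hα hsum).2 rfl)
    ((mem_block_iff_label_eq hα hsum).2 rfl)]
  rfl

/-- The embedding of `{1, …, N}` in the half of the index set containing the block `p`. -/
def tag (p : Fin D ⊕ Fin D) : Fin N → Fin N ⊕ Fin N :=
  p.elim (fun _ => Sum.inl) fun _ => Sum.inr

/-- The label of `p`, forgetting the half. -/
def base (p : Fin D ⊕ Fin D) : Fin D := p.elim id id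

lemma tag_injective (p : Fin D ⊕ Fin D) : (tag p : Fin N → Fin N ⊕ Fin N).Injective := by
  rcases p with p | p
  exacts [Sum.inl_injective, Sum.inr_injective]

/-- The row of the `k`-th diagonal entry of the block `(p, q)`. -/
def rowIdx (α : Fin D → ℝ) (N : ℕ) (p q : Fin D ⊕ Fin D)
    (k : Fin (min (blockSize α N (base p)) (blockSize α N (base q)))) : Fin N ⊕ Fin N :=
  tag p (blockElem α N (base p) (k.castLE (min_le_left _ _)))

/-- The column of the `k`-th diagonal entry of the block `(p, q)`. -/
def colIdx (α : Fin D → ℝ) (N : ℕ) (p q : Fin D ⊕ Fin D)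
    (k : Fin (min (blockSize α N (base p)) (blockSize α N (base q)))) : Fin N ⊕ Fin N :=
  tag q (blockElem α N (base q) (k.castLE (min_le_right _ _)))

lemma rowIdx_injective (p q : Fin D ⊕ Fin D) : (rowIdx α N p q).Injective := fun _ _ h =>
  Fin.castLE_injective _ ((blockElem α N (base p)).injective (tag_injective p h))

lemma colIdx_injective (p q : Fin D ⊕ Fin D) : (colIdx α N p q).Injective := fun _ _ h =>
  Fin.castLE_injective _ ((blockElem α N (base q)).injective (tag_injective q h))

lemma stieltjes_apply (X : Matrix (Fin N) (Fin N) ℂ) (z : ℂ) (t : ℝ) (p q : Fin D ⊕ Fin D) :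
    stieltjes α X z (Complex.I * t) p q =
      ∑ k, (((α (base p) * N)⁻¹ : ℝ) : ℂ) *
        green (herm X z) t (rowIdx α N p q k) (colIdx α N p q k) := by
  have e : (((α (base p) * N)⁻¹ : ℝ) : ℂ) = 1 / (α (base p) : ℂ) * (1 / (N : ℂ)) := by
    push_cast; rw [mul_inv]; simp
  rw [← Finset.mul_sum, e, mul_assoc, ← resolvent_eq_green]
  rcases p with p | p <;> rcases q with q | q <;> rfl

/-- When the labels agree, the rectangular trace is an ordinary one over a single block, even if row
and column lie in different halves. -/
lemma stieltjes_apply_of_base_eq (X : Matrix (Fin N) (Fin N) ℂ) (z : ℂ) (t : ℝ)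
    {p q : Fin D ⊕ Fin D} (h : base p = base q) :
    stieltjes α X z (Complex.I * t) p q =
      (((α (base p) * N)⁻¹ : ℝ) : ℂ) * ∑ i ∈ block α N (base p),
        green (herm X z) t (tag p i) (tag q i) := by
  rw [stieltjes_apply, ← Finset.mul_sum]
  congr 1
  rw [← sum_blockElem (α := α) (N := N) (fun i => green (herm X z) t (tag p i) (tag q i)) (base p)
    (m := min (blockSize α N (base p)) (blockSize α N (base q))) (by rw [h, min_self])
    (min_le_left _ _)]
  refine Finset.sum_congr rfl fun k _ => ?_
  unfold rowIdx colIdx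
  congr 2
  have key : ∀ {c d : Fin D} (_ : c = d) {m : ℕ} (k : Fin m) (h1 : m ≤ blockSize α N d)
      (h2 : m ≤ blockSize α N c),
      blockElem α N d (k.castLE h1) = blockElem α N c (k.castLE h2) := by
    rintro c _ rfl m k h1 h2
    rfl
  exact key h k _ _

lemma norm_inv_mul_le {a : ℝ} (ha : 0 < a) (haα : ∀ c, a ≤ α c) (c : Fin D) :
    ‖(((α c * N)⁻¹ : ℝ) : ℂ)‖ ≤ (a * N)⁻¹ := by
  have hc : 0 < α c := ha.trans_le (haα c)
  rw [Complex.norm_real, Real.norm_of_nonneg (by positivity)]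
  rcases Nat.eq_zero_or_pos N with rfl | hN
  · simp
  · have hN' : (0 : ℝ) < N := by exact_mod_cast hN
    gcongr
    exact haα c

lemma blockSize_le (c : Fin D) : blockSize α N c ≤ N := by
  unfold blockSize
  simpa using Finset.card_le_univ (block α N c)

lemma norm_weighted_sum_le {a C : ℝ} (ha : 0 < a) (haα : ∀ c, a ≤ α c) (hC : 0 ≤ C)
    (p q : Fin D ⊕ Fin D)
    {f : Fin (min (blockSize α N (base p)) (blockSize α N (base q))) → ℂ} (hf : ∀ k, ‖f k‖ ≤ C) :
    ‖∑ k, (((α (base p) * N)⁻¹ : ℝ) : ℂ) * f k‖ ≤ a⁻¹ * C := by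
  have hm : ((min (blockSize α N (base p)) (blockSize α N (base q)) : ℕ) : ℝ) ≤ N := by
    exact_mod_cast (min_le_left _ _).trans (blockSize_le _)
  calc _ ≤ ∑ _k : Fin (min (blockSize α N (base p)) (blockSize α N (base q))),
        (a * N)⁻¹ * C := by
        refine norm_sum_le_of_le _ fun k _ => ?_
        rw [norm_mul]
        exact mul_le_mul (norm_inv_mul_le ha haα _) (hf k) (norm_nonneg _) (by positivity)
    _ ≤ N * ((a * N)⁻¹ * C) := by
        rw [Finset.sum_const, Finset.card_univ, Fintype.card_fin, nsmul_eq_mul]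
        exact mul_le_mul_of_nonneg_right hm (by positivity)
    _ ≤ _ := by
        rcases Nat.eq_zero_or_pos N with rfl | hN
        · simp; positivity
        · have hN' : (0 : ℝ) < N := by exact_mod_cast hN
          refine le_of_eq ?_
          field_simp

lemma norm_stieltjes_apply_le {a : ℝ} (ha : 0 < a) (haα : ∀ c, a ≤ α c)
    (X : Matrix (Fin N) (Fin N) ℂ) (z : ℂ) {t : ℝ} (ht : 0 < t) (p q : Fin D ⊕ Fin D) :
    ‖stieltjes α X z (Complex.I * t) p q‖ ≤ a⁻¹ * t⁻¹ := by
  rw [stieltjes_apply]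
  refine norm_weighted_sum_le ha haα (by positivity) p q fun k => (norm_entry_le _ _ _).trans ?_
  simpa [abs_of_pos ht] using norm_green_le (herm_isHermitian X z) ht.ne'

lemma norm_stieltjes_sub_le {a : ℝ} (ha : 0 < a) (haα : ∀ c, a ≤ α c)
    (X : Matrix (Fin N) (Fin N) ℂ) (z z' : ℂ) {t t' : ℝ} (ht : 0 < t) (ht' : 0 < t')
    (p q : Fin D ⊕ Fin D) :
    ‖stieltjes α X z (Complex.I * t) p q - stieltjes α X z' (Complex.I * t') p q‖ ≤
      a⁻¹ * (t⁻¹ * (‖z - z'‖ + |t - t'|) * t'⁻¹) := by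
  rw [stieltjes_apply, stieltjes_apply, ← Finset.sum_sub_distrib]
  simp only [← mul_sub]
  refine norm_weighted_sum_le ha haα (by positivity) p q fun k => ?_
  rw [← Matrix.sub_apply]
  refine (norm_entry_le _ _ _).trans ?_
  simpa [abs_of_pos ht, abs_of_pos ht'] using
    norm_green_herm_sub_le (X := X) (z := z) (z' := z') ht.ne' ht'.ne'

/-- Row `i` of `X` enters the Hermitization only in the row and the column of `Sum.inl i`, so
`norm_sum_green_sub_le` applies with a one-element set. -/
lemma norm_stieltjes_sub_row_le {a : ℝ} (ha : 0 < a) (haα : ∀ c, a ≤ α c)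
    {X X' : Matrix (Fin N) (Fin N) ℂ} {i : Fin N} (hX : ∀ j ≠ i, ∀ l, X j l = X' j l)
    (z : ℂ) {t : ℝ} (ht : 0 < t) (p q : Fin D ⊕ Fin D) :
    ‖stieltjes α X z (Complex.I * t) p q - stieltjes α X' z (Complex.I * t) p q‖ ≤
      4 / (a * N * t) := by
  rw [stieltjes_apply, stieltjes_apply, ← Finset.sum_sub_distrib]
  simp only [← mul_sub, ← Matrix.sub_apply]
  refine (norm_sum_green_sub_le (S := {Sum.inl i}) (herm_isHermitian X z) (herm_isHermitian X' z)
    ht.ne' ?_ (rowIdx_injective p q) (colIdx_injective p q) (β := (a * N)⁻¹) (by positivity)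
    fun _ => norm_inv_mul_le ha haα _).trans (le_of_eq ?_)
  · intro j l hj hl
    rcases j with j | j <;> rcases l with l | l <;> simp only [Finset.mem_singleton,
      Sum.inl.injEq] at hj hl
    · simp [herm]
    · simp [herm, hX j hj]
    · simp [herm, hX l hl]
    · simp [herm]
  · rw [abs_of_pos ht, Finset.card_singleton]
    have := ha.ne'
    have := ht.ne'
    rw [div_eq_mul_inv, mul_inv]
    push_cast
    ring

lemma stieltjes_neg (X : Matrix (Fin N) (Fin N) ℂ) (z : ℂ) {t : ℝ} (ht : t ≠ 0) :
    stieltjes α X z (Complex.I * (-t : ℝ)) =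
      Matrix.fromBlocks (-(stieltjes α X z (Complex.I * t)).toBlocks₁₁)
        (stieltjes α X z (Complex.I * t)).toBlocks₁₂
        (stieltjes α X z (Complex.I * t)).toBlocks₂₁
        (-(stieltjes α X z (Complex.I * t)).toBlocks₂₂) := by
  have hneg := green_herm_neg (X := X) (z := z) ht
  rw [← Matrix.fromBlocks_toBlocks (green (herm X z) t), Matrix.fromBlocks_multiply,
    Matrix.fromBlocks_multiply] at hneg
  ext p q
  rw [stieltjes_apply, hneg]
  rcases p with p | p <;> rcases q with q | q <;>
    simp [Matrix.toBlocks₁₁, Matrix.toBlocks₁₂, Matrix.toBlocks₂₁, Matrix.toBlocks₂₂,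
      stieltjes_apply, rowIdx, colIdx, tag]

lemma stieltjes_diag_im (X : Matrix (Fin N) (Fin N) ℂ) (z : ℂ) (t : ℝ) (p : Fin D ⊕ Fin D) :
    (stieltjes α X z (Complex.I * t) p p).im =
      (α (base p) * N)⁻¹ * ∑ i ∈ block α N (base p), (green (herm X z) t (tag p i) (tag p i)).im := by
  rw [stieltjes_apply_of_base_eq X z t rfl, Complex.im_ofReal_mul, Complex.im_sum]

lemma stieltjes_diag_im_nonneg (hα : ∀ c, 0 < α c) (X : Matrix (Fin N) (Fin N) ℂ) (z : ℂ) {t : ℝ}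
    (ht : 0 < t) (p : Fin D ⊕ Fin D) : 0 ≤ (stieltjes α X z (Complex.I * t) p p).im := by
  rw [stieltjes_diag_im]
  have := hα (base p)
  refine mul_nonneg (by positivity) (Finset.sum_nonneg fun i _ => ?_)
  rw [green_diag_im (herm_isHermitian X z) ht.ne']
  exact mul_nonneg ht.le (Finset.sum_nonneg fun _ _ => sq_nonneg _)

lemma sum_label {f : Fin D → ℝ} {h : Fin N → ℝ} :
    ∑ l : Fin N, f (label α hα hsum l) * h l = ∑ e, f e * ∑ l ∈ block α N e, h l := by
  simp only [block_eq_filter_label hα hsum, Finset.mul_sum, Finset.sum_filter]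
  rw [Finset.sum_comm]
  refine Finset.sum_congr rfl fun l _ => ?_
  simp

/-- The self-energies in the Schur complement formula depend on the index only through its
block. -/
lemma sum_profile_eq (hN : N ≠ 0) (X : Matrix (Fin N) (Fin N) ℂ) (z : ℂ) (t : ℝ) (k : Fin N) :
    (t + ∑ l, (N : ℝ)⁻¹ * profile α g hα hsum N k l ^ 2 *
        (green (herm X z) t (Sum.inr l) (Sum.inr l)).im =
      selfEnergy (covKernel α g) t (fun p => (stieltjes α X z (Complex.I * t) p p).im)
        (Sum.inl (label α hα hsum k))) ∧
    (t + ∑ l, (N : ℝ)⁻¹ * profile α g hα hsum N l k ^ 2 *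
        (green (herm X z) t (Sum.inl l) (Sum.inl l)).im =
      selfEnergy (covKernel α g) t (fun p => (stieltjes α X z (Complex.I * t) p p).im)
        (Sum.inr (label α hα hsum k))) := by
  have hN' : (N : ℝ) ≠ 0 := by exact_mod_cast hN
  constructor
  · rw [selfEnergy, Fintype.sum_sum_type]
    simp only [covKernel, zero_mul, Finset.sum_const_zero, zero_add, profile]
    rw [sum_label hα hsum (f := fun e => (N : ℝ)⁻¹ * g (label α hα hsum k) e ^ 2)
      (h := fun l => (green (herm X z) t (Sum.inr l) (Sum.inr l)).im)]
    congr 1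
    refine Finset.sum_congr rfl fun e _ => ?_
    rw [stieltjes_diag_im]
    have := (hα e).ne'
    simp only [base, Sum.elim_inr, id, tag]
    field_simp
  · rw [selfEnergy, Fintype.sum_sum_type]
    simp only [covKernel, zero_mul, Finset.sum_const_zero, add_zero, profile]
    rw [sum_label hα hsum (f := fun e => (N : ℝ)⁻¹ * g e (label α hα hsum k) ^ 2)
      (h := fun l => (green (herm X z) t (Sum.inl l) (Sum.inl l)).im)]
    congr 1
    refine Finset.sum_congr rfl fun e _ => ?_
    rw [stieltjes_diag_im]
    have := (hα e).ne'
    simp only [base, Sum.elim_inl, id, tag]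
    field_simp

/-- Different blocks are disjoint, so row and column of such an entry never come from the same
original index, and `IsNoise.lintegral_offdiag_le` applies to it. -/
lemma rowIdx_mem_colIdx_notMem (hα : ∀ c, 0 < α c) (hsum : ∑ c, α c = 1)
    {p q : Fin D ⊕ Fin D} (hpq : base p ≠ base q)
    (k : Fin (min (blockSize α N (base p)) (blockSize α N (base q)))) :
    ∃ u : Fin N, rowIdx α N p q k ∈ ({Sum.inl u, Sum.inr u} : Finset (Fin N ⊕ Fin N)) ∧
      colIdx α N p q k ∉ ({Sum.inl u, Sum.inr u} : Finset (Fin N ⊕ Fin N)) := by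
  set u := blockElem α N (base p) (k.castLE (min_le_left _ _)) with hu
  set u' := blockElem α N (base q) (k.castLE (min_le_right _ _)) with hu'
  have h1 : u ∈ block α N (base p) := Finset.orderEmbOfFin_mem _ _ _
  have h2 : u' ∈ block α N (base q) := Finset.orderEmbOfFin_mem _ _ _
  have hne : u' ≠ u := fun e => by
    rw [e, mem_block_iff_label_eq hα hsum] at h2
    rw [mem_block_iff_label_eq hα hsum] at h1
    exact hpq (h1.symm.trans h2)
  refine ⟨u, ?_, ?_⟩
  · rcases p with p | p <;> simp [rowIdx, tag, hu]
  · rcases q with q | q <;> simp [colIdx, tag, ← hu', hne]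

end Blocks

/-! ### The Dyson matrix -/

section DysonMatrix

variable {D : ℕ} {α : Fin D → ℝ} {g : Fin D → Fin D → ℝ} {z : ℂ} {t κ : ℝ}

/-- The right hand side of the Dyson equation, in terms of the diagonal entries `√-1 x`. -/
def dysonMatrix (α : Fin D → ℝ) (g : Fin D → Fin D → ℝ) (z : ℂ) (t : ℝ)
    (x : Fin D ⊕ Fin D → ℝ) : Matrix (Fin D ⊕ Fin D) (Fin D ⊕ Fin D) ℂ :=
  let S := selfEnergy (covKernel α g) t x
  let F := dysonMap (covKernel α g) Sum.swap (‖z‖ ^ 2) t x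
  let w : Fin D → ℂ := fun c => ((S (Sum.inl c) * S (Sum.inr c) + ‖z‖ ^ 2 : ℝ) : ℂ)
  Matrix.fromBlocks
    (Matrix.diagonal fun c => Complex.I * (F (Sum.inl c) : ℝ))
    (Matrix.diagonal fun c => -(z * (w c)⁻¹))
    (Matrix.diagonal fun c => -(star z * (w c)⁻¹))
    (Matrix.diagonal fun c => Complex.I * (F (Sum.inr c) : ℝ))

lemma limitMatrix_eq_dysonMatrix {x : Fin D ⊕ Fin D → ℝ}
    (hfix : dysonMap (covKernel α g) Sum.swap (‖z‖ ^ 2) t x = x) :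
    limitMatrix α g z 1 t x = dysonMatrix α g z t x := by
  unfold limitMatrix dysonMatrix
  rw [hfix]
  simp only [one_mul]

lemma dysonMatrix_apply_of_base_ne {x : Fin D ⊕ Fin D → ℝ} {p q : Fin D ⊕ Fin D}
    (h : base p ≠ base q) : dysonMatrix α g z t x p q = 0 := by
  rcases p with p | p <;> rcases q with q | q <;> simp [base] at h <;> simp [dysonMatrix, h]

lemma dysonMatrix_diag (x : Fin D ⊕ Fin D → ℝ) (p : Fin D ⊕ Fin D) :
    dysonMatrix α g z t x p p =
      Complex.I * (dysonMap (covKernel α g) Sum.swap (‖z‖ ^ 2) t x p : ℝ) := by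
  rcases p with p | p <;> simp [dysonMatrix]

lemma abs_selfEnergy_sub_le (hα : ∀ c, 0 < α c) (hκ : ∀ i, ∑ j, covKernel α g i j ≤ κ)
    (x y : Fin D ⊕ Fin D → ℝ) (i : Fin D ⊕ Fin D) :
    |selfEnergy (covKernel α g) t x i - selfEnergy (covKernel α g) t y i| ≤
      κ * ∑ j, |x j - y j| := by
  have e : selfEnergy (covKernel α g) t x i - selfEnergy (covKernel α g) t y i =
      ∑ j, covKernel α g i j * (x j - y j) := by
    simp only [selfEnergy, mul_sub, Finset.sum_sub_distrib]; ring
  rw [e, Finset.mul_sum]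
  refine (Finset.abs_sum_le_sum_abs _ _).trans (Finset.sum_le_sum fun j _ => ?_)
  rw [abs_mul, abs_of_nonneg (covKernel_nonneg hα i j)]
  refine mul_le_mul_of_nonneg_right ?_ (abs_nonneg _)
  exact (Finset.single_le_sum (fun j _ => covKernel_nonneg hα i j) (Finset.mem_univ j)).trans (hκ i)

lemma norm_dysonMatrix_sub_le (hα : ∀ c, 0 < α c) (hκ : ∀ i, ∑ j, covKernel α g i j ≤ κ)
    (ht : 0 < t) {x y : Fin D ⊕ Fin D → ℝ} (hx : ∀ i, 0 ≤ x i) (hy : ∀ i, 0 ≤ y i)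
    (p q : Fin D ⊕ Fin D) :
    ‖dysonMatrix α g z t x p q - dysonMatrix α g z t y p q‖ ≤
      2 * κ / t ^ 2 * ∑ j, |x j - y j| := by
  have hS := abs_selfEnergy_sub_le (t := t) hα hκ x y
  have hx' := le_selfEnergy (t := t) (covKernel_nonneg (g := g) hα) hx
  have hy' := le_selfEnergy (t := t) (covKernel_nonneg (g := g) hα) hy
  set d := ∑ j, |x j - y j| with hd
  have hd0 : 0 ≤ κ * d := (abs_nonneg _).trans (hS p)
  have e : 2 * κ / t ^ 2 * d = (κ * d + κ * d) / t ^ 2 := by ring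
  rw [e]
  have hfin : ∀ i j, (|selfEnergy (covKernel α g) t x i - selfEnergy (covKernel α g) t y i| +
      |selfEnergy (covKernel α g) t x j - selfEnergy (covKernel α g) t y j|) / t ^ 2 ≤
      (κ * d + κ * d) / t ^ 2 := fun i j => by gcongr <;> exact hS _
  by_cases h : base p = base q
  swap
  · rw [dysonMatrix_apply_of_base_ne h, dysonMatrix_apply_of_base_ne h, sub_zero, norm_zero]
    positivity
  have hoff : ∀ (c : Fin D) (ζ : ℂ), ‖ζ‖ = ‖z‖ →
      ‖-(ζ * (((selfEnergy (covKernel α g) t x (Sum.inl c) *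
        selfEnergy (covKernel α g) t x (Sum.inr c) + ‖z‖ ^ 2 : ℝ) : ℂ))⁻¹) -
        -(ζ * (((selfEnergy (covKernel α g) t y (Sum.inl c) *
        selfEnergy (covKernel α g) t y (Sum.inr c) + ‖z‖ ^ 2 : ℝ) : ℂ))⁻¹)‖ ≤
      (κ * d + κ * d) / t ^ 2 := fun c ζ hζ => by
    rw [neg_sub_neg, ← mul_sub, norm_mul, hζ, ← Complex.ofReal_inv, ← Complex.ofReal_inv,
      ← Complex.ofReal_sub, Complex.norm_real, Real.norm_eq_abs, abs_sub_comm]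
    exact (abs_inv_mul_add_sub_le (norm_nonneg z) ht (hx' _) (hx' _) (hy' _) (hy' _)).trans
      (hfin _ _)
  have hon : ∀ p, ‖dysonMatrix α g z t x p p - dysonMatrix α g z t y p p‖ ≤
      (κ * d + κ * d) / t ^ 2 := fun p => by
    rw [dysonMatrix_diag, dysonMatrix_diag, ← mul_sub, norm_mul, Complex.norm_I, one_mul,
      ← Complex.ofReal_sub, Complex.norm_real, Real.norm_eq_abs]
    exact (abs_inv_add_div_sub_le (sq_nonneg _) ht (hx' _) (hx' _) (hy' _) (hy' _)).trans
      (hfin _ _)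
  rcases p with c | c <;> rcases q with c' | c' <;> simp only [base, Sum.elim_inl, Sum.elim_inr,
    id] at h <;> subst h
  · exact hon _
  · simpa only [dysonMatrix, Matrix.fromBlocks_apply₁₂, Matrix.diagonal_apply_eq] using
      hoff c z rfl
  · simpa only [dysonMatrix, Matrix.fromBlocks_apply₂₁, Matrix.diagonal_apply_eq] using
      hoff c (star z) (norm_star z)
  · exact hon _

lemma norm_dysonMatrix_le (hα : ∀ c, 0 < α c) (ht : 0 < t) {x : Fin D ⊕ Fin D → ℝ}
    (hx : ∀ i, 0 ≤ x i) (p q : Fin D ⊕ Fin D) : ‖dysonMatrix α g z t x p q‖ ≤ t⁻¹ := by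
  have hΓ := covKernel_nonneg (g := g) hα
  have hx' := le_selfEnergy (t := t) hΓ hx
  by_cases h : base p = base q
  swap
  · rw [dysonMatrix_apply_of_base_ne h, norm_zero]
    positivity
  have hoff : ∀ (c : Fin D) (ζ : ℂ), ‖ζ‖ = ‖z‖ →
      ‖-(ζ * (((selfEnergy (covKernel α g) t x (Sum.inl c) *
        selfEnergy (covKernel α g) t x (Sum.inr c) + ‖z‖ ^ 2 : ℝ) : ℂ))⁻¹)‖ ≤ t⁻¹ := fun c ζ hζ => by
    have h1 := mul_le_mul (hx' (Sum.inl c)) (hx' (Sum.inr c)) ht.le (ht.le.trans (hx' _))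
    set S := selfEnergy (covKernel α g) t x (Sum.inl c) *
      selfEnergy (covKernel α g) t x (Sum.inr c)
    have hpos : 0 < S + ‖z‖ ^ 2 := by
      have := mul_pos ht ht
      have := sq_nonneg ‖z‖
      linarith
    rw [norm_neg, norm_mul, hζ, norm_inv, Complex.norm_real, Real.norm_of_nonneg hpos.le,
      ← div_eq_mul_inv, div_le_iff₀ hpos, inv_mul_eq_div, le_div_iff₀ ht]
    nlinarith [sq_nonneg (‖z‖ - t)]
  have hon : ∀ p, ‖dysonMatrix α g z t x p p‖ ≤ t⁻¹ := fun p => by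
    rw [dysonMatrix_diag, norm_mul, Complex.norm_I, one_mul, Complex.norm_real,
      Real.norm_of_nonneg (dysonMap_pos hΓ (sq_nonneg _) ht hx p).le]
    exact dysonMap_le hΓ (sq_nonneg _) ht hx p
  rcases p with c | c <;> rcases q with c' | c' <;> simp only [base, Sum.elim_inl, Sum.elim_inr,
    id] at h <;> subst h
  · exact hon _
  · simpa only [dysonMatrix, Matrix.fromBlocks_apply₁₂, Matrix.diagonal_apply_eq] using
      hoff c z rfl
  · simpa only [dysonMatrix, Matrix.fromBlocks_apply₂₁, Matrix.diagonal_apply_eq] using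
      hoff c (star z) (norm_star z)
  · exact hon _

/-- Quantitative stability of the fixed point of the Dyson map. -/
lemma abs_sub_fixedPoint_le (hα : ∀ c, 0 < α c) (hκ0 : 0 ≤ κ)
    (hκ : ∀ i, ∑ j, covKernel α g i j ≤ κ) (ht : 0 < t) {a G e : ℝ} (ha : 0 < a) (ha1 : a ≤ 1)
    (hG : t ^ 2 + κ / a + ‖z‖ ^ 2 ≤ G) {x y : Fin D ⊕ Fin D → ℝ} (hx : ∀ i, 0 ≤ x i)
    (hxL : ∀ i, x i ≤ a⁻¹ * t⁻¹) (hy : ∀ i, 0 ≤ y i)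
    (hfix : dysonMap (covKernel α g) Sum.swap (‖z‖ ^ 2) t y = y) (he0 : 0 ≤ e)
    (he : ∀ i, |x i - dysonMap (covKernel α g) Sum.swap (‖z‖ ^ 2) t x i| ≤ e)
    (hsmall : 4 * G ^ 2 * e ≤ t ^ 3) (i : Fin D ⊕ Fin D) :
    |x i - y i| ≤ 4 * G ^ 2 / (a * t ^ 4) * e := by
  have hΓ := covKernel_nonneg (g := g) hα
  have hL : 0 ≤ a⁻¹ * t⁻¹ := by positivity
  have hka : 0 ≤ κ / a := by positivity
  have hG0 : 0 < G := lt_of_lt_of_le (by positivity) hG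
  have hyL : ∀ i, y i ≤ a⁻¹ * t⁻¹ := fun i => by
    rw [← hfix]
    refine (dysonMap_le hΓ (sq_nonneg _) ht hy i).trans ?_
    exact le_mul_of_one_le_left (by positivity) ((one_le_inv₀ ha).2 ha1)
  have hSle : t + κ * (a⁻¹ * t⁻¹) + ‖z‖ ^ 2 / t ≤ G / t := by
    rw [le_div_iff₀ ht]
    refine le_trans (le_of_eq ?_) hG
    field_simp
  have hδS : ∀ {u : Fin D ⊕ Fin D → ℝ} (_ : ∀ i, u i ≤ a⁻¹ * t⁻¹) i,
      t ^ 2 / G * selfEnergy (covKernel α g) t u i ≤ t := fun hu i => by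
    have h1 := selfEnergy_le (t := t) hΓ hκ hL hu i
    have h2 : (0 : ℝ) ≤ ‖z‖ ^ 2 / t := by positivity
    calc _ ≤ t ^ 2 / G * (G / t) := by gcongr; linarith
      _ = t := by field_simp
  -- The self-energies are at most `G / t`, so `t` is the fraction `δ = t² / G` of them; the Dyson
  -- map is at least `t / G`, so the absolute error `e` is a relative error `η = e G / t`. The
  -- condition `η ≤ δ / 4` is `hsmall`.
  have h := dysonMap_stability hΓ (sq_nonneg ‖z‖) ht (δ := t ^ 2 / G) (η := e * G / t)
    (L := a⁻¹ * t⁻¹) (by positivity) (by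
      rw [div_le_one hG0]; nlinarith [sq_nonneg ‖z‖]) hx hy hxL hyL (hδS hxL) (hδS hyL) hfix
    (by
      rw [div_div, div_le_div_iff₀ ht (by positivity)]
      nlinarith) (fun i => by
      refine (he i).trans ?_
      have h1 := le_dysonMap (σ := Sum.swap) hΓ hκ (sq_nonneg ‖z‖) ht hL hx hxL i
      have h2 : t / G ≤ (t + κ * (a⁻¹ * t⁻¹) + ‖z‖ ^ 2 / t)⁻¹ := by
        rw [← inv_div]
        exact inv_anti₀ (by positivity) hSle
      calc e = e * G / t * (t / G) := by field_simp
        _ ≤ _ := by gcongr; exact h2.trans h1) i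
  refine h.trans (le_of_eq ?_)
  field_simp

end DysonMatrix

/-! ### Concentration and expectation of the Stieltjes transform -/

section Expectation

open scoped Matrix Matrix.Norms.L2Operator

variable {D : ℕ} {α : Fin D → ℝ} {g : Fin D → Fin D → ℝ} {N : ℕ}
  (hα : ∀ c, 0 < α c) (hsum : ∑ c, α c = 1)
  {Ω : Type*} [MeasurableSpace Ω] {P : Measure Ω} [IsProbabilityMeasure P]
  {J : Fin N → Fin N → Ω → ℂ} {v w : ℝ}

/-- The Stieltjes transform of the random block matrix at `η = √-1 t`. -/
def randomStieltjes (α : Fin D → ℝ) (g : Fin D → Fin D → ℝ) (J : Fin N → Fin N → Ω → ℂ) (z : ℂ)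
    (t : ℝ) (ω : Ω) : Matrix (Fin D ⊕ Fin D) (Fin D ⊕ Fin D) ℂ :=
  stieltjes α (blockMatrix α g fun i j => J i j ω) z (Complex.I * t)

lemma measurable_stieltjes_blockMatrix (hα : ∀ c, 0 < α c) (hsum : ∑ c, α c = 1) (z : ℂ) (t : ℝ)
    (p q : Fin D ⊕ Fin D) :
    Measurable fun A : Fin N → Fin N → ℂ => stieltjes α (blockMatrix α g A) z (Complex.I * t) p q := by
  simp only [stieltjes_apply, blockMatrix_eq_profileMatrix hα hsum]
  refine Finset.measurable_sum _ fun k _ => Measurable.const_mul ?_ _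
  refine measurable_green (measurable_herm (fun i j => ?_) z) t _ _
  have h : Measurable fun A : Fin N → Fin N → ℂ => A i j := by fun_prop
  exact h.const_mul _

lemma measurable_randomStieltjes (hα : ∀ c, 0 < α c) (hsum : ∑ c, α c = 1)
    (hJ : ∀ i j, Measurable (J i j)) (z : ℂ) (t : ℝ) (p q : Fin D ⊕ Fin D) :
    Measurable fun ω => randomStieltjes α g J z t ω p q :=
  (measurable_stieltjes_blockMatrix hα hsum z t p q).comp
    (measurable_pi_lambda _ fun i => measurable_pi_lambda _ fun j => hJ i j)

lemma integrable_randomStieltjes (hα : ∀ c, 0 < α c) (hsum : ∑ c, α c = 1)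
    (hJ : ∀ i j, Measurable (J i j)) (z : ℂ) {t : ℝ} (ht : 0 < t) {a : ℝ} (ha : 0 < a)
    (haα : ∀ c, a ≤ α c) (p q : Fin D ⊕ Fin D) :
    Integrable (fun ω => randomStieltjes α g J z t ω p q) P :=
  Integrable.of_bound (measurable_randomStieltjes hα hsum hJ z t p q).aestronglyMeasurable
    (a⁻¹ * t⁻¹) (ae_of_all _ fun _ => norm_stieltjes_apply_le ha haα _ z ht p q)

/-- `f` stands for the real or the imaginary part; the bounded differences over the rows come from
`norm_stieltjes_sub_row_le`. -/
lemma hasSubgaussianMGF_randomStieltjes (hα : ∀ c, 0 < α c) (hsum : ∑ c, α c = 1)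
    (hJ : ∀ i j, Measurable (J i j)) (hind : iIndepFun (fun p : Fin N × Fin N => J p.1 p.2) P)
    (z : ℂ) {t a : ℝ} (ht : 0 < t) (ha : 0 < a) (haα : ∀ c, a ≤ α c) {f : ℂ → ℝ}
    (hf : LipschitzWith 1 f) (hf0 : f 0 = 0) (p q : Fin D ⊕ Fin D) :
    HasSubgaussianMGF (fun ω => f (randomStieltjes α g J z t ω p q) -
      ∫ ω, f (randomStieltjes α g J z t ω p q) ∂P) (N * (4 / (a * N * t)).toNNReal ^ 2) P := by
  have hfn : ∀ u v, |f u - f v| ≤ ‖u - v‖ := fun u v => by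
    simpa [Real.dist_eq, dist_eq_norm] using hf.dist_le_mul u v
  refine hasSubgaussianMGF_of_rows (f := fun A => f (stieltjes α (blockMatrix α g A) z
    (Complex.I * t) p q)) (B := a⁻¹ * t⁻¹) hJ hind
    (hf.continuous.measurable.comp (measurable_stieltjes_blockMatrix hα hsum z t p q)) ?_ ?_
  · intro A
    have := hfn (stieltjes α (blockMatrix α g A) z (Complex.I * t) p q) 0
    rw [hf0, sub_zero, sub_zero] at this
    exact this.trans (norm_stieltjes_apply_le ha haα _ z ht p q)
  · intro A i y
    rw [Real.coe_toNNReal _ (by positivity)]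
    refine (hfn _ _).trans (norm_stieltjes_sub_row_le ha haα (i := i) (fun j hj l => ?_) z ht p q)
    simp [blockMatrix_eq_profileMatrix hα hsum, profileMatrix, hj]

lemma subgaussian_parameter (hN : N ≠ 0) {t a : ℝ} (ht : 0 < t) (ha : 0 < a) :
    (((N : NNReal) * (4 / (a * N * t)).toNNReal ^ 2 : NNReal) : ℝ) =
      16 / (a ^ 2 * N * t ^ 2) := by
  have hN' : (0 : ℝ) < N := by exact_mod_cast Nat.pos_of_ne_zero hN
  rw [NNReal.coe_mul, NNReal.coe_pow, Real.coe_toNNReal _ (by positivity), NNReal.coe_natCast]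
  field_simp
  norm_num

lemma integral_abs_randomStieltjes_sub_le (hα : ∀ c, 0 < α c) (hsum : ∑ c, α c = 1)
    (hJ : ∀ i j, Measurable (J i j)) (hind : iIndepFun (fun p : Fin N × Fin N => J p.1 p.2) P)
    (hN : N ≠ 0) (z : ℂ) {t a : ℝ} (ht : 0 < t) (ha : 0 < a) (haα : ∀ c, a ≤ α c) {f : ℂ → ℝ}
    (hf : LipschitzWith 1 f) (hf0 : f 0 = 0) (p q : Fin D ⊕ Fin D) :
    ∫ ω, |f (randomStieltjes α g J z t ω p q) -
      ∫ ω, f (randomStieltjes α g J z t ω p q) ∂P| ∂P ≤ 16 / (a * t * √N) := by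
  have hN' : (0 : ℝ) < N := by exact_mod_cast Nat.pos_of_ne_zero hN
  have h := integral_abs_le_of_hasSubgaussianMGF
    (hasSubgaussianMGF_randomStieltjes (g := g) hα hsum hJ hind z ht ha haα hf hf0 p q)
    (σ := 4 / (a * t * √N)) (by positivity) (by
      rw [subgaussian_parameter hN ht ha, div_pow, mul_pow, mul_pow, Real.sq_sqrt hN'.le]
      refine le_of_eq ?_
      field_simp
      norm_num)
  refine h.trans (le_of_eq ?_)
  ring

lemma measure_abs_randomStieltjes_sub_ge_le (hα : ∀ c, 0 < α c) (hsum : ∑ c, α c = 1)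
    (hJ : ∀ i j, Measurable (J i j)) (hind : iIndepFun (fun p : Fin N × Fin N => J p.1 p.2) P)
    (hN : N ≠ 0) (z : ℂ) {t a : ℝ} (ht : 0 < t) (ha : 0 < a) (haα : ∀ c, a ≤ α c) {f : ℂ → ℝ}
    (hf : LipschitzWith 1 f) (hf0 : f 0 = 0) (p q : Fin D ⊕ Fin D) {ε : ℝ} (hε : 0 ≤ ε) :
    P.real {ω | ε ≤ |f (randomStieltjes α g J z t ω p q) -
      ∫ ω, f (randomStieltjes α g J z t ω p q) ∂P|} ≤
      2 * Real.exp (-(ε ^ 2 * (a ^ 2 * N * t ^ 2) / 32)) := by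
  have hN' : (0 : ℝ) < N := by exact_mod_cast Nat.pos_of_ne_zero hN
  have h := hasSubgaussianMGF_randomStieltjes (g := g) hα hsum hJ hind z ht ha haα hf hf0 p q
  have h1 := h.measure_ge_le hε
  have h2 := h.neg.measure_ge_le hε
  rw [subgaussian_parameter hN ht ha] at h1 h2
  have e : -ε ^ 2 / (2 * (16 / (a ^ 2 * N * t ^ 2))) = -(ε ^ 2 * (a ^ 2 * N * t ^ 2) / 32) := by
    field_simp
    ring
  rw [e] at h1 h2
  set Y : Ω → ℝ := fun ω => f (randomStieltjes α g J z t ω p q) -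
      ∫ ω, f (randomStieltjes α g J z t ω p q) ∂P with hY
  have hsub : {ω | ε ≤ |Y ω|} ⊆ {ω | ε ≤ Y ω} ∪ {ω | ε ≤ (-Y) ω} := fun ω hω => by
    simpa [le_abs] using hω
  calc P.real {ω | ε ≤ |Y ω|} ≤ P.real ({ω | ε ≤ Y ω} ∪ {ω | ε ≤ (-Y) ω}) := measureReal_mono hsub
    _ ≤ _ := (measureReal_union_le _ _).trans (by rw [two_mul]; exact add_le_add h1 h2)

/-- Each entry of the resolvent in the block `(p, q)` is close to the entry of the Dyson matrix. -/
lemma norm_green_sub_dysonMatrix_le (hN : N ≠ 0) {b : ℝ} (hb : ∀ c d, |g c d| ≤ b) (z : ℂ)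
    {t : ℝ} (ht : 0 < t) (A : Fin N → Fin N → ℂ) (k : Fin N) {p q : Fin D ⊕ Fin D}
    (hp : base p = label α hα hsum k) (hq : base q = label α hα hsum k) :
    ‖green (herm (blockMatrix α g A) z) t (tag p k) (tag q k) -
      dysonMatrix α g z t (fun p => (stieltjes α (blockMatrix α g A) z (Complex.I * t) p p).im) p q‖
    ≤ (cavityError (blockMatrix α g A) (fun i j => (N : ℝ)⁻¹ * profile α g hα hsum N i j ^ 2) z t k
        + 18 * ((N : ℝ)⁻¹ * b ^ 2) / t) / t ^ 2 := by
  have hN' : (0 : ℝ) < N := by exact_mod_cast Nat.pos_of_ne_zero hN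
  have h := norm_green_sub_le_cavityError (X := blockMatrix α g A) (z := z) ht k
    (s := fun i j => (N : ℝ)⁻¹ * profile α g hα hsum N i j ^ 2) (β := (N : ℝ)⁻¹ * b ^ 2)
    (fun i j => by positivity) (fun i j => by
      refine mul_le_mul_of_nonneg_left ?_ (by positivity)
      rw [← sq_abs]
      exact pow_le_pow_left₀ (abs_nonneg _) (hb _ _) 2)
  have hx : ∀ p, 0 ≤ (stieltjes α (blockMatrix α g A) z (Complex.I * t) p p).im :=
    stieltjes_diag_im_nonneg hα _ z ht
  have hS : ∀ i, 0 < selfEnergy (covKernel α g) t (fun p =>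
      (stieltjes α (blockMatrix α g A) z (Complex.I * t) p p).im) i := fun i =>
    ht.trans_le (le_selfEnergy (covKernel_nonneg hα) hx i)
  obtain ⟨ea, eb⟩ := sum_profile_eq (g := g) hα hsum hN (blockMatrix α g A) z t k
  simp only [ea, eb] at h
  have hF : ∀ (p : Fin D ⊕ Fin D), (dysonMap (covKernel α g) Sum.swap (‖z‖ ^ 2) t (fun p =>
      (stieltjes α (blockMatrix α g A) z (Complex.I * t) p p).im) p) = _ := fun p =>
    dysonMap_swap hS p
  rcases p with c | c <;> rcases q with c' | c' <;> simp only [base, Sum.elim_inl, Sum.elim_inr,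
    id] at hp hq <;> subst hp <;> subst hq
  · rw [dysonMatrix_diag, hF]
    simpa [tag, mul_assoc] using h.1
  · simpa [tag, dysonMatrix] using h.2.2.1
  · simpa [tag, dysonMatrix] using h.2.2.2
  · rw [dysonMatrix_diag, hF]
    simpa [tag, mul_assoc, mul_comm] using h.2.1

end Expectation

/-! ### The approximate Dyson equation for the expectation -/

section MeanEquation

open scoped Matrix Matrix.Norms.L2Operator

variable {D : ℕ} {α : Fin D → ℝ} {g : Fin D → Fin D → ℝ} {N : ℕ}
  {Ω : Type*} [MeasurableSpace Ω] {P : Measure Ω} [IsProbabilityMeasure P]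
  {J : Fin N → Fin N → Ω → ℂ} {v w : ℝ}

lemma norm_integral_le_of_lintegral {f : Ω → ℂ} {C : ℝ} (hC : 0 ≤ C)
    (h : ∫⁻ ω, ‖f ω‖ₑ ∂P ≤ ENNReal.ofReal C) : ‖∫ ω, f ω ∂P‖ ≤ C := by
  have h1 := (enorm_integral_le_lintegral_enorm (μ := P) f).trans h
  rwa [← ofReal_norm, ENNReal.ofReal_le_ofReal_iff hC] at h1

/-- The expected imaginary parts of the diagonal entries. -/
def meanDiag (P : Measure Ω) (α : Fin D → ℝ) (g : Fin D → Fin D → ℝ) (J : Fin N → Fin N → Ω → ℂ)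
    (z : ℂ) (t : ℝ) (p : Fin D ⊕ Fin D) : ℝ :=
  ∫ ω, (randomStieltjes α g J z t ω p p).im ∂P

lemma abs_weight_mul_card_sub_one_le (hα : ∀ c, 0 < α c) (hsum : ∑ c, α c = 1) (hN : N ≠ 0) {a : ℝ}
    (ha : 0 < a) (haα : ∀ c, a ≤ α c) (c : Fin D) :
    |(α c * N)⁻¹ * (block α N c).card - 1| ≤ a⁻¹ * (N : ℝ)⁻¹ := by
  have hN' : (0 : ℝ) < N := by exact_mod_cast Nat.pos_of_ne_zero hN
  have h := abs_blockSize_sub_le hα hsum N c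
  have hc := hα c
  have e : (α c * N)⁻¹ * (block α N c).card - 1 = (α c * N)⁻¹ * ((blockSize α N c : ℝ) - N * α c) := by
    rw [mul_sub, mul_comm (N : ℝ), inv_mul_cancel₀ (by positivity)]
    rfl
  rw [e, abs_mul, abs_of_pos (by positivity)]
  calc _ ≤ (α c * N)⁻¹ * 1 := by gcongr
    _ ≤ (a * N)⁻¹ := by
        rw [mul_one]
        gcongr
        exact haα c
    _ = _ := by rw [mul_inv]

/-- Four errors are collected: the mean cavity error, the replacement of the random diagonal inside
the Dyson matrix by its mean (Lipschitz bound and concentration), the rounding of the block sizes,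
and the mean of the entries in blocks with different labels, where the Dyson matrix is zero. -/
theorem norm_integral_randomStieltjes_sub_le (hα : ∀ c, 0 < α c) (hsum : ∑ c, α c = 1)
    (hJ : IsNoise P (fun p : Fin N × Fin N => J p.1 p.2) (N : ℝ)⁻¹ w) (hN : N ≠ 0) (z : ℂ)
    {t a b κ τ : ℝ} (ht : 0 < t) (ha : 0 < a) (haα : ∀ c, a ≤ α c) (hb : ∀ c d, |g c d| ≤ b)
    (hκ0 : 0 ≤ κ) (hκ : ∀ i, ∑ j, covKernel α g i j ≤ κ) (hτ : 0 < τ)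
    (hw : w * (N * b ^ 4 * (t⁻¹) ^ 2) ≤ τ ^ 2) (hv : (N : ℝ)⁻¹ * b ^ 2 ≤ τ ^ 2)
    (hv' : (N : ℝ)⁻¹ * (b ^ 2 * (t⁻¹) ^ 2) ≤ τ ^ 2) (p q : Fin D ⊕ Fin D) :
    ‖∫ ω, randomStieltjes α g J z t ω p q ∂P -
      dysonMatrix α g z t (meanDiag P α g J z t) p q‖ ≤
      a⁻¹ * ((10 * τ + 18 * ((N : ℝ)⁻¹ * b ^ 2) / t) / t ^ 2 +
        2 * κ / t ^ 2 * (2 * D * (16 / (a * t * √N)))) + a⁻¹ * (N : ℝ)⁻¹ * t⁻¹ +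
        a⁻¹ * (2 * τ / t) := by
  have hN' : (0 : ℝ) < N := by exact_mod_cast Nat.pos_of_ne_zero hN
  have hJm : ∀ i j, Measurable (J i j) := fun i j => hJ.meas (i, j)
  set γ := profile α g hα hsum N with hγ
  have hγb : ∀ i j, |γ i j| ≤ b := fun i j => hb _ _
  have hX : ∀ ω, (blockMatrix α g fun i j => J i j ω) = profileMatrix γ fun p => J p.1 p.2 ω :=
    fun ω => blockMatrix_eq_profileMatrix hα hsum _
  have mR : ∀ i j, Measurable fun ω =>
      green (herm (blockMatrix α g fun i j => J i j ω) z) t i j := fun i j => by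
    simp only [hX]
    exact (measurable_green_herm_profileMatrix γ z t i j).comp (measurable_pi_lambda _ hJ.meas)
  have bR : ∀ i j ω, ‖green (herm (blockMatrix α g fun i j => J i j ω) z) t i j‖ ≤ t⁻¹ :=
    fun i j ω => (norm_entry_le _ _ _).trans (by
      simpa [abs_of_pos ht] using norm_green_le (herm_isHermitian _ z) ht.ne')
  have iR : ∀ i j, Integrable (fun ω =>
      green (herm (blockMatrix α g fun i j => J i j ω) z) t i j) P := fun i j =>
    Integrable.of_bound (mR i j).aestronglyMeasurable t⁻¹ (ae_of_all _ (bR i j))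
  by_cases hpq : base p = base q
  swap
  · rw [dysonMatrix_apply_of_base_ne hpq, sub_zero]
    have e : ∫ ω, randomStieltjes α g J z t ω p q ∂P =
        ∑ k, (((α (base p) * N)⁻¹ : ℝ) : ℂ) * ∫ ω,
          green (herm (blockMatrix α g fun i j => J i j ω) z) t (rowIdx α N p q k)
            (colIdx α N p q k) ∂P := by
      simp only [randomStieltjes, stieltjes_apply]
      rw [integral_finsetSum _ fun k _ => (iR _ _).const_mul _]
      simp only [integral_const_mul]
    rw [e]
    have h1 := norm_weighted_sum_le (N := N) ha haα (C := 2 * τ / t) (by positivity) p q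
      (f := fun k => ∫ ω, green (herm (blockMatrix α g fun i j => J i j ω) z) t
        (rowIdx α N p q k) (colIdx α N p q k) ∂P) (fun k => by
        obtain ⟨u, hu, hu'⟩ := rowIdx_mem_colIdx_notMem hα hsum hpq k
        refine norm_integral_le_of_lintegral (by positivity) ?_
        simp only [hX]
        exact hJ.lintegral_offdiag_le u ht hγb hτ hv' hu hu')
    refine h1.trans ?_
    have : 0 ≤ a⁻¹ * ((10 * τ + 18 * ((N : ℝ)⁻¹ * b ^ 2) / t) / t ^ 2 +
        2 * κ / t ^ 2 * (2 * D * (16 / (a * t * √N)))) + a⁻¹ * (N : ℝ)⁻¹ * t⁻¹ := by positivity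
    linarith
  set c := base p with hc
  set m := meanDiag P α g J z t with hm
  set x : Ω → Fin D ⊕ Fin D → ℝ := fun ω p => (randomStieltjes α g J z t ω p p).im with hx
  have hx0 : ∀ ω p, 0 ≤ x ω p := fun ω p => stieltjes_diag_im_nonneg hα _ z ht p
  have hm0 : ∀ p, 0 ≤ m p := fun p => integral_nonneg fun ω => hx0 ω p
  have ix : ∀ p, Integrable (fun ω => x ω p) P := fun p =>
    (integrable_randomStieltjes hα hsum hJm z ht ha haα p p).im
  have dev : ∀ j, ∫ ω, |x ω j - m j| ∂P ≤ 16 / (a * t * √N) := fun j =>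
    integral_abs_randomStieltjes_sub_le hα hsum hJm hJ.indep hN z ht ha haα
      (f := Complex.im) (LipschitzWith.of_dist_le_mul fun u v => by
        rw [NNReal.coe_one, one_mul, Real.dist_eq, dist_eq_norm, ← Complex.sub_im]
        exact Complex.abs_im_le_norm _) Complex.zero_im j j
  have idev : ∀ j, Integrable (fun ω => |x ω j - m j|) P := fun j =>
    ((ix j).sub (integrable_const _)).abs
  set E₁ := (10 * τ + 18 * ((N : ℝ)⁻¹ * b ^ 2) / t) / t ^ 2 +
        2 * κ / t ^ 2 * (2 * D * (16 / (a * t * √N))) with hE₁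
  have hE₁0 : 0 ≤ E₁ := by positivity
  have key : ∀ k ∈ block α N c, ‖∫ ω, green (herm (blockMatrix α g fun i j => J i j ω) z) t
      (tag p k) (tag q k) ∂P - dysonMatrix α g z t m p q‖ ≤ E₁ := by
    intro k hk
    rw [mem_block_iff_label_eq hα hsum] at hk
    obtain ⟨icav, hcav⟩ := hJ.integral_cavityError_le k (z := z) ht hγb hτ
      (by simpa using hw) hv
    have e : ∫ ω, green (herm (blockMatrix α g fun i j => J i j ω) z) t
        (tag p k) (tag q k) ∂P - dysonMatrix α g z t m p q =
        ∫ ω, (green (herm (blockMatrix α g fun i j => J i j ω) z) t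
        (tag p k) (tag q k) - dysonMatrix α g z t m p q) ∂P := by
      rw [integral_sub (iR _ _) (integrable_const _)]
      simp
    rw [e]
    have hpt : ∀ ω, ‖green (herm (blockMatrix α g fun i j => J i j ω) z) t
        (tag p k) (tag q k) - dysonMatrix α g z t m p q‖ ≤
        (cavityError (profileMatrix γ fun p => J p.1 p.2 ω)
          (fun i j => (N : ℝ)⁻¹ * γ i j ^ 2) z t k + 18 * ((N : ℝ)⁻¹ * b ^ 2) / t) / t ^ 2 +
        2 * κ / t ^ 2 * ∑ j, |x ω j - m j| := fun ω => by
      have h1 := norm_green_sub_dysonMatrix_le hα hsum hN hb z ht (fun i j => J i j ω) k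
        (p := p) (q := q) (hk ▸ rfl) (by rw [hk, ← hpq])
      have h2 := norm_dysonMatrix_sub_le (z := z) hα hκ ht (hx0 ω) hm0 p q
      rw [← hX]
      exact (norm_sub_le_norm_sub_add_norm_sub _ _ _).trans (add_le_add h1 h2)
    have i1 : Integrable (fun ω => (cavityError (profileMatrix γ fun p => J p.1 p.2 ω)
          (fun i j => (N : ℝ)⁻¹ * γ i j ^ 2) z t k + 18 * ((N : ℝ)⁻¹ * b ^ 2) / t) / t ^ 2) P :=
      (icav.add (integrable_const _)).div_const _
    have i2 : Integrable (fun ω => 2 * κ / t ^ 2 * ∑ j, |x ω j - m j|) P :=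
      (integrable_finsetSum _ fun j _ => idev j).const_mul _
    calc _ ≤ ∫ ω, ((cavityError (profileMatrix γ fun p => J p.1 p.2 ω)
          (fun i j => (N : ℝ)⁻¹ * γ i j ^ 2) z t k + 18 * ((N : ℝ)⁻¹ * b ^ 2) / t) / t ^ 2 +
        2 * κ / t ^ 2 * ∑ j, |x ω j - m j|) ∂P :=
          norm_integral_le_of_norm_le (i1.add i2) (ae_of_all _ hpt)
      _ ≤ E₁ := by
          rw [integral_add i1 i2, integral_div, integral_add icav (integrable_const _),
            integral_const_mul, integral_finsetSum _ fun j _ => idev j]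
          simp only [integral_const, probReal_univ, one_smul]
          rw [hE₁]
          gcongr
          refine (Finset.sum_le_sum fun j _ => dev j).trans (le_of_eq ?_)
          rw [Finset.sum_const, Finset.card_univ, Fintype.card_sum, Fintype.card_fin, nsmul_eq_mul]
          push_cast
          ring
  have e : ∫ ω, randomStieltjes α g J z t ω p q ∂P =
      (((α c * N)⁻¹ : ℝ) : ℂ) * ∑ k ∈ block α N c, ∫ ω,
        green (herm (blockMatrix α g fun i j => J i j ω) z) t (tag p k) (tag q k) ∂P := by
    simp only [randomStieltjes, stieltjes_apply_of_base_eq _ z t hpq]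
    rw [integral_const_mul, integral_finsetSum _ fun k _ => iR _ _]
  -- The normalization is `α c * N` and not the exact block size, so a multiple of the Dyson entry
  -- of relative size `O(1 / N)` remains.
  have e2 : ∫ ω, randomStieltjes α g J z t ω p q ∂P - dysonMatrix α g z t m p q =
      (((α c * N)⁻¹ : ℝ) : ℂ) * ∑ k ∈ block α N c, (∫ ω,
        green (herm (blockMatrix α g fun i j => J i j ω) z) t (tag p k) (tag q k) ∂P -
          dysonMatrix α g z t m p q) +
      (((α c * N)⁻¹ * (block α N c).card - 1 : ℝ) : ℂ) * dysonMatrix α g z t m p q := by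
    rw [e, Finset.sum_sub_distrib, Finset.sum_const, nsmul_eq_mul]
    push_cast
    ring
  rw [e2]
  have n1 : ‖(((α c * N)⁻¹ : ℝ) : ℂ) * ∑ k ∈ block α N c, (∫ ω,
        green (herm (blockMatrix α g fun i j => J i j ω) z) t (tag p k) (tag q k) ∂P -
          dysonMatrix α g z t m p q)‖ ≤ a⁻¹ * E₁ := by
    rw [norm_mul]
    calc _ ≤ (a * N)⁻¹ * (N * E₁) := by
          refine mul_le_mul (norm_inv_mul_le ha haα c) ?_ (norm_nonneg _) (by positivity)
          refine (norm_sum_le_of_le _ key).trans ?_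
          rw [Finset.sum_const, nsmul_eq_mul]
          refine mul_le_mul_of_nonneg_right ?_ hE₁0
          exact_mod_cast blockSize_le (α := α) (N := N) c
      _ = _ := by field_simp
  have n2 : ‖(((α c * N)⁻¹ * (block α N c).card - 1 : ℝ) : ℂ) * dysonMatrix α g z t m p q‖ ≤
      a⁻¹ * (N : ℝ)⁻¹ * t⁻¹ := by
    rw [norm_mul, Complex.norm_real, Real.norm_eq_abs]
    exact mul_le_mul (abs_weight_mul_card_sub_one_le hα hsum hN ha haα c)
      (norm_dysonMatrix_le hα ht hm0 p q) (norm_nonneg _) (by positivity)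
  have n3 : 0 ≤ a⁻¹ * (2 * τ / t) := by positivity
  have := norm_add_le ((((α c * N)⁻¹ : ℝ) : ℂ) * ∑ k ∈ block α N c, (∫ ω,
        green (herm (blockMatrix α g fun i j => J i j ω) z) t (tag p k) (tag q k) ∂P -
          dysonMatrix α g z t m p q)) ((((α c * N)⁻¹ * (block α N c).card - 1 : ℝ) : ℂ) *
          dysonMatrix α g z t m p q)
  linarith

end MeanEquation

/-! ### From the approximate equation to its exact solution -/

section MeanBound

variable {D : ℕ} {α : Fin D → ℝ} {g : Fin D → Fin D → ℝ}
  {Ω : Type*} [MeasurableSpace Ω] {P : Measure Ω} [IsProbabilityMeasure P]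

lemma one_le_sqrt_natCast {N : ℕ} (hN : N ≠ 0) : 1 ≤ √(N : ℝ) := by
  rw [Real.one_le_sqrt]; exact_mod_cast Nat.pos_of_ne_zero hN

lemma mean_error_le {t a b κ τ₀ T s N : ℝ} {D : ℕ} (ht : 0 < t) (htT : t ≤ T) (ha : 0 < a)
    (hκ0 : 0 ≤ κ) (hτ₀ : 0 ≤ τ₀) (hs : 1 ≤ s) (hsN : s ^ 2 = N) :
    a⁻¹ * ((10 * (τ₀ / (t * s)) + 18 * (N⁻¹ * b ^ 2) / t) / t ^ 2 +
        2 * κ / t ^ 2 * (2 * D * (16 / (a * t * s)))) + a⁻¹ * N⁻¹ * t⁻¹ +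
        a⁻¹ * (2 * (τ₀ / (t * s)) / t) ≤
      a⁻¹ * (10 * τ₀ + 18 * b ^ 2 + 64 * κ * D * a⁻¹ + T ^ 2 + 2 * τ₀ * T) / (t ^ 3 * s) := by
  have hs0 : 0 < s := by linarith
  have hT : 0 < T := ht.trans_le htT
  have hNs : N⁻¹ ≤ s⁻¹ := by
    rw [← hsN]
    refine inv_anti₀ hs0 ?_
    nlinarith
  have h1 : t⁻¹ ≤ T ^ 2 / t ^ 3 := by
    rw [le_div_iff₀ (by positivity)]
    calc t⁻¹ * t ^ 3 = t ^ 2 := by field_simp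
      _ ≤ _ := by gcongr
  have h2 : (t ^ 2)⁻¹ ≤ T / t ^ 3 := by
    rw [le_div_iff₀ (by positivity)]
    calc (t ^ 2)⁻¹ * t ^ 3 = t := by field_simp
      _ ≤ _ := htT
  calc _ = a⁻¹ * (10 * τ₀ / (t ^ 3 * s) + 18 * b ^ 2 * N⁻¹ / t ^ 3 +
        64 * κ * D * a⁻¹ / (t ^ 3 * s)) + a⁻¹ * N⁻¹ * t⁻¹ + a⁻¹ * (2 * τ₀ * s⁻¹ * (t ^ 2)⁻¹) := by
        field_simp
        ring
    _ ≤ a⁻¹ * (10 * τ₀ / (t ^ 3 * s) + 18 * b ^ 2 * s⁻¹ / t ^ 3 +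
        64 * κ * D * a⁻¹ / (t ^ 3 * s)) + a⁻¹ * s⁻¹ * (T ^ 2 / t ^ 3) +
        a⁻¹ * (2 * τ₀ * s⁻¹ * (T / t ^ 3)) := by
        gcongr
    _ = _ := by
        field_simp

/-- The expected Stieltjes transform is close to the solution of the Dyson equation. -/
theorem exists_norm_integral_randomStieltjes_sub_le (hα : ∀ c, 0 < α c) (hsum : ∑ c, α c = 1)
    {a b κ T K : ℝ} (ha : 0 < a) (ha1 : a ≤ 1) (haα : ∀ c, a ≤ α c) (hb0 : 0 ≤ b)
    (hb : ∀ c d, |g c d| ≤ b) (hκ0 : 0 ≤ κ) (hκ : ∀ i, ∑ j, covKernel α g i j ≤ κ) (hT : 0 < T)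
    (hK : 1 ≤ K) :
    ∃ C : ℝ, 1 ≤ C ∧ ∀ (N : ℕ) (J : Fin N → Fin N → Ω → ℂ), N ≠ 0 →
      IsNoise P (fun p : Fin N × Fin N => J p.1 p.2) (N : ℝ)⁻¹ (K / N ^ 2) →
      ∀ (z : ℂ) (t : ℝ), ‖z‖ ≤ T → 0 < t → t ≤ T → C / √N ≤ t ^ 8 →
      ∀ x : Fin D ⊕ Fin D → ℝ, (∀ i, 0 ≤ x i) →
        dysonMap (covKernel α g) Sum.swap (‖z‖ ^ 2) t x = x → ∀ p q,
        ‖∫ ω, randomStieltjes α g J z t ω p q ∂P - dysonMatrix α g z t x p q‖ ≤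
          C / (t ^ 9 * √N) := by
  -- Chosen so that `τ = τ₀ / (t √N)` meets the three moment conditions: `K b²` serves the fourth
  -- moments, and `b (T + 1)` serves the variances with and without the factor `t⁻²`; the `1` makes
  -- `τ` positive.
  obtain ⟨τ₀, hτ₀⟩ : ∃ u : ℝ, u = K * b ^ 2 + b * (T + 1) + 1 := ⟨_, rfl⟩
  obtain ⟨C₁, hC₁⟩ : ∃ u : ℝ, u = a⁻¹ * (10 * τ₀ + 18 * b ^ 2 + 64 * κ * D * a⁻¹ + T ^ 2 + 2 * τ₀ * T) := ⟨_, rfl⟩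
  obtain ⟨G, hG⟩ : ∃ u : ℝ, u = T ^ 2 + κ / a + T ^ 2 := ⟨_, rfl⟩
  have hK0 : 0 < K := by linarith
  have hτ₀0 : 0 < τ₀ := by rw [hτ₀]; positivity
  have hC₁0 : 0 ≤ C₁ := by rw [hC₁]; positivity
  have hG0 : 0 < G := by rw [hG]; positivity
  -- The first summand turns `C / √N ≤ t ^ 8` into the smallness condition of the stability
  -- estimate, the bracket is the constant of the final bound, and the `1` ensures `1 ≤ C`.
  refine ⟨4 * G ^ 2 * C₁ * T ^ 2 + (C₁ * T ^ 6 + 16 * κ * D * G ^ 2 * C₁ / a) + 1, ?_, ?_⟩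
  · have : 0 ≤ 4 * G ^ 2 * C₁ * T ^ 2 + (C₁ * T ^ 6 + 16 * κ * D * G ^ 2 * C₁ / a) := by positivity
    linarith
  intro N J hN hJ z t hz ht htT hreg x hx0 hfix p q
  obtain ⟨s, hs⟩ : ∃ u : ℝ, √(N : ℝ) = u := ⟨_, rfl⟩
  rw [hs] at hreg ⊢
  have hs1 : 1 ≤ s := hs ▸ one_le_sqrt_natCast hN
  have hs0 : 0 < s := by linarith
  have hsN : s ^ 2 = (N : ℝ) := hs ▸ Real.sq_sqrt (Nat.cast_nonneg _)
  have hτ : 0 < τ₀ / (t * s) := by positivity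
  have hττ : (τ₀ / (t * s)) ^ 2 = τ₀ ^ 2 / (t ^ 2 * s ^ 2) := by rw [div_pow, mul_pow]
  have hbT : 0 ≤ b * (T + 1) := by positivity
  have hKb : 0 ≤ K * b ^ 2 := by positivity
  have hw : K / N ^ 2 * (N * b ^ 4 * (t⁻¹) ^ 2) ≤ (τ₀ / (t * s)) ^ 2 := by
    rw [hττ, ← hsN]
    calc K / (s ^ 2) ^ 2 * (s ^ 2 * b ^ 4 * (t⁻¹) ^ 2) = K * b ^ 4 / (t ^ 2 * s ^ 2) := by
          field_simp
      _ ≤ _ := by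
          gcongr
          have h1 : K * b ^ 2 ≤ τ₀ := by linarith
          calc K * b ^ 4 ≤ K * K * b ^ 4 := by gcongr; nlinarith
            _ = (K * b ^ 2) ^ 2 := by ring
            _ ≤ _ := by gcongr
  have hv : (N : ℝ)⁻¹ * b ^ 2 ≤ (τ₀ / (t * s)) ^ 2 := by
    rw [hττ, ← hsN]
    calc (s ^ 2)⁻¹ * b ^ 2 = (b * t) ^ 2 / (t ^ 2 * s ^ 2) := by field_simp
      _ ≤ _ := by
          gcongr
          calc b * t ≤ b * (T + 1) := by gcongr; linarith
            _ ≤ τ₀ := by linarith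
  have hv' : (N : ℝ)⁻¹ * (b ^ 2 * (t⁻¹) ^ 2) ≤ (τ₀ / (t * s)) ^ 2 := by
    rw [hττ, ← hsN]
    calc (s ^ 2)⁻¹ * (b ^ 2 * (t⁻¹) ^ 2) = b ^ 2 / (t ^ 2 * s ^ 2) := by field_simp
      _ ≤ _ := by
          gcongr
          nlinarith
  set m := meanDiag P α g J z t with hm
  have hmain : ∀ p q, ‖∫ ω, randomStieltjes α g J z t ω p q ∂P - dysonMatrix α g z t m p q‖ ≤
      C₁ / (t ^ 3 * s) := fun p q =>
    (norm_integral_randomStieltjes_sub_le hα hsum hJ hN z ht ha haα hb hκ0 hκ hτ hw hv hv' p q).trans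
      (by rw [hC₁, hs]; exact mean_error_le ht htT ha hκ0 hτ₀0.le hs1 hsN)
  have hJm : ∀ i j, Measurable (J i j) := fun i j => hJ.meas (i, j)
  have hint := fun p => integrable_randomStieltjes (P := P) (g := g) hα hsum hJm z ht ha haα p p
  have hm0 : ∀ p, 0 ≤ m p := fun p =>
    integral_nonneg fun ω => stieltjes_diag_im_nonneg hα _ z ht p
  have hmL : ∀ p, m p ≤ a⁻¹ * t⁻¹ := fun p => by
    have h1 : ∫ ω, (randomStieltjes α g J z t ω p p).im ∂P ≤ ∫ _ω, a⁻¹ * t⁻¹ ∂P :=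
      integral_mono (hint p).im (integrable_const _) fun ω =>
        (le_abs_self _).trans ((Complex.abs_im_le_norm _).trans
          (norm_stieltjes_apply_le ha haα _ z ht p p))
    rw [integral_const, probReal_univ, one_smul] at h1
    exact h1
  -- The imaginary parts of the diagonal entries of the mean estimate say that `m` is nearly fixed
  -- by the Dyson map.
  have hmF : ∀ p, |m p - dysonMap (covKernel α g) Sum.swap (‖z‖ ^ 2) t m p| ≤ C₁ / (t ^ 3 * s) := by
    intro p
    refine le_trans (le_trans (le_of_eq ?_) (Complex.abs_im_le_norm _)) (hmain p p)
    have him : (∫ ω, randomStieltjes α g J z t ω p p ∂P).im = m p := (integral_im (hint p)).symm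
    rw [Complex.sub_im, him, dysonMatrix_diag]
    simp
  have hGz : t ^ 2 + κ / a + ‖z‖ ^ 2 ≤ G := by
    rw [hG]
    gcongr
  have hsmall : 4 * G ^ 2 * (C₁ / (t ^ 3 * s)) ≤ t ^ 3 := by
    have h1 : 4 * G ^ 2 * C₁ * T ^ 2 / s ≤ t ^ 8 := by
      refine le_trans ?_ hreg
      gcongr
      have : 0 ≤ (C₁ * T ^ 6 + 16 * κ * D * G ^ 2 * C₁ / a) := by positivity
      linarith
    have h2 : t ^ 8 ≤ t ^ 6 * T ^ 2 := by
      calc t ^ 8 = t ^ 6 * t ^ 2 := by ring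
        _ ≤ _ := by gcongr
    have h3 : 4 * G ^ 2 * C₁ / s ≤ t ^ 6 := by
      have e : 4 * G ^ 2 * C₁ * T ^ 2 / s = 4 * G ^ 2 * C₁ / s * T ^ 2 := by ring
      rw [e] at h1
      exact le_of_mul_le_mul_right (h1.trans h2) (by positivity)
    calc 4 * G ^ 2 * (C₁ / (t ^ 3 * s)) = 4 * G ^ 2 * C₁ / s / t ^ 3 := by field_simp
      _ ≤ t ^ 6 / t ^ 3 := by gcongr
      _ = t ^ 3 := by field_simp
  have hmx := abs_sub_fixedPoint_le hα hκ0 hκ ht ha ha1 hGz hm0 hmL hx0 hfix (by positivity) hmF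
    hsmall
  have hdm := norm_dysonMatrix_sub_le (z := z) hα hκ ht hm0 hx0 p q
  have hsumle : ∑ j, |m j - x j| ≤ 2 * D * (4 * G ^ 2 / (a * t ^ 4) * (C₁ / (t ^ 3 * s))) := by
    refine (Finset.sum_le_sum fun j _ => hmx j).trans (le_of_eq ?_)
    rw [Finset.sum_const, Finset.card_univ, Fintype.card_sum, Fintype.card_fin, nsmul_eq_mul]
    push_cast
    ring
  calc _ ≤ C₁ / (t ^ 3 * s) + 2 * κ / t ^ 2 *
        (2 * D * (4 * G ^ 2 / (a * t ^ 4) * (C₁ / (t ^ 3 * s)))) := by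
        refine (norm_sub_le_norm_sub_add_norm_sub _ (dysonMatrix α g z t m p q) _).trans
          (add_le_add (hmain p q) (hdm.trans ?_))
        gcongr
    _ = C₁ * t ^ 6 / (t ^ 9 * s) + 16 * κ * D * G ^ 2 * C₁ / a / (t ^ 9 * s) := by
        field_simp
        ring
    _ ≤ C₁ * T ^ 6 / (t ^ 9 * s) + 16 * κ * D * G ^ 2 * C₁ / a / (t ^ 9 * s) := by gcongr
    _ = (C₁ * T ^ 6 + 16 * κ * D * G ^ 2 * C₁ / a) / (t ^ 9 * s) := by ring
    _ ≤ _ := by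
        have : 0 ≤ 4 * G ^ 2 * C₁ * T ^ 2 := by positivity
        exact div_le_div_of_nonneg_right (by linarith) (by positivity)

end MeanBound

/-! ### Almost sure bounds -/

section AlmostSure

variable {D : ℕ} {α : Fin D → ℝ} {g : Fin D → Fin D → ℝ}
  {Ω : Type*} [MeasurableSpace Ω] {P : Measure Ω} [IsProbabilityMeasure P]

lemma rpow_neg_quarter_sq (N : ℕ) : ((N : ℝ) ^ (-(1 / 4) : ℝ)) ^ 2 = (√(N : ℝ))⁻¹ := by
  rw [← Real.rpow_natCast, ← Real.rpow_mul (Nat.cast_nonneg _), Real.sqrt_eq_rpow,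
    ← Real.rpow_neg (Nat.cast_nonneg _)]
  norm_num

/-- The real and imaginary part. -/
def realPart : Bool → ℂ → ℝ
  | true => Complex.re
  | false => Complex.im

lemma realPart_lipschitz (i : Bool) : LipschitzWith 1 (realPart i) := by
  refine LipschitzWith.of_dist_le_mul fun u v => ?_
  rw [NNReal.coe_one, one_mul, Real.dist_eq, dist_eq_norm]
  cases i
  · simpa [realPart] using Complex.abs_im_le_norm (u - v)
  · simpa [realPart] using Complex.abs_re_le_norm (u - v)

lemma realPart_zero (i : Bool) : realPart i 0 = 0 := by cases i <;> rfl

/-- The exponent is `y = a² √N t² / 32`, and `hreg` keeps it above a power of `N`. In `y¹⁶ / 16! ≤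
exp y` the factor `t³² = (t⁸)⁴` costs only `N²` of the `N⁸` available, which leaves `N⁶`. -/
lemma exp_neg_le_div_pow {a c t : ℝ} {N : ℕ} (hN : N ≠ 0) (ha : 0 < a) (hc : 0 < c) (ht : 0 < t)
    (hreg : c / √N ≤ t ^ 8) :
    2 * Real.exp (-(((N : ℝ) ^ (-(1 / 4) : ℝ)) ^ 2 * (a ^ 2 * N * t ^ 2) / 32)) ≤
      2 * (Nat.factorial 16) * 32 ^ 16 / (a ^ 32 * c ^ 4) / N ^ 6 := by
  have hN' : (0 : ℝ) < N := by exact_mod_cast Nat.pos_of_ne_zero hN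
  rw [rpow_neg_quarter_sq]
  obtain ⟨s, hs⟩ : ∃ u : ℝ, √(N : ℝ) = u := ⟨_, rfl⟩
  have hs0 : 0 < s := hs ▸ Real.sqrt_pos.2 hN'
  have hsN : (N : ℝ) = s ^ 2 := hs ▸ (Real.sq_sqrt hN'.le).symm
  rw [hs] at hreg
  rw [hs, hsN]
  set y := s⁻¹ * (a ^ 2 * s ^ 2 * t ^ 2) / 32 with hy
  have hy0 : 0 < y := by positivity
  have h1 := Real.pow_div_factorial_le_exp y hy0.le 16
  have h2 : (s ^ 2) ^ 6 * (a ^ 32 * c ^ 4) / 32 ^ 16 ≤ y ^ 16 := by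
    have h3 : (c / s) ^ 4 ≤ (t ^ 8) ^ 4 := pow_le_pow_left₀ (by positivity) hreg 4
    calc (s ^ 2) ^ 6 * (a ^ 32 * c ^ 4) / 32 ^ 16 = s ^ 16 * a ^ 32 / 32 ^ 16 * (c / s) ^ 4 := by
          field_simp
      _ ≤ s ^ 16 * a ^ 32 / 32 ^ 16 * (t ^ 8) ^ 4 := by gcongr
      _ = y ^ 16 := by rw [hy]; field_simp
  have h4 : (s ^ 2) ^ 6 * (a ^ 32 * c ^ 4) / 32 ^ 16 / (Nat.factorial 16 : ℝ) ≤ Real.exp y :=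
    le_trans (by gcongr) h1
  rw [Real.exp_neg]
  have hf : (0 : ℝ) < (Nat.factorial 16 : ℝ) := by exact_mod_cast Nat.factorial_pos 16
  generalize (Nat.factorial 16 : ℝ) = F at h4 hf ⊢
  calc 2 * (Real.exp y)⁻¹ ≤ 2 * ((s ^ 2) ^ 6 * (a ^ 32 * c ^ 4) / 32 ^ 16 / F)⁻¹ := by
        have : 0 < (s ^ 2) ^ 6 * (a ^ 32 * c ^ 4) / 32 ^ 16 / F := by positivity
        gcongr
    _ = _ := by field_simp

/-- The grid of spacing `1 / N` in the box of size `R`. -/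
def grid (R N : ℕ) : Finset (ℤ × ℤ × ℕ) :=
  Finset.Icc (-((R * N : ℕ) : ℤ)) (R * N : ℕ) ×ˢ
    Finset.Icc (-((R * N : ℕ) : ℤ)) (R * N : ℕ) ×ˢ Finset.Icc 1 (R * N)

lemma card_grid_le (R N : ℕ) : ((grid R N).card : ℝ) ≤ 9 * R ^ 3 * N ^ 3 := by
  have h : (grid R N).card = (2 * (R * N) + 1) * ((2 * (R * N) + 1) * (R * N)) := by
    simp only [grid, Finset.card_product, Int.card_Icc, Nat.card_Icc]
    have : (((R * N : ℕ) : ℤ) + 1 - -((R * N : ℕ) : ℤ)).toNat = 2 * (R * N) + 1 := by omega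
    rw [this, Nat.add_sub_cancel]
  have h2 : (grid R N).card ≤ 9 * (R * N) ^ 3 := by
    rw [h]
    rcases Nat.eq_zero_or_pos (R * N) with h0 | h0
    · simp [h0]
    · nlinarith [Nat.mul_le_mul h0 h0, Nat.mul_le_mul (Nat.mul_le_mul h0 h0) h0, sq_nonneg (R * N)]
  calc ((grid R N).card : ℝ) ≤ ((9 * (R * N) ^ 3 : ℕ) : ℝ) := by exact_mod_cast h2
    _ = _ := by push_cast; ring

/-- Almost surely, the Stieltjes transform is close to its expectation on the grid. -/
theorem ae_eventually_norm_sub_integral_le (hα : ∀ c, 0 < α c) (hsum : ∑ c, α c = 1)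
    {J : (N : ℕ) → Fin N → Fin N → Ω → ℂ} (hmeas : ∀ N i j, Measurable (J N i j))
    (hindep : ∀ N, iIndepFun (fun p : Fin N × Fin N => J N p.1 p.2) P)
    {a c : ℝ} (ha : 0 < a) (haα : ∀ c, a ≤ α c) (hc : 0 < c) (R : ℕ) :
    ∀ᵐ ω ∂P, ∀ᶠ N : ℕ in atTop, ∀ k ∈ grid R N, c / √N ≤ ((k.2.2 : ℝ) / N) ^ 8 → ∀ p q,
      ‖randomStieltjes α g (J N) (⟨k.1 / N, k.2.1 / N⟩ : ℂ) (k.2.2 / N) ω p q -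
        ∫ ω, randomStieltjes α g (J N) (⟨k.1 / N, k.2.1 / N⟩ : ℂ) (k.2.2 / N) ω p q ∂P‖ ≤
        2 * (N : ℝ) ^ (-(1 / 4) : ℝ) := by
  classical
  set Z : (N : ℕ) → (ℤ × ℤ × ℕ) → Ω → Matrix (Fin D ⊕ Fin D) (Fin D ⊕ Fin D) ℂ := fun N k ω =>
    randomStieltjes α g (J N) (⟨k.1 / N, k.2.1 / N⟩ : ℂ) (k.2.2 / N) ω with hZ
  -- The bad event for one grid point, one entry and its real or imaginary part; it is empty where
  -- `t` is too small for the concentration bound to be useful.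
  set S : (N : ℕ) → ((ℤ × ℤ × ℕ) × (Fin D ⊕ Fin D) × (Fin D ⊕ Fin D) × Bool) → Set Ω :=
    fun N i => if c / √N ≤ ((i.1.2.2 : ℝ) / N) ^ 8 then
      {ω | (N : ℝ) ^ (-(1 / 4) : ℝ) ≤ |realPart i.2.2.2 (Z N i.1 ω i.2.1 i.2.2.1) -
        ∫ ω, realPart i.2.2.2 (Z N i.1 ω i.2.1 i.2.2.1) ∂P|} else ∅ with hS
  set B : ℕ → Set Ω := fun N => ⋃ i ∈ grid R N ×ˢ Finset.univ, S N i with hB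
  obtain ⟨A, hA⟩ : ∃ u : ℝ, u = 2 * (Nat.factorial 16) * 32 ^ 16 / (a ^ 32 * c ^ 4) := ⟨_, rfl⟩
  have hA0 : 0 ≤ A := by rw [hA]; positivity
  have hpos : ∀ {N : ℕ} {k : ℤ × ℤ × ℕ}, k ∈ grid R N → N ≠ 0 ∧ (0 : ℝ) < (k.2.2 : ℝ) / N := by
    intro N k hk
    simp only [grid, Finset.mem_product, Finset.mem_Icc] at hk
    have hN : N ≠ 0 := by
      rintro rfl
      simp only [mul_zero] at hk
      omega
    have h1 : (0 : ℝ) < (k.2.2 : ℝ) := by exact_mod_cast hk.2.2.1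
    have h2 : (0 : ℝ) < N := by exact_mod_cast Nat.pos_of_ne_zero hN
    exact ⟨hN, div_pos h1 h2⟩
  have hSle : ∀ N, ∀ i ∈ grid R N ×ˢ (Finset.univ : Finset ((Fin D ⊕ Fin D) × (Fin D ⊕ Fin D) × Bool)),
      P.real (S N i) ≤ A / N ^ 6 := by
    intro N i hi
    obtain ⟨hN, ht⟩ := hpos (Finset.mem_product.1 hi).1
    by_cases hreg : c / √N ≤ ((i.1.2.2 : ℝ) / N) ^ 8
    · simp only [hS, if_pos hreg]
      refine (measure_abs_randomStieltjes_sub_ge_le hα hsum (hmeas N) (hindep N) hN _ ht ha haα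
        (realPart_lipschitz _) (realPart_zero _) _ _ (by positivity)).trans ?_
      rw [hA]
      exact exp_neg_le_div_pow hN ha hc ht hreg
    · simp only [hS, if_neg hreg, measureReal_empty]
      positivity
  -- About `N³` grid points against a probability `N⁻⁶` each: the total `N⁻³` is summable, as
  -- Borel–Cantelli requires. The factor `8 D²` counts the `(2 D)²` entries with two parts each.
  have hBle : ∀ N, P.real (B N) ≤ 72 * R ^ 3 * D ^ 2 * A * (1 / (N : ℝ) ^ 3) := by
    intro N
    have hcard : ((grid R N ×ˢ (Finset.univ : Finset ((Fin D ⊕ Fin D) × (Fin D ⊕ Fin D) ×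
        Bool))).card : ℝ) ≤ 9 * R ^ 3 * N ^ 3 * (8 * D ^ 2) := by
      rw [Finset.card_product, Nat.cast_mul]
      have e : ((Finset.univ : Finset ((Fin D ⊕ Fin D) × (Fin D ⊕ Fin D) × Bool)).card : ℝ) =
          8 * D ^ 2 := by
        simp only [Finset.card_univ, Fintype.card_prod, Fintype.card_sum, Fintype.card_fin,
          Fintype.card_bool]
        push_cast
        ring
      rw [e]
      exact mul_le_mul_of_nonneg_right (card_grid_le R N) (by positivity)
    calc P.real (B N) ≤ ∑ i ∈ grid R N ×ˢ Finset.univ, P.real (S N i) :=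
          measureReal_biUnion_finset_le _ _
      _ ≤ ∑ _i ∈ grid R N ×ˢ (Finset.univ : Finset ((Fin D ⊕ Fin D) × (Fin D ⊕ Fin D) × Bool)),
          A / N ^ 6 := Finset.sum_le_sum (hSle N)
      _ ≤ 9 * R ^ 3 * N ^ 3 * (8 * D ^ 2) * (A / N ^ 6) := by
          rw [Finset.sum_const, nsmul_eq_mul]
          gcongr
      _ = _ := by
          rcases Nat.eq_zero_or_pos N with rfl | hN
          · simp
          · have hN' : (N : ℝ) ≠ 0 := by exact_mod_cast hN.ne'
            field_simp
            ring
  have hsumm : Summable fun N : ℕ => 72 * R ^ 3 * D ^ 2 * A * (1 / (N : ℝ) ^ 3) :=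
    (Real.summable_one_div_nat_pow.2 (by norm_num)).mul_left _
  have hfin : ∑' N, P (B N) ≠ ⊤ := by
    refine ne_top_of_le_ne_top hsumm.tsum_ofReal_ne_top (ENNReal.tsum_le_tsum fun N => ?_)
    rw [← ofReal_measureReal (measure_ne_top P _)]
    exact ENNReal.ofReal_le_ofReal (hBle N)
  filter_upwards [ae_eventually_notMem hfin] with ω hω
  filter_upwards [hω] with N hN k hk hreg p q
  have hpart : ∀ i, |realPart i (Z N k ω p q) - ∫ ω, realPart i (Z N k ω p q) ∂P| ≤
      (N : ℝ) ^ (-(1 / 4) : ℝ) := by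
    intro i
    by_contra hcon
    refine hN (Set.mem_biUnion (x := (k, p, q, i)) (by simp [hk]) ?_)
    simp only [hS, if_pos hreg]
    exact (not_le.1 hcon).le
  have hint := integrable_randomStieltjes (P := P) (g := g) hα hsum (hmeas N)
    (⟨k.1 / N, k.2.1 / N⟩ : ℂ) (hpos hk).2 ha haα p q
  have hre : (∫ ω, Z N k ω p q ∂P).re = ∫ ω, (Z N k ω p q).re ∂P := (integral_re hint).symm
  have him : (∫ ω, Z N k ω p q ∂P).im = ∫ ω, (Z N k ω p q).im ∂P := (integral_im hint).symm
  refine (Complex.norm_le_abs_re_add_abs_im _).trans ?_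
  rw [Complex.sub_re, Complex.sub_im]
  have h1 := hpart true
  have h2 := hpart false
  simp only [realPart, ← hre, ← him] at h1 h2
  rw [two_mul]
  exact add_le_add h1 h2

end AlmostSure

/-! ### From the grid to all spectral parameters -/

section LocalLaw

variable {D : ℕ} {α : Fin D → ℝ} {g : Fin D → Fin D → ℝ}
  {Ω : Type*} [MeasurableSpace Ω] {P : Measure Ω} [IsProbabilityMeasure P]

/-- Every point is within `3 / N` of a grid point with larger `t`. -/
lemma exists_grid_near {T : ℝ} {R N : ℕ} (hR : T + 1 ≤ R) (hN : N ≠ 0) {z : ℂ} {t : ℝ}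
    (hz : ‖z‖ < T) (ht : 0 < t) (htT : t < T) :
    ∃ k ∈ grid R N, t ≤ (k.2.2 : ℝ) / N ∧
      ‖z - (⟨k.1 / N, k.2.1 / N⟩ : ℂ)‖ + |t - (k.2.2 : ℝ) / N| ≤ 3 / N := by
  have hN1 : (1 : ℝ) ≤ N := by exact_mod_cast Nat.pos_of_ne_zero hN
  have hN' : (0 : ℝ) < N := by linarith
  have hre := abs_lt.1 ((Complex.abs_re_le_norm z).trans_lt hz)
  have him := abs_lt.1 ((Complex.abs_im_le_norm z).trans_lt hz)
  have hRN : (T + 1) * N ≤ ((R * N : ℕ) : ℝ) := by push_cast; gcongr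
  have hfl : ∀ u : ℝ, -T < u → u < T → ⌊u * N⌋ ∈ Finset.Icc (-((R * N : ℕ) : ℤ)) (R * N : ℕ) := by
    intro u h1 h2
    rw [Finset.mem_Icc]
    constructor
    · rw [Int.le_floor]
      rw [Int.cast_neg, Int.cast_natCast]
      nlinarith
    · have : (⌊u * N⌋ : ℝ) ≤ ((R * N : ℕ) : ℤ) := by
        rw [Int.cast_natCast]
        refine (Int.floor_le _).trans ?_
        nlinarith
      exact_mod_cast this
  have hdist : ∀ u : ℝ, |u - ⌊u * N⌋ / N| ≤ 1 / N := by
    intro u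
    have e : u - ⌊u * N⌋ / N = (u * N - ⌊u * N⌋) / N := by field_simp
    rw [e, abs_div, abs_of_pos hN', abs_of_nonneg (by linarith [Int.floor_le (u * N)])]
    gcongr
    linarith [Int.lt_floor_add_one (u * N)]
  have htN : 0 < t * N := by positivity
  -- `t` is rounded up, so that lower bounds on `t⁸` and upper bounds on `t⁻¹` pass to the grid
  -- point; the spare `1` in `T + 1 ≤ R` leaves room for this.
  refine ⟨(⌊z.re * N⌋, ⌊z.im * N⌋, ⌈t * N⌉₊), ?_, ?_, ?_⟩
  · simp only [grid, Finset.mem_product]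
    refine ⟨hfl _ hre.1 hre.2, hfl _ him.1 him.2, ?_⟩
    rw [Finset.mem_Icc]
    refine ⟨Nat.one_le_iff_ne_zero.2 (Nat.ceil_pos.2 htN).ne', ?_⟩
    have h1 := Nat.ceil_lt_add_one htN.le
    have : (⌈t * N⌉₊ : ℝ) ≤ ((R * N : ℕ) : ℝ) := by nlinarith
    exact_mod_cast this
  · simp only
    rw [le_div_iff₀ hN']
    exact Nat.le_ceil _
  · simp only
    have h1 : ‖z - (⟨⌊z.re * N⌋ / N, ⌊z.im * N⌋ / N⟩ : ℂ)‖ ≤ 1 / N + 1 / N :=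
      (Complex.norm_le_abs_re_add_abs_im _).trans (add_le_add (hdist z.re) (hdist z.im))
    have h2 : |t - (⌈t * N⌉₊ : ℝ) / N| ≤ 1 / N := by
      have e : t - (⌈t * N⌉₊ : ℝ) / N = -((⌈t * N⌉₊ - t * N) / N) := by field_simp; ring
      rw [e, abs_neg, abs_div, abs_of_pos hN', abs_of_nonneg (by linarith [Nat.le_ceil (t * N)])]
      gcongr
      linarith [Nat.ceil_lt_add_one htN.le]
    calc _ ≤ (1 / N + 1 / N : ℝ) + 1 / N := add_le_add h1 h2
      _ = 3 / N := by ring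

lemma opNorm_le_sum (A : Matrix (Fin D ⊕ Fin D) (Fin D ⊕ Fin D) ℂ) :
    opNorm A ≤ ∑ p, ∑ q, ‖A p q‖ := by
  have h := norm_le_sum_entries A
  rwa [Matrix.cstar_norm_def] at h

/-- Almost surely, all entries of the Stieltjes transform are close to the limit. -/
theorem ae_eventually_norm_randomStieltjes_sub_le (hα : ∀ c, 0 < α c) (hsum : ∑ c, α c = 1)
    {J : (N : ℕ) → Fin N → Fin N → Ω → ℂ} {K : ℝ} (hK : 1 ≤ K)
    (hJ : ∀ N, N ≠ 0 →
      IsNoise P (fun p : Fin N × Fin N => J N p.1 p.2) (N : ℝ)⁻¹ (K / (N : ℝ) ^ 2))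
    (hmeas : ∀ N i j, Measurable (J N i j))
    (hindep : ∀ N, iIndepFun (fun p : Fin N × Fin N => J N p.1 p.2) P) {T : ℝ} (hT : 0 < T) :
    ∃ C : ℝ, 0 < C ∧ ∀ᵐ ω ∂P, ∀ᶠ N : ℕ in atTop, ∀ (z : ℂ) (t : ℝ), ‖z‖ < T → 0 < t → t < T →
      ∀ x : Fin D ⊕ Fin D → ℝ, (∀ i, 0 < x i) →
        dysonMap (covKernel α g) Sum.swap (‖z‖ ^ 2) t x = x → ∀ p q,
        ‖randomStieltjes α g (J N) z t ω p q - dysonMatrix α g z t x p q‖ ≤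
          C / t ^ 5 * (N : ℝ) ^ (-(1 / 4) : ℝ) := by
  have hDne : Nonempty (Fin D) := by
    by_contra h
    rw [not_nonempty_iff] at h
    simp at hsum
  obtain ⟨c₀, hc₀⟩ := Finite.exists_min α
  obtain ⟨a, haα, ha, ha1⟩ : ∃ a, (∀ c, a ≤ α c) ∧ 0 < a ∧ a ≤ 1 :=
    ⟨α c₀, hc₀, hα c₀, hsum ▸ Finset.single_le_sum (fun c _ => (hα c).le) (Finset.mem_univ c₀)⟩
  obtain ⟨b, hb0, hb⟩ : ∃ b : ℝ, 0 ≤ b ∧ ∀ c d, |g c d| ≤ b :=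
    ⟨∑ c, ∑ d, |g c d|, by positivity, fun c d =>
      (Finset.single_le_sum (f := fun d => |g c d|) (fun _ _ => abs_nonneg _)
        (Finset.mem_univ d)).trans (Finset.single_le_sum (f := fun c => ∑ d, |g c d|)
        (fun _ _ => Finset.sum_nonneg fun _ _ => abs_nonneg _) (Finset.mem_univ c))⟩
  have hΓ := covKernel_nonneg (g := g) hα
  obtain ⟨κ, hκ0, hκ⟩ : ∃ κ : ℝ, 0 ≤ κ ∧ ∀ i, ∑ j, covKernel α g i j ≤ κ :=
    ⟨∑ i, ∑ j, covKernel α g i j, Finset.sum_nonneg fun i _ => Finset.sum_nonneg fun j _ => hΓ i j,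
      fun i => Finset.single_le_sum (f := fun i => ∑ j, covKernel α g i j)
        (fun i _ => Finset.sum_nonneg fun j _ => hΓ i j) (Finset.mem_univ i)⟩
  obtain ⟨C, hC1, hmean⟩ := exists_norm_integral_randomStieltjes_sub_le (P := P) (g := g) hα hsum ha
    ha1 haα hb0 hb hκ0 hκ hT hK
  have hC0 : 0 < C := by linarith
  obtain ⟨R, hR⟩ := exists_nat_ge (T + 1)
  -- The bracket serves the range `C / √N ≤ t ^ 8`: two Lipschitz steps, the concentration on the
  -- grid and the error of the mean. The last summand serves smaller `t`.
  refine ⟨(6 * a⁻¹ * T ^ 3 + 2 * T ^ 5 + C) + (a⁻¹ + 1) * C, by positivity, ?_⟩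
  filter_upwards [ae_eventually_norm_sub_integral_le (g := g) hα hsum hmeas hindep ha haα hC0 R]
    with ω hω
  filter_upwards [hω, eventually_ne_atTop 0] with N hconc hN z t hz ht htT x hx hfix p q
  have hN1 : (1 : ℝ) ≤ N := by exact_mod_cast Nat.pos_of_ne_zero hN
  have hN' : (0 : ℝ) < N := by linarith
  have hsq := rpow_neg_quarter_sq N
  have hinv : (N : ℝ)⁻¹ ≤ (N : ℝ) ^ (-(1 / 4) : ℝ) := by
    rw [← Real.rpow_neg_one]
    exact Real.rpow_le_rpow_of_exponent_le hN1 (by norm_num)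
  have hε0 : 0 < (N : ℝ) ^ (-(1 / 4) : ℝ) := Real.rpow_pos_of_pos hN' _
  generalize (N : ℝ) ^ (-(1 / 4) : ℝ) = ε at hsq hinv hε0 hconc ⊢
  by_cases hreg : C / √N ≤ t ^ 8
  · obtain ⟨k, hk, htk, hdist⟩ := exists_grid_near hR hN hz ht htT
    have hreg' : C / √N ≤ ((k.2.2 : ℝ) / N) ^ 8 := hreg.trans (by gcongr)
    have h1 := hconc k hk hreg' p q
    set z' : ℂ := ⟨k.1 / N, k.2.1 / N⟩ with hz'
    set t' : ℝ := (k.2.2 : ℝ) / N with ht'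
    have ht'0 : 0 < t' := ht.trans_le htk
    have hlip : ∀ ω, ‖randomStieltjes α g (J N) z t ω p q - randomStieltjes α g (J N) z' t' ω p q‖ ≤
        3 * a⁻¹ / (t ^ 2 * N) := fun ω => by
      refine (norm_stieltjes_sub_le ha haα _ z z' ht ht'0 p q).trans ?_
      calc a⁻¹ * (t⁻¹ * (‖z - z'‖ + |t - t'|) * t'⁻¹) ≤ a⁻¹ * (t⁻¹ * (3 / N) * t⁻¹) := by
            gcongr
        _ = _ := by field_simp
    have hi := integrable_randomStieltjes (P := P) (g := g) hα hsum (hmeas N) z ht ha haα p q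
    have hi' := integrable_randomStieltjes (P := P) (g := g) hα hsum (hmeas N) z' ht'0 ha haα p q
    have h2 : ‖∫ ω, randomStieltjes α g (J N) z' t' ω p q ∂P -
        ∫ ω, randomStieltjes α g (J N) z t ω p q ∂P‖ ≤ 3 * a⁻¹ / (t ^ 2 * N) := by
      rw [norm_sub_rev, ← integral_sub hi hi']
      refine (norm_integral_le_of_norm_le_const (ae_of_all _ hlip)).trans (le_of_eq ?_)
      rw [probReal_univ, mul_one]
    have h3 := hmean N (J N) hN (hJ N hN) z t hz.le ht htT.le hreg x (fun i => (hx i).le) hfix p q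
    -- One of the two factors `ε = N^(-1/4)` in `N^(-1/2)` is traded for `t⁴`, which improves `t⁻⁹`
    -- to `t⁻⁵`.
    have hεt : ε ≤ t ^ 4 := by
      have h4 : ε ^ 2 ≤ (t ^ 4) ^ 2 := by
        calc ε ^ 2 ≤ C * ε ^ 2 := le_mul_of_one_le_left (by positivity) hC1
          _ = C / √N := by rw [hsq]; rfl
          _ ≤ t ^ 8 := hreg
          _ = _ := by ring
      exact le_of_sq_le_sq h4 (by positivity)
    have h5 : C / (t ^ 9 * √N) ≤ C / t ^ 5 * ε := by
      calc C / (t ^ 9 * √N) = C / t ^ 9 * ε ^ 2 := by rw [hsq]; field_simp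
        _ = C / t ^ 9 * (ε * ε) := by ring
        _ ≤ C / t ^ 9 * (t ^ 4 * ε) := by gcongr
        _ = _ := by field_simp
    have h6 : 3 * a⁻¹ / (t ^ 2 * N) ≤ 3 * a⁻¹ * T ^ 3 / t ^ 5 * ε := by
      calc 3 * a⁻¹ / (t ^ 2 * N) = 3 * a⁻¹ * t ^ 3 / t ^ 5 * (N : ℝ)⁻¹ := by field_simp
        _ ≤ _ := by gcongr
    have h7 : 2 * ε ≤ 2 * T ^ 5 / t ^ 5 * ε := by
      gcongr
      rw [le_div_iff₀ (by positivity)]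
      gcongr
    have h8 : 0 ≤ (a⁻¹ + 1) * C / t ^ 5 * ε := by positivity
    have e : randomStieltjes α g (J N) z t ω p q - dysonMatrix α g z t x p q =
        (randomStieltjes α g (J N) z t ω p q - randomStieltjes α g (J N) z' t' ω p q) +
        (randomStieltjes α g (J N) z' t' ω p q - ∫ ω, randomStieltjes α g (J N) z' t' ω p q ∂P) +
        (∫ ω, randomStieltjes α g (J N) z' t' ω p q ∂P -
          ∫ ω, randomStieltjes α g (J N) z t ω p q ∂P) +
        (∫ ω, randomStieltjes α g (J N) z t ω p q ∂P - dysonMatrix α g z t x p q) := by ring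
    rw [e]
    refine (norm_add_le_of_le (norm_add_le_of_le (norm_add_le_of_le (hlip ω) h1) h2) h3).trans ?_
    calc _ ≤ 3 * a⁻¹ * T ^ 3 / t ^ 5 * ε + 2 * T ^ 5 / t ^ 5 * ε + 3 * a⁻¹ * T ^ 3 / t ^ 5 * ε +
          C / t ^ 5 * ε + (a⁻¹ + 1) * C / t ^ 5 * ε := by linarith
      _ = _ := by ring
  · rw [not_le] at hreg
    -- Below the threshold, the a priori bound `O(t⁻¹) = O(t⁴ / t⁵)` is already `O(ε / t⁵)`.
    have hεt : t ^ 4 ≤ C * ε := by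
      have h4 : (t ^ 4) ^ 2 ≤ (C * ε) ^ 2 := by
        calc (t ^ 4) ^ 2 = t ^ 8 := by ring
          _ ≤ C / √N := hreg.le
          _ = C * ε ^ 2 := by rw [hsq]; rfl
          _ ≤ C * C * ε ^ 2 := by gcongr; nlinarith
          _ = _ := by ring
      exact le_of_sq_le_sq h4 (by positivity)
    have h1 : ‖randomStieltjes α g (J N) z t ω p q‖ ≤ a⁻¹ * t⁻¹ :=
      norm_stieltjes_apply_le ha haα _ z ht p q
    have h2 := norm_dysonMatrix_le (g := g) (z := z) hα ht (fun i => (hx i).le) p q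
    have h3 : 0 ≤ (6 * a⁻¹ * T ^ 3 + 2 * T ^ 5 + C) / t ^ 5 * ε := by positivity
    calc _ ≤ a⁻¹ * t⁻¹ + t⁻¹ := (norm_sub_le _ _).trans (add_le_add h1 h2)
      _ = (a⁻¹ + 1) / t ^ 5 * t ^ 4 := by field_simp
      _ ≤ (a⁻¹ + 1) / t ^ 5 * (C * ε) := by gcongr
      _ ≤ (6 * a⁻¹ * T ^ 3 + 2 * T ^ 5 + C) / t ^ 5 * ε + (a⁻¹ + 1) / t ^ 5 * (C * ε) := by
          linarith
      _ = _ := by ring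

lemma opNorm_le_of_entries {A : Matrix (Fin D ⊕ Fin D) (Fin D ⊕ Fin D) ℂ} {δ : ℝ}
    (h : ∀ p q, ‖A p q‖ ≤ δ) : opNorm A ≤ 4 * D ^ 2 * δ := by
  refine (opNorm_le_sum A).trans ((Finset.sum_le_sum fun p _ => Finset.sum_le_sum fun q _ =>
    h p q).trans (le_of_eq ?_))
  simp only [Finset.sum_const, Finset.card_univ, Fintype.card_sum, Fintype.card_fin, nsmul_eq_mul]
  push_cast
  ring

end LocalLaw

/-! ### Both signs of `t` and the conclusion -/

section Main

variable {D : ℕ} {α : Fin D → ℝ} {g : Fin D → Fin D → ℝ}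

/-- The scalar system is solved at `|t|`; the sign of `t` enters only in front of the diagonal. -/
lemma exists_isLimitSolution (hα : ∀ c, 0 < α c) (z : ℂ) {t : ℝ} (ht : t ≠ 0) :
    ∃ x : Fin D ⊕ Fin D → ℝ, (∀ i, 0 < x i) ∧
      dysonMap (covKernel α g) Sum.swap (‖z‖ ^ 2) |t| x = x ∧
      IsLimitSolution α g z t (limitMatrix α g z (SignType.sign t) |t| x) := by
  obtain ⟨x, hx, hfix⟩ := exists_dysonMap_fixedPoint (σ := Sum.swap) (covKernel_nonneg (g := g) hα)
    (sq_nonneg ‖z‖) (abs_pos.2 ht)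
  refine ⟨x, hx, hfix, ?_⟩
  have hs : ((SignType.sign t : ℝ) = 1 ∨ (SignType.sign t : ℝ) = -1) := by
    rcases lt_or_gt_of_ne ht with h | h <;> simp [h]
  have h := isLimitSolution_limitMatrix hα z (abs_pos.2 ht) hs hx hfix
  rwa [sign_mul_abs] at h

/-- The passage from `t` to `-t` changes the sign of the two diagonal blocks and keeps the other
two, for the random matrix by chiral symmetry and for the limit by construction. -/
lemma norm_stieltjes_sub_limitMatrix_neg {N : ℕ} (X : Matrix (Fin N) (Fin N) ℂ) (z : ℂ) {t : ℝ}
    (ht : t ≠ 0) (x : Fin D ⊕ Fin D → ℝ) (p q : Fin D ⊕ Fin D) :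
    ‖stieltjes α X z (Complex.I * (-t : ℝ)) p q - limitMatrix α g z (-1) t x p q‖ =
      ‖stieltjes α X z (Complex.I * t) p q - limitMatrix α g z 1 t x p q‖ := by
  rw [stieltjes_neg X z ht]
  have hneg : ∀ u v : ℂ, ‖-u + v‖ = ‖u - v‖ := fun u v => by
    rw [← norm_neg]; congr 1; ring
  rcases p with p | p <;> rcases q with q | q <;> by_cases h : p = q <;>
    simp [limitMatrix, Matrix.toBlocks₁₁, Matrix.toBlocks₁₂, Matrix.toBlocks₂₁, Matrix.toBlocks₂₂,
      h, hneg]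

/-- The summand `1` in `|K| + 1` makes the fourth moment bound dominate the squared variance `N⁻²`.
-/
lemma isNoise_of_moments {Ω : Type*} [MeasurableSpace Ω] {P : Measure Ω} [IsProbabilityMeasure P]
    {N : ℕ} (hN : N ≠ 0) {J : Fin N → Fin N → Ω → ℂ} (hmeas : ∀ i j, Measurable (J i j))
    (hindep : iIndepFun (fun p : Fin N × Fin N => J p.1 p.2) P)
    (hmean : ∀ i j, ∫ ω, J i j ω ∂P = 0)
    (hvar : ∀ i j, ∫ ω, ‖J i j ω‖ ^ 2 ∂P = 1 / (N : ℝ)) {K : ℝ}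
    (hfourth : ∀ i j, Integrable (fun ω => ‖J i j ω‖ ^ 4) P ∧
      (N : ℝ) ^ 2 * ∫ ω, ‖J i j ω‖ ^ 4 ∂P ≤ K) :
    IsNoise P (fun p : Fin N × Fin N => J p.1 p.2) (N : ℝ)⁻¹ ((|K| + 1) / (N : ℝ) ^ 2) := by
  have hN' : (0 : ℝ) < N := by exact_mod_cast Nat.pos_of_ne_zero hN
  refine ⟨fun p => hmeas _ _, hindep, fun p => hmean _ _, fun p => by rw [hvar, one_div],
    fun p => (hfourth _ _).1, fun p => ?_, ?_⟩
  · rw [le_div_iff₀ (by positivity), mul_comm]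
    exact (hfourth _ _).2.trans (by linarith [le_abs_self K])
  · rw [inv_pow, ← one_div]
    gcongr
    linarith [abs_nonneg K]

end Main

end BlockRandomMatrix

end

open BlockRandomMatrix

theorem mainTheorem3 {Ω : Type*} [MeasurableSpace Ω] (P : Measure Ω) [IsProbabilityMeasure P]
    {D : ℕ} (α : Fin D → ℝ) (hα : ∀ c, 0 < α c) (hsum : ∑ c, α c = 1)
    (g : Fin D → Fin D → ℝ) (hg : ∀ c d, 0 < g c d)
    (J : (N : ℕ) → Fin N → Fin N → Ω → ℂ)
    (hmeas : ∀ N i j, Measurable (J N i j))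
    (hindep : ∀ N, iIndepFun (fun p : Fin N × Fin N => J N p.1 p.2) P)
    (hident : ∀ N i j i' j', IdentDistrib (J N i j) (J N i' j') P P)
    (hmean : ∀ N i j, ∫ ω, J N i j ω ∂P = 0)
    (hvar : ∀ N i j, ∫ ω, ‖J N i j ω‖ ^ 2 ∂P = 1 / (N : ℝ))
    (K : ℝ)
    (hfourth : ∀ N i j, Integrable (fun ω => ‖J N i j ω‖ ^ 4) P ∧
      (N : ℝ) ^ 2 * ∫ ω, ‖J N i j ω‖ ^ 4 ∂P ≤ K) :
    (∀ (z : ℂ) (t : ℝ), t ≠ 0 → ∃! M, BlockRandomMatrix.IsLimitSolution α g z t M) ∧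
    ∀ T : ℝ, 0 < T → ∃ C : ℝ, 0 < C ∧ ∀ᵐ ω ∂P, ∀ᶠ N : ℕ in atTop,
      ∀ (z : ℂ) (t : ℝ), ‖z‖ < T → 0 < |t| → |t| < T →
        ∀ M, BlockRandomMatrix.IsLimitSolution α g z t M →
          BlockRandomMatrix.opNorm
              (BlockRandomMatrix.stieltjes α
                (BlockRandomMatrix.blockMatrix α g (fun i j => J N i j ω)) z (Complex.I * t) - M)
            ≤ C * |t| ^ (-5 : ℤ) * (N : ℝ) ^ (-(1 / 4) : ℝ) := by
  refine ⟨fun z t ht => ?_, fun T hT => ?_⟩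
  · obtain ⟨x, _, _, hx⟩ := exists_isLimitSolution (g := g) hα z ht
    exact ⟨_, hx, fun M hM => isLimitSolution_unique hα ht hM hx⟩
  · obtain ⟨C, hC, h⟩ := ae_eventually_norm_randomStieltjes_sub_le (P := P) (g := g) hα hsum
      (J := J) (K := |K| + 1) (by linarith [abs_nonneg K])
      (fun N hN => isNoise_of_moments hN (hmeas N) (hindep N) (hmean N) (hvar N) (hfourth N))
      hmeas hindep hT
    -- The operator norm is bounded by the sum over the `(2 D)²` entries; the `1` makes the constant
    -- visibly positive.
    refine ⟨4 * D ^ 2 * C + 1, by positivity, ?_⟩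
    filter_upwards [h] with ω hω
    filter_upwards [hω] with N hN z t hz ht0 htT M hM
    have ht : t ≠ 0 := abs_pos.1 ht0
    obtain ⟨x, hx0, hfix, hx⟩ := exists_isLimitSolution (g := g) hα z ht
    rw [isLimitSolution_unique hα ht hM hx]
    have hent := hN z |t| hz ht0 htT x hx0 hfix
    have hbound : ∀ p q, ‖(stieltjes α (blockMatrix α g fun i j => J N i j ω) z (Complex.I * t) -
        limitMatrix α g z (SignType.sign t) |t| x) p q‖ ≤
        C / |t| ^ 5 * (N : ℝ) ^ (-(1 / 4) : ℝ) := by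
      intro p q
      refine le_trans (le_of_eq ?_) (hent p q)
      rw [Matrix.sub_apply, ← limitMatrix_eq_dysonMatrix hfix, randomStieltjes]
      rcases lt_or_gt_of_ne ht with hneg | hpos
      · have e := norm_stieltjes_sub_limitMatrix_neg (α := α) (g := g)
          (blockMatrix α g fun i j => J N i j ω) z (abs_pos.2 ht).ne' x p q
        rw [← e, sign_neg hneg, abs_of_neg hneg, neg_neg]
        simp
      · rw [sign_pos hpos, abs_of_pos hpos]
        simp
    refine (opNorm_le_of_entries hbound).trans ?_
    have e : |t| ^ (-5 : ℤ) = (|t| ^ 5)⁻¹ := by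
      rw [zpow_neg]
      norm_cast
    rw [e]
    have h0 : 0 ≤ (|t| ^ 5)⁻¹ * (N : ℝ) ^ (-(1 / 4) : ℝ) := by positivity
    calc 4 * (D : ℝ) ^ 2 * (C / |t| ^ 5 * (N : ℝ) ^ (-(1 / 4) : ℝ)) =
          4 * D ^ 2 * C * ((|t| ^ 5)⁻¹ * (N : ℝ) ^ (-(1 / 4) : ℝ)) := by ring
      _ ≤ (4 * D ^ 2 * C + 1) * ((|t| ^ 5)⁻¹ * (N : ℝ) ^ (-(1 / 4) : ℝ)) := by
          gcongr
          linarith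
      _ = _ := by ring
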